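/- \textbf{Definitions.} Let $\mathcal F$ be a family of subsets of a finite set $\mathcal U$ and let $\mathcal F_{\max}$ be the set of its inclusion-wise maximal members. An \emph{ordering scheme} $\pi$ assigns to every $F\in\mathcal F$ an ordering $\pi(F)=f_1,\dots,f_{|F|}$ of the elements of $F$ such that $\{f_1,\dots,f_i\}\in\mathcal F$ for all $0\le i<|F|$. For $F_1,F_2\in\mathcal F$ with $\pi(F_2)=f_1,\dots,f_{|F_2|}$, the \emph{proximity} $F_1\,\tilde\cap\,F_2$ is the largest $i\le|F_2|$ with $\{f_1,\dots,f_i\}\subseteq F_1$. For $X\in\mathcal F$ let $X^+=\{x\in\mathcal U\setminus X : X\cup\{x\}\in\mathcal F\}$. The scheme $\pi$ is \emph{prefix-closed} if there are total orders $<_X$ on $X^+$, one for every $X\in\mathcal F$, such that for every $F\in\mathcal F$ and every ordering $f_1,\dots,f_\ell$ of the elements of $F$: $\pi(F)=f_1,\dots,f_\ell$ if and only if $f_{i+1}=\min_{<_{F^i}}\bigl((F^i)^+\cap F\bigr)$ for all $0\le i<\ell$, where $F^i=\{f_1,\dots,f_i\}$. Consider a family of set systems $(\mathcal U_x,\mathcal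 F_x)$ indexed by instances $x$ (given as binary words), where $|\mathcal U_x|$ is polynomially bounded in the length $|x|$ and the elements of $\mathcal U_x$ are numbered. Subsets of $\mathcal U_x$ are represented by characteristic vectors, and "polynomial" means polynomial in $|x|$. A scheme $\pi$ (an ordering scheme $\pi_x$ for every $\mathcal F_x$) is \emph{polynomial-time computable} if $\pi_x(F)$ can be computed from $x$ and $F\in\mathcal F_x$ in polynomial time. It is \emph{proximity searchable} if there is a polynomial-time computable function mapping $x$ and $F\in(\mathcal F_x)_{\max}$ to a finite set $\mathrm{Neighbours}_x(F)\subseteq(\mathcal F_x)_{\max}$ such that for every $x$ and all distinct $F_1,F_2\in(\mathcal F_x)_{\max}$ there is $F'\in\mathrm{Neighbours}_x(F_1)$ with $F'\,\tilde\cap\,F_2>F_1\,\tilde\cap\,F_2$. \textbf{Theorem.} Let $(\mathcal U_x,\mathcal F_x)_x$ be such a family of set systems, and let $\pi$ be a polynomial-time computable ordering scheme for it that is proximity searchable and such that every $\pi_x$ is prefix-closed. Assume that some $F_0\in(\mathcal F_x)_{\max}$ can be computed from $x$ in polynomial time. Then $(\mathcal F_x)_{\max}$ can be enumerated with polynomial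 delay and polynomial space: there is one machine which, on every input $x$, outputs every member of $(\mathcal F_x)_{\max}$ exactly once and nothing else and then halts, such that the time before the first output, between two consecutive outputs, and after the last output, and the space used throughout (emitted solutions are not stored), are bounded by polynomials in $|x|$. (No commutability of the set systems is assumed.) -/

import Mathlib

namespace ProximitySearch

open Turing

/-! ### Set systems, ordering schemes, proximity -/

section SetSystems

variable {U : Type} [DecidableEq U]

/-- The inclusion-wise maximal members of a set system on the ground set `U`. -/
def maxSets (𝓕 : Set (Finset U)) : Set (Finset U) :=
  {F | Maximal (· ∈ 𝓕) F}

/-- A maximal member, regarded as a member. -/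
def maxToMem {𝓕 : Set (Finset U)} (F : maxSets 𝓕) : 𝓕 :=
  ⟨F.1, F.2.prop⟩

/-- An ordering scheme: it lists the elements of every member `F`, each exactly once,
in such a way that all proper prefixes are members too. -/
def IsOrderingScheme (𝓕 : Set (Finset U)) (π : 𝓕 → List U) : Prop :=
  ∀ F : 𝓕, (π F).Nodup ∧ (π F).toFinset = F.1 ∧
    ∀ i < F.1.card, ((π F).take i).toFinset ∈ 𝓕

/-- The `π`-proximity between `F₁` and `F₂`: the largest `i ≤ |F₂|` such that the first `i`
elements of `π F₂` all belong to `F₁`. -/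
def prox {𝓕 : Set (Finset U)} (π : 𝓕 → List U) (F₁ : Finset U) (F₂ : 𝓕) : ℕ :=
  Nat.findGreatest (fun i => ((π F₂).take i).toFinset ⊆ F₁) F₂.1.card

/-- The set `X⁺` of candidates for `X`: the elements that can be added to `X`. -/
def candidates (𝓕 : Set (Finset U)) (X : Finset U) : Set U :=
  {x | x ∉ X ∧ insert x X ∈ 𝓕}

/-- `x` is the least element of `A` for the strict order `r`. -/
def IsMin (r : U → U → Prop) (A : Set U) (x : U) : Prop :=
  x ∈ A ∧ ∀ y ∈ A, y ≠ x → r x y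

/-- Prefix-closed ordering schemes: for a suitable choice of a (strict) total order `r X` on the
candidates for `X`, for each member `X`, the listing `π F` is characterised among all the listings
`l` of `F` by the property that each entry is the least candidate for the set of the entries
before it that lies in `F`. -/
def IsPrefixClosed (𝓕 : Set (Finset U)) (π : 𝓕 → List U) : Prop :=
  ∃ r : Finset U → U → U → Prop,
    (∀ X ∈ 𝓕, IsStrictTotalOrder (candidates 𝓕 X) (fun a b => r X a.1 b.1)) ∧
    ∀ (F : 𝓕) (l : List U), l.Nodup → l.toFinset = F.1 →
      (π F = l ↔ ∀ (i : ℕ) (hi : i < l.length),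
        IsMin (r (l.take i).toFinset) (candidates 𝓕 (l.take i).toFinset ∩ (F.1 : Set U)) l[i])

end SetSystems

/-! ### Words and polynomial-time computability -/

/-- A finite sequence of binary words is written over the alphabet `Option Bool`, the symbol `none`
being put at the end of each word. -/
def encWords (ws : List (List Bool)) : List (Option Bool) :=
  ws.flatMap fun w => w.map some ++ [none]

/-- The function that maps the input words `inp a` to the output words `out a`, for `a : α`, is
computed by a (multi-stack) Turing machine in time polynomial in the length of the input. -/
def PolyTime {α : Type} (inp out : α → List (List Bool)) : Prop :=
  Nonempty (TM2ComputableInPolyTime (fun a => encWords (inp a)) encWords out)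

/-! ### Enumeration machines -/

/-- An enumeration machine is a (multi-stack) Turing machine with a set of output labels:
whenever the machine is at one of these labels, the present content of its output stack is
emitted as one solution. Emitted solutions are not stored. The machine has finitely many stacks,
labels and internal states, and so pushes only finitely many different symbols. -/
structure EnumMachine extends TM2ComputableAux (Option Bool) (Option Bool) where
  /-- the output labels -/
  emit : Set tm.Λ

namespace EnumMachine

variable (M : EnumMachine) (w : List (Option Bool))

/-- The configuration after `t` steps on the input `w` (`none` if the machine has stopped
before). -/
def cfgAt (t : ℕ) : Option M.tm.Cfg :=
  (flip bind M.tm.step)^[t] (some (initList M.tm (w.map M.inputAlphabet.invFun)))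

/-- After `t` steps on the input `w`, the machine emits the word `v`. -/
def EmitsAt (t : ℕ) (v : List (Option Bool)) : Prop :=
  ∃ c, M.cfgAt w t = some c ∧ (∃ l ∈ M.emit, c.l = some l) ∧
    c.stk M.tm.k₁ = v.map M.outputAlphabet.invFun

/-- After exactly `t` steps on the input `w`, the machine halts. -/
def HaltsAt (t : ℕ) : Prop :=
  ∃ c, M.cfgAt w t = some c ∧ c.l = none

/-- The number of symbols on all the stacks of a configuration. -/
def space (c : M.tm.Cfg) : ℕ :=
  ∑ k ∈ @Finset.univ M.tm.K M.tm.kFin, (c.stk k).length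

/-- On the input `w`, the machine halts after having emitted the codes of the elements of `sols`,
each exactly once, and nothing else. At most `delay` steps pass from the start to the first
emission, between two consecutive emissions, and from the last emission to the end; the stacks
never hold more than `spc` symbols in total. -/
structure Enumerates {β : Type} (code : β → List (Option Bool)) (sols : Set β)
    (delay spc : ℕ) : Prop where
  halts : ∃ t, M.HaltsAt w t
  sound : ∀ t v, M.EmitsAt w t v → ∃ F ∈ sols, v = code F
  exactly_once : ∀ F ∈ sols, ∃! t, M.EmitsAt w t (code F)
  delay_le : ∀ t c, M.cfgAt w t = some c → c.l ≠ none →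
    ∃ t', t < t' ∧ t' ≤ t + delay ∧ (M.HaltsAt w t' ∨ ∃ v, M.EmitsAt w t' v)
  space_le : ∀ t c, M.cfgAt w t = some c → M.space c ≤ spc

end EnumMachine

/-! ### Families of set systems -/

/-- An enumeration problem given by set systems: every instance `i`, written as a binary word,
determines a finite ground set `U i`, whose elements are numbered and whose cardinality `size i` is
polynomially bounded in the length of the word, and a family `sets i` of subsets of `U i`. -/
structure SetSystemFamily where
  /-- the instances -/
  Inst : Type
  /-- the binary word by which an instance is given -/
  encode : Inst → List Bool
  /-- the ground set -/
  U : Inst → Type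
  /-- the cardinality of the ground set -/
  size : Inst → ℕ
  /-- the numbering of the ground set -/
  num : ∀ i, U i ≃ Fin (size i)
  /-- the ground set has polynomial size -/
  size_le : ∃ p : Polynomial ℕ, ∀ i, size i ≤ p.eval (encode i).length
  /-- the family of sets -/
  sets : ∀ i, Set (Finset (U i))

namespace SetSystemFamily

variable (S : SetSystemFamily)

instance (i : S.Inst) : DecidableEq (S.U i) :=
  (S.num i).decidableEq

/-- Sets are given by their characteristic vectors. -/
def charVec {i : S.Inst} (F : Finset (S.U i)) : List Bool :=
  List.ofFn fun k : Fin (S.size i) => decide ((S.num i).symm k ∈ F)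

/-- Elements of the ground set are given by their numbers in unary. -/
def elemCode {i : S.Inst} (x : S.U i) : List Bool :=
  List.replicate (S.num i x) true

/-- The ordering scheme (one for each instance) is computable in polynomial time: the input is an
instance `i` and a member `F`, the output is the sequence `π i F`. -/
def PolyTimeOrdering (π : ∀ i, S.sets i → List (S.U i)) : Prop :=
  PolyTime (α := Σ i, S.sets i)
    (fun a => [S.encode a.1, S.charVec a.2.1])
    (fun a => (π a.1 a.2).map S.elemCode)

/-- Proximity searchability: there is a polynomial-time computable function `N` (the neighbours) that
maps a maximal set to a finite set of maximal sets, written as a list, such that for any two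
distinct maximal sets `F₁`, `F₂` some neighbour of `F₁` has a larger proximity to `F₂` than `F₁`
has. -/
def ProximitySearchable (π : ∀ i, S.sets i → List (S.U i)) : Prop :=
  ∃ N : ∀ i, maxSets (S.sets i) → List (maxSets (S.sets i)),
    PolyTime (α := Σ i, maxSets (S.sets i))
      (fun a => [S.encode a.1, S.charVec a.2.1])
      (fun a => (N a.1 a.2).map fun F => S.charVec F.1) ∧
    ∀ (i : S.Inst) (F₁ F₂ : maxSets (S.sets i)), F₁ ≠ F₂ →
      ∃ F' ∈ N i F₁, prox (π i) F₁.1 (maxToMem F₂) < prox (π i) F'.1 (maxToMem F₂)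

/-- One maximal set can be found in polynomial time, for every instance. -/
def PolyTimeMaximalSet : Prop :=
  ∃ F₀ : ∀ i, maxSets (S.sets i),
    PolyTime (fun i => [S.encode i]) (fun i => [S.charVec (F₀ i).1])

/-- The maximal sets can be enumerated with polynomial delay and polynomial space: one machine
does it for all the instances, with bounds polynomial in the length of the instance. -/
def EnumerablePolyDelayPolySpace : Prop :=
  ∃ (M : EnumMachine) (p q : Polynomial ℕ), ∀ i,
    M.Enumerates (encWords [S.encode i]) (fun F => encWords [S.charVec F]) (maxSets (S.sets i))
      (p.eval (S.encode i).length) (q.eval (S.encode i).length)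

end SetSystemFamily

end ProximitySearch

/-! Fix a maximal set `F₀`. Every sequence of elements guides a walk among maximal sets that starts
in `F₀`: the elements are read one by one, and when those read so far no longer all lie in the
current set, the walk moves to the first neighbour that contains them all. Along `π Y` such a
neighbour always exists: a current set that contains the prefix p but not the next element has
proximity |p| to Y, so a neighbour with larger proximity contains one element more
(`exists_neighbour`). Hence the walk ends in a maximal set containing Y, that is, in Y
(`search_eq_self`). The parent of Y is the set abandoned at the last change. It is computed from Y
in polynomial time, and for Y ≠ F₀ the set Y is one of its neighbours (`exists_parent`). The
children of a set are therefore found by computing the parents of its neighbours.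

Prefix-closedness excludes cycles of parents. The core of Y is the shortest prefix of `π Y` whose
walk ends in Y. For Y ≠ F₀ it has the form q ++ [x], where reading x causes the last change and the
walk along q ends in the parent P. All of q lies in P, so where `π P` and q first differ, `π P` has
the smaller candidate; and if q is a prefix of `π P`, the core of P is no longer than q. In every
case the core of P precedes that of Y lexicographically, with respect to the orders on the
candidates for the common prefix (`core_parent_lt`, `exists_order`). So the maximal sets form a tree
with root `F₀`.

The tree is traversed depth first without a recursion stack: on leaving a vertex, its parent and the
later siblings are recomputed, so only the current vertex and its unvisited children are stored.
Emitting a set whenever it is entered would allow long silent ascents. Instead, every second move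
emits the vertex that it enters or leaves. An even number of moves lies between entering and leaving
a vertex, so exactly one of these two moves counts (`exists_tour_aux`, `exists_pairTour`).

The traversal is carried out by a stack machine with registers that hosts the three given machines
as subroutines. Every operation has an explicit time bound in terms of one number B, which bounds
the subroutine calls and the lengths of their data and is polynomial in the instance. Space follows
from time: the registers are short at each output, and a step pushes boundedly many symbols, so the
space exceeds this by at most a constant times the delay (`exists_stackSize_bound`,
`lists_emitCfg`). -/

namespace ProximitySearch

open Turing

/-! ### Program fragments for stack machines -/

section Fragments

variable {K : Type} {Γ : K → Type} {σ : Type}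

/-- Transport a statement along a map of labels, sending `halt` to the exit `x`. -/
def relabel {Λ Λ' : Type} (e : Λ → Λ') (x : Option Λ') : TM2.Stmt Γ Λ σ → TM2.Stmt Γ Λ' σ
  | .push k f q => .push k f (relabel e x q)
  | .peek k f q => .peek k f (relabel e x q)
  | .pop k f q => .pop k f (relabel e x q)
  | .load f q => .load f (relabel e x q)
  | .branch f q₁ q₂ => .branch f (relabel e x q₁) (relabel e x q₂)
  | .goto l => .goto fun v => e (l v)
  | .halt => match x with
    | none => .halt
    | some y => .goto fun _ => y

/-- The configuration that corresponds to `c` after relabelling. -/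
def relabelCfg {Λ Λ' : Type} (e : Λ → Λ') (x : Option Λ') (c : TM2.Cfg Γ Λ σ) :
    TM2.Cfg Γ Λ' σ :=
  ⟨(c.l.map e).or x, c.var, c.stk⟩

variable [DecidableEq K]

theorem stepAux_relabel {Λ Λ' : Type} (e : Λ → Λ') (x : Option Λ') (q : TM2.Stmt Γ Λ σ)
    (v : σ) (S : ∀ k, List (Γ k)) :
    TM2.stepAux (relabel e x q) v S = relabelCfg e x (TM2.stepAux q v S) := by
  induction q generalizing v S with
  | push k f q ih => exact ih _ _
  | peek k f q ih => exact ih _ _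
  | pop k f q ih => exact ih _ _
  | load f q ih => exact ih _ _
  | branch f q₁ q₂ ih₁ ih₂ =>
    simp only [relabel, TM2.stepAux]
    cases f v
    · exact ih₂ _ _
    · exact ih₁ _ _
  | goto l => rfl
  | halt => cases x <;> rfl

/-- `c'` is the configuration after exactly `t` steps from `c`. -/
def StepsTo {Λ : Type} (m : Λ → TM2.Stmt Γ Λ σ) (t : ℕ) (c c' : TM2.Cfg Γ Λ σ) : Prop :=
  (flip bind (TM2.step m))^[t] (some c) = some c'

theorem iterate_bind_none {α : Type} (f : α → Option α) (t : ℕ) :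
    (flip bind f)^[t] none = none := by
  induction t with
  | zero => rfl
  | succ t ih => exact ih

namespace StepsTo

variable {Λ Λ' : Type} {m : Λ → TM2.Stmt Γ Λ σ} {c c' c'' : TM2.Cfg Γ Λ σ} {s t : ℕ}

theorem refl (c : TM2.Cfg Γ Λ σ) : StepsTo m 0 c c := rfl

theorem trans (h : StepsTo m s c c') (h' : StepsTo m t c' c'') : StepsTo m (s + t) c c'' := by
  unfold StepsTo at *
  rw [Nat.add_comm, Function.iterate_add_apply, h, h']

theorem one {l : Λ} {v : σ} {S : ∀ k, List (Γ k)} (h : TM2.stepAux (m l) v S = c') :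
    StepsTo m 1 ⟨some l, v, S⟩ c' :=
  congrArg some h

theorem of_zero (h : StepsTo m 0 c c') : c = c' := Option.some.inj h

theorem unique (h : StepsTo m t c c') (h' : StepsTo m t c c'') : c' = c'' :=
  Option.some.inj (h.symm.trans h')

theorem not_succ_of_halted (hc : c.l = none) : ¬ StepsTo m (t + 1) c c' := by
  obtain ⟨l, v, S⟩ := c
  subst hc
  intro h
  exact Option.some_ne_none _ (h.symm.trans (iterate_bind_none _ t))

theorem of_succ (h : StepsTo m (t + 1) c c') :
    ∃ l v S, c = ⟨some l, v, S⟩ ∧ StepsTo m t (TM2.stepAux (m l) v S) c' := by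
  obtain ⟨_ | l, v, S⟩ := c
  · exact absurd h (not_succ_of_halted rfl)
  · exact ⟨l, v, S, rfl, h⟩

theorem split (h : StepsTo m (s + t) c c'') : ∃ c', StepsTo m s c c' ∧ StepsTo m t c' c'' := by
  unfold StepsTo at *
  rw [Nat.add_comm, Function.iterate_add_apply] at h
  cases h' : (flip bind (TM2.step m))^[s] (some c) with
  | none => rw [h', iterate_bind_none] at h; exact absurd h.symm (Option.some_ne_none _)
  | some c' => exact ⟨c', rfl, h'.symm ▸ h⟩

theorem before (h : StepsTo m t c c') (hs : s < t) :
    ∃ l v S, StepsTo m s c ⟨some l, v, S⟩ := by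
  obtain ⟨r, rfl⟩ : ∃ r, t = s + (r + 1) := ⟨t - s - 1, by omega⟩
  obtain ⟨c₁, h₁, h₂⟩ := h.split
  obtain ⟨l, v, S, rfl, -⟩ := h₂.of_succ
  exact ⟨l, v, S, h₁⟩

/-- A halted guest corresponds to a host at the exit `x`, which may run on. Counting `t + 1` steps
makes the induction pass only through configurations that still have a label, so guest and host stay
in step. -/
theorem host {e : Λ → Λ'} {x : Option Λ'} {m' : Λ' → TM2.Stmt Γ Λ' σ}
    (hm : ∀ l, m' (e l) = relabel e x (m l)) {l : Λ} {v : σ} {S : ∀ k, List (Γ k)}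
    (h : StepsTo m (t + 1) ⟨some l, v, S⟩ c') :
    StepsTo m' (t + 1) ⟨some (e l), v, S⟩ (relabelCfg e x c') := by
  induction t generalizing l v S with
  | zero =>
    obtain ⟨l', v', S', hc, h⟩ := h.of_succ
    cases hc
    exact h.of_zero ▸ one (by rw [hm, stepAux_relabel])
  | succ t ih =>
    obtain ⟨l, v, S, hc, h⟩ := h.of_succ
    cases hc
    have h1 : StepsTo m' 1 ⟨some (e l), v, S⟩ (relabelCfg e x (TM2.stepAux (m l) v S)) :=
      one (by rw [hm, stepAux_relabel])
    obtain ⟨l₂, v₂, S₂, h2, -⟩ := h.of_succ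
    rw [h2] at h h1
    rw [Nat.add_comm]
    exact h1.trans (ih h)

theorem host_exit {e : Λ → Λ'} {x : Option Λ'} {m' : Λ' → TM2.Stmt Γ Λ' σ}
    (hm : ∀ l, m' (e l) = relabel e x (m l)) {l : Λ} {v v' : σ} {S S' : ∀ k, List (Γ k)}
    (h : StepsTo m t ⟨some l, v, S⟩ ⟨none, v', S'⟩) :
    StepsTo m' t ⟨some (e l), v, S⟩ ⟨x, v', S'⟩ := by
  cases t with
  | zero => cases h.of_zero
  | succ t => exact h.host hm

/-- Before a hosted program exits, the host sees only labels in the range of `e`. This is what shows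
that no output label occurs during a subprogram. -/
theorem host_before {e : Λ → Λ'} {x : Option Λ'} {m' : Λ' → TM2.Stmt Γ Λ' σ}
    (hm : ∀ l, m' (e l) = relabel e x (m l)) {l : Λ} {v : σ} {S : ∀ k, List (Γ k)}
    (h : StepsTo m t ⟨some l, v, S⟩ c') (hs : s < t) :
    ∃ l' v' S', StepsTo m' s ⟨some (e l), v, S⟩ ⟨some (e l'), v', S'⟩ := by
  obtain ⟨l', v', S', h'⟩ := h.before hs
  cases s with
  | zero => exact ⟨l, v, S, refl _⟩
  | succ s => exact ⟨l', v', S', h'.host hm⟩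

end StepsTo

/-- A program fragment: a stack machine program with an entry label; halting means leaving the
fragment. -/
structure Frag (Γ : K → Type) (σ : Type) where
  /-- the labels -/
  Λ : Type
  /-- there are finitely many labels -/
  fin : Fintype Λ
  /-- the entry label -/
  entry : Λ
  /-- the program -/
  code : Λ → TM2.Stmt Γ Λ σ

namespace Frag

/-- The fragment `F` leads from the memory `(v, S)` to the memory `(v', S')` in at most `T`
steps. -/
def Runs (F : Frag Γ σ) (v : σ) (S : ∀ k, List (Γ k)) (T : ℕ) (v' : σ) (S' : ∀ k, List (Γ k)) :
    Prop :=
  ∃ t ≤ T, StepsTo F.code t ⟨some F.entry, v, S⟩ ⟨none, v', S'⟩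

/-- A single step. -/
def block (q : TM2.Stmt Γ Unit σ) : Frag Γ σ := ⟨Unit, inferInstance, (), fun _ => q⟩

/-- Sequential composition. -/
def seq (F G : Frag Γ σ) : Frag Γ σ :=
  haveI := F.fin; haveI := G.fin
  ⟨F.Λ ⊕ G.Λ, inferInstance, .inl F.entry,
    Sum.elim (fun l => relabel .inl (some (.inr G.entry)) (F.code l))
      (fun l => relabel .inr none (G.code l))⟩

/-- Case distinction. -/
def ite (p : σ → Bool) (F G : Frag Γ σ) : Frag Γ σ :=
  haveI := F.fin; haveI := G.fin
  ⟨Option (F.Λ ⊕ G.Λ), inferInstance, none, fun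
    | none => .branch p (.goto fun _ => some (.inl F.entry)) (.goto fun _ => some (.inr G.entry))
    | some (.inl l) => relabel (some ∘ .inl) none (F.code l)
    | some (.inr l) => relabel (some ∘ .inr) none (G.code l)⟩

/-- Conditional loop. -/
def loop (p : σ → Bool) (F : Frag Γ σ) : Frag Γ σ :=
  haveI := F.fin
  ⟨Option F.Λ, inferInstance, none, fun
    | none => .branch p (.goto fun _ => some F.entry) .halt
    | some l => relabel some (some none) (F.code l)⟩

variable {F G : Frag Γ σ} {v v' v'' : σ} {S S' S'' : ∀ k, List (Γ k)} {T T' : ℕ} {p : σ → Bool}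

theorem Runs.mono (h : F.Runs v S T v' S') (hT : T ≤ T') : F.Runs v S T' v' S' :=
  let ⟨t, ht, h⟩ := h
  ⟨t, ht.trans hT, h⟩

theorem runs_block {q : TM2.Stmt Γ Unit σ} (h : TM2.stepAux q v S = ⟨none, v', S'⟩) :
    (block q).Runs v S 1 v' S' :=
  ⟨1, le_rfl, StepsTo.one h⟩

theorem Runs.seq (h : F.Runs v S T v' S') (h' : G.Runs v' S' T' v'' S'') :
    (F.seq G).Runs v S (T + T') v'' S'' := by
  obtain ⟨t, ht, h⟩ := h
  obtain ⟨t', ht', h'⟩ := h'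
  exact ⟨t + t', by omega, (h.host_exit (m' := (F.seq G).code) fun _ => rfl).trans
    (h'.host_exit (e := Sum.inr) fun _ => rfl)⟩

theorem Runs.ite_true (hp : p v = true) (h : F.Runs v S T v' S') :
    (ite p F G).Runs v S (1 + T) v' S' := by
  obtain ⟨t, ht, h⟩ := h
  refine ⟨1 + t, by omega, StepsTo.trans (StepsTo.one ?_)
    (h.host_exit (e := some ∘ Sum.inl) fun _ => rfl)⟩
  simp [ite, hp]

theorem Runs.ite_false (hp : p v = false) (h : G.Runs v S T v' S') :
    (ite p F G).Runs v S (1 + T) v' S' := by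
  obtain ⟨t, ht, h⟩ := h
  refine ⟨1 + t, by omega, StepsTo.trans (StepsTo.one ?_)
    (h.host_exit (e := some ∘ Sum.inr) fun _ => rfl)⟩
  simp [ite, hp]

theorem runs_loop_done (hp : p v = false) : (loop p F).Runs v S 1 v S := by
  refine ⟨1, le_rfl, StepsTo.one ?_⟩
  simp [loop, hp]

theorem Runs.loop (hp : p v = true) (h : F.Runs v S T v' S')
    (h' : (loop p F).Runs v' S' T' v'' S'') : (loop p F).Runs v S (1 + T + T') v'' S'' := by
  obtain ⟨t, ht, h⟩ := h
  obtain ⟨t', ht', h'⟩ := h'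
  refine ⟨1 + t + t', by omega, StepsTo.trans (StepsTo.trans (StepsTo.one ?_)
    (h.host_exit (e := some) (m' := (Frag.loop p F).code) fun _ => rfl)) h'⟩
  simp [Frag.loop, hp]

end Frag

end Fragments

end ProximitySearch

namespace ProximitySearch

open Turing

/-! ### Space bounds -/

section Space

variable {K : Type} [DecidableEq K] [Fintype K] {Γ : K → Type} {σ Λ : Type}

/-- The number of symbols on all the tapes. -/
def stackSize (S : ∀ k, List (Γ k)) : ℕ := ∑ k, (S k).length

theorem stackSize_update (S : ∀ k, List (Γ k)) (k : K) (x : List (Γ k)) :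
    stackSize (Function.update S k x) + (S k).length = stackSize S + x.length := by
  unfold stackSize
  rw [← Finset.add_sum_erase _ _ (Finset.mem_univ k),
    ← Finset.add_sum_erase _ (fun k => (S k).length) (Finset.mem_univ k),
    Function.update_self,
    Finset.sum_congr rfl fun j hj => by rw [Function.update_of_ne (Finset.ne_of_mem_erase hj)]]
  omega

/-- An upper bound for the number of push operations in a statement. -/
def pushCount : TM2.Stmt Γ Λ σ → ℕ
  | .push _ _ q => pushCount q + 1
  | .peek _ _ q => pushCount q
  | .pop _ _ q => pushCount q
  | .load _ q => pushCount q
  | .branch _ q₁ q₂ => pushCount q₁ + pushCount q₂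
  | .goto _ => 0
  | .halt => 0

theorem stackSize_stepAux (q : TM2.Stmt Γ Λ σ) (v : σ) (S : ∀ k, List (Γ k)) :
    stackSize (TM2.stepAux q v S).stk ≤ stackSize S + pushCount q := by
  induction q generalizing v S with
  | push k f q ih =>
    refine (ih _ _).trans ?_
    have := stackSize_update S k (f v :: S k)
    simp only [List.length_cons, pushCount] at *
    omega
  | peek k f q ih => exact ih _ _
  | pop k f q ih =>
    refine (ih _ _).trans ?_
    have := stackSize_update S k (S k).tail
    simp only [List.length_tail, pushCount] at *
    omega
  | load f q ih => exact ih _ _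
  | branch f q₁ q₂ ih₁ ih₂ =>
    simp only [TM2.stepAux, pushCount]
    cases f v
    · exact (ih₂ _ _).trans (by omega)
    · exact (ih₁ _ _).trans (by omega)
  | goto l => exact le_rfl
  | halt => exact le_rfl

/-- Each step executes one of finitely many statements, so the sum of their push counts bounds the
growth in one step. Time bounds thus become bounds for space and for the lengths of outputs. -/
theorem exists_stackSize_bound [Fintype Λ] (m : Λ → TM2.Stmt Γ Λ σ) :
    ∃ C, ∀ t c c', StepsTo m t c c' → stackSize c'.stk ≤ stackSize c.stk + C * t := by
  refine ⟨∑ l, pushCount (m l), fun t => ?_⟩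
  induction t with
  | zero => intro c c' h; rw [h.of_zero]; omega
  | succ t ih =>
    intro c c' h
    obtain ⟨l, v, S, rfl, h⟩ := h.of_succ
    have h1 := ih _ _ h
    have h2 := stackSize_stepAux (m l) v S
    have h3 : pushCount (m l) ≤ ∑ l, pushCount (m l) :=
      Finset.single_le_sum (f := fun l => pushCount (m l)) (fun _ _ => Nat.zero_le _)
        (Finset.mem_univ l)
    rw [Nat.mul_succ]
    simp only at *
    omega

end Space

/-! ### Registers and subroutines -/

/-- The symbols of the registers. -/
abbrev Sym := Option Bool

section Registers

set_option linter.unusedSectionVars false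

variable {J : Type} [DecidableEq J] (A : J → TM2ComputableAux Sym Sym) (R : Type) [DecidableEq R]

/-- The stacks: the registers and the tapes of the subroutines. -/
abbrev Stack := R ⊕ (Σ j, (A j).tm.K)

/-- The alphabets of the tapes. -/
abbrev Alph : Stack A R → Type
  | .inl _ => Sym
  | .inr p => (A p.1).tm.Γ p.2

/-- The flags: two symbols that have been read, and a truth value. -/
abbrev Flags := Option Sym × Option Sym × Bool

/-- The internal states: the flags and the internal states of the subroutines. -/
abbrev Vars := Flags × ∀ j, (A j).tm.σ

/-- Program fragments over registers with subroutines. -/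
abbrev Prog := Frag (Alph A R) (Vars A)

variable {A R}

/-- The tapes with given registers and subroutine tapes. -/
def tapes (ρ : R → List Sym) (I : ∀ j k, List ((A j).tm.Γ k)) : ∀ k, List (Alph A R k)
  | .inl r => ρ r
  | .inr p => I p.1 p.2

@[simp] theorem tapes_inl (ρ : R → List Sym) (I : ∀ j k, List ((A j).tm.Γ k)) (r : R) :
    tapes ρ I (.inl r) = ρ r := rfl

@[simp] theorem tapes_inr (ρ : R → List Sym) (I : ∀ j k, List ((A j).tm.Γ k)) (p) :
    tapes ρ I (.inr p) = I p.1 p.2 := rfl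

@[simp] theorem update_tapes_inl (ρ : R → List Sym) (I : ∀ j k, List ((A j).tm.Γ k)) (r : R)
    (x : List Sym) :
    Function.update (tapes ρ I) (.inl r) x = tapes (Function.update ρ r x) I := by
  funext k
  rcases k with s | p
  · by_cases h : s = r
    · subst h; simp
    · rw [Function.update_of_ne (by simpa using h)]; simp [h]
  · simp

theorem update_tapes_inr (ρ : R → List Sym) (I : ∀ j k, List ((A j).tm.Γ k)) (j : J)
    (S : ∀ k, List ((A j).tm.Γ k)) (k : (A j).tm.K) (x : List ((A j).tm.Γ k)) :
    Function.update (tapes ρ (Function.update I j S)) (.inr ⟨j, k⟩) x =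
      tapes ρ (Function.update I j (Function.update S k x)) := by
  funext k'
  rcases k' with s | ⟨j', k'⟩
  · simp
  · by_cases hj : j' = j
    · subst hj
      by_cases hk : k' = k
      · subst hk; simp
      · rw [Function.update_of_ne (by simpa using hk)]; simp [hk]
    · rw [Function.update_of_ne (by simp [hj])]; simp [hj]

/-- The statement of a subroutine as a statement of the whole machine. -/
def embed (j : J) {Λ : Type} : TM2.Stmt (A j).tm.Γ Λ (A j).tm.σ → TM2.Stmt (Alph A R) Λ (Vars A)
  | .push k f q => .push (.inr ⟨j, k⟩) (fun s => f (s.2 j)) (embed j q)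
  | .peek k f q => .peek (.inr ⟨j, k⟩)
      (fun s o => (s.1, Function.update s.2 j (f (s.2 j) o))) (embed j q)
  | .pop k f q => .pop (.inr ⟨j, k⟩)
      (fun s o => (s.1, Function.update s.2 j (f (s.2 j) o))) (embed j q)
  | .load f q => .load (fun s => (s.1, Function.update s.2 j (f (s.2 j)))) (embed j q)
  | .branch f q₁ q₂ => .branch (fun s => f (s.2 j)) (embed j q₁) (embed j q₂)
  | .goto l => .goto fun s => l (s.2 j)
  | .halt => .halt

/-- An embedded statement touches only the component `j` of the states and tapes. Writing these
components as an update at `j` lets the induction run while everything else stays arbitrary. -/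
theorem stepAux_embed (j : J) {Λ : Type} (q : TM2.Stmt (A j).tm.Γ Λ (A j).tm.σ) (v : Flags)
    (ρ : R → List Sym) (st : ∀ j, (A j).tm.σ) (I : ∀ j k, List ((A j).tm.Γ k))
    (s : (A j).tm.σ) (S : ∀ k, List ((A j).tm.Γ k)) :
    TM2.stepAux (embed j q) (v, Function.update st j s) (tapes ρ (Function.update I j S)) =
      ⟨(TM2.stepAux q s S).l, (v, Function.update st j (TM2.stepAux q s S).var),
        tapes ρ (Function.update I j (TM2.stepAux q s S).stk)⟩ := by
  induction q generalizing s S with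
  | push k f q ih =>
    simp only [embed, TM2.stepAux, Function.update_self, tapes_inr, update_tapes_inr]
    exact ih _ _
  | peek k f q ih =>
    simp only [embed, TM2.stepAux, Function.update_self, tapes_inr, Function.update_idem]
    exact ih _ _
  | pop k f q ih =>
    simp only [embed, TM2.stepAux, Function.update_self, tapes_inr, update_tapes_inr,
      Function.update_idem]
    exact ih _ _
  | load f q ih =>
    simp only [embed, TM2.stepAux, Function.update_self, Function.update_idem]
    exact ih _ _
  | branch f q₁ q₂ ih₁ ih₂ =>
    simp only [embed, TM2.stepAux, Function.update_self]
    cases f s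
    · exact ih₂ _ _
    · exact ih₁ _ _
  | goto l => simp [embed]
  | halt => rfl

/-- The program of a subroutine. -/
def body (j : J) : Prog A R :=
  ⟨(A j).tm.Λ, (A j).tm.ΛFin, (A j).tm.main, fun l => embed j ((A j).tm.m l)⟩

theorem stepsTo_body (j : J) {t : ℕ} {c c' : (A j).tm.Cfg} (v : Flags)
    (ρ : R → List Sym) (st : ∀ j, (A j).tm.σ) (I : ∀ j k, List ((A j).tm.Γ k))
    (h : StepsTo (A j).tm.m t c c') :
    StepsTo (body j).code t
      ⟨c.l, (v, Function.update st j c.var), tapes ρ (Function.update I j c.stk)⟩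
      ⟨c'.l, (v, Function.update st j c'.var), tapes ρ (Function.update I j c'.stk)⟩ := by
  induction t generalizing c with
  | zero => rw [h.of_zero]; exact .refl _
  | succ t ih =>
    obtain ⟨l, s, S, rfl, h⟩ := StepsTo.of_succ h
    rw [Nat.add_comm]
    exact (StepsTo.one (stepAux_embed j _ v ρ st I s S)).trans (ih h)

/-- The initial states of the subroutines. -/
def idle : ∀ j, (A j).tm.σ := fun j => (A j).tm.initialState

/-- The program `F` changes the registers and the truth value as indicated in at most `T` steps;
before and after it the tapes of the subroutines are empty. -/
def Does (F : Prog A R) (v : Flags) (ρ : R → List Sym) (T : ℕ) (v' : Flags) (ρ' : R → List Sym) :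
    Prop :=
  F.Runs (v, idle) (tapes ρ fun _ _ => []) T (v', idle) (tapes ρ' fun _ _ => [])

/-- The configuration of a subroutine's tapes with only one of them nonempty. -/
def single {K : Type} [DecidableEq K] {Γ : K → Type} (k : K) (w : List (Γ k)) :
    ∀ k, List (Γ k) := Function.update (fun _ => []) k w

theorem stk_initList (tm : FinTM2) (w : List (tm.Γ tm.k₀)) :
    (initList tm w).stk = single tm.k₀ w := by
  funext k
  by_cases h : k = tm.k₀
  · subst h; simp [initList, single]
  · simp [initList, single, h]

theorem stk_haltList (tm : FinTM2) (w : List (tm.Γ tm.k₁)) :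
    (haltList tm w).stk = single tm.k₁ w := by
  funext k
  by_cases h : k = tm.k₁
  · subst h; simp [haltList, single]
  · simp [haltList, single, h]

/-- Pop a symbol from a register. -/
abbrev popTop {Λ : Type} (r : R) (q : TM2.Stmt (Alph A R) Λ (Vars A)) :
    TM2.Stmt (Alph A R) Λ (Vars A) :=
  .pop (.inl r) (fun s o => ((o, s.1.2), s.2)) q

/-- The top symbol is present. -/
abbrev hasTop (s : Vars A) : Bool := s.1.1.isSome

/-- Move a register to the input stack of a subroutine, in reverse order. -/
def loadInput (j : J) (r : R) : Prog A R :=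
  (Frag.block (popTop r .halt)).seq <| Frag.loop hasTop <| Frag.block <|
    .push (.inr ⟨j, (A j).tm.k₀⟩) (fun s => (A j).inputAlphabet.symm (s.1.1.getD none)) <|
      popTop r .halt

/-- Move the output stack of a subroutine to a register, in reverse order. -/
def storeOutput (j : J) (r : R) : Prog A R :=
  let q : TM2.Stmt (Alph A R) Unit (Vars A) := .pop (.inr ⟨j, (A j).tm.k₁⟩)
    (fun s o => ((o.map (A j).outputAlphabet, s.1.2), s.2)) .halt
  (Frag.block q).seq <| Frag.loop hasTop <| Frag.block <|
    .push (.inl r) (fun s => s.1.1.getD none) q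

/-- Replace the content of a register, read from bottom to top, by the value of a subroutine. -/
def call (j : J) (r : R) : Prog A R :=
  (loadInput j r).seq ((body j).seq (storeOutput j r))

theorem single_nil {K : Type} [DecidableEq K] {Γ : K → Type} (k : K) :
    single k ([] : List (Γ k)) = fun _ => [] := by
  simp [single]

/-- Loop invariant: `x` has been popped but not yet pushed, `u` already lies on the input stack, and
`w` remains in the register. -/
theorem loadInput_loop (j : J) (r : R) (b : Bool) (w u : List Sym) (ρ : R → List Sym) (x : Sym) :
    (Frag.loop hasTop (Frag.block
      (.push (.inr ⟨j, (A j).tm.k₀⟩) (fun s => (A j).inputAlphabet.symm (s.1.1.getD none)) <|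
      popTop r .halt) : Prog A R)).Runs ((some x, none, b), idle)
      (tapes (Function.update ρ r w)
        (Function.update (fun _ _ => []) j (single _ (u.map (A j).inputAlphabet.symm))))
      (2 * w.length + 3) ((none, none, b), idle) (tapes (Function.update ρ r [])
        (Function.update (fun _ _ => []) j
          (single _ ((w.reverse ++ x :: u).map (A j).inputAlphabet.symm)))) := by
  induction w generalizing u x with
  | nil =>
    refine (Frag.Runs.loop (v' := ((none, none, b), idle)) rfl (Frag.runs_block ?_)
      (Frag.runs_loop_done rfl)).mono ?_
    · simp [update_tapes_inr, single]
    · simp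
  | cons y w ih =>
    have := ih (x :: u) y
    rw [show w.reverse ++ y :: x :: u = (y :: w).reverse ++ x :: u by simp] at this
    refine (Frag.Runs.loop (v := ((some x, none, b), idle)) (v' := ((some y, none, b), idle)) rfl
      (Frag.runs_block ?_) this).mono ?_
    · simp [update_tapes_inr, single]
    · simp; omega

theorem runs_loadInput (j : J) (r : R) (b : Bool) (w : List Sym) (ρ : R → List Sym)
    (hr : ρ r = w.reverse) :
    (loadInput j r : Prog A R).Runs ((none, none, b), idle) (tapes ρ fun _ _ => [])
      (2 * w.length + 4) ((none, none, b), idle) (tapes (Function.update ρ r [])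
        (Function.update (fun _ _ => []) j
          (single _ (w.map (A j).inputAlphabet.symm)))) := by
  obtain ⟨u, rfl⟩ : ∃ u : List Sym, u.reverse = w := ⟨_, w.reverse_reverse⟩
  rw [List.reverse_reverse] at hr
  cases u with
  | nil =>
    refine (Frag.Runs.seq (v' := ((none, none, b), idle)) (Frag.runs_block ?_)
      (Frag.runs_loop_done rfl)).mono ?_
    · simp [hr, single_nil]
    · simp
  | cons x u =>
    rw [List.reverse_cons]
    refine (Frag.Runs.seq (Γ := Alph A R) (Frag.runs_block ?_) (loadInput_loop j r b u [] ρ x)).mono ?_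
    · simp [hr, single_nil]
    · simp; omega

theorem storeOutput_loop (j : J) (r : R) (b : Bool) (w : List Sym) (ρ : R → List Sym) (x : Sym) :
    (Frag.loop hasTop (Frag.block
      (.push (.inl r) (fun s => s.1.1.getD none) <| .pop (.inr ⟨j, (A j).tm.k₁⟩)
        (fun s o => ((o.map (A j).outputAlphabet, s.1.2), s.2)) .halt) : Prog A R)).Runs
      ((some x, none, b), idle) (tapes ρ
        (Function.update (fun _ _ => []) j (single _ (w.map (A j).outputAlphabet.symm))))
      (2 * w.length + 3) ((none, none, b), idle)
      (tapes (Function.update ρ r (w.reverse ++ x :: ρ r)) (fun _ _ => [])) := by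
  induction w generalizing ρ x with
  | nil =>
    refine (Frag.Runs.loop (v' := ((none, none, b), idle)) rfl (Frag.runs_block ?_)
      (Frag.runs_loop_done rfl)).mono ?_
    · simp [single]
    · simp
  | cons y w ih =>
    have := ih (Function.update ρ r (x :: ρ r)) y
    simp only [Function.update_self, Function.update_idem] at this
    refine (Frag.Runs.loop (v := ((some x, none, b), idle)) (v' := ((some y, none, b), idle)) rfl
      (Frag.runs_block ?_)
      (by simpa using this)).mono ?_
    · simp [update_tapes_inr, single]
    · simp; omega

theorem runs_storeOutput (j : J) (r : R) (b : Bool) (w : List Sym) (ρ : R → List Sym)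
    (hr : ρ r = []) :
    (storeOutput j r : Prog A R).Runs ((none, none, b), idle) (tapes ρ
        (Function.update (fun _ _ => []) j (single _ (w.map (A j).outputAlphabet.symm))))
      (2 * w.length + 4) ((none, none, b), idle)
      (tapes (Function.update ρ r w.reverse) (fun _ _ => [])) := by
  cases w with
  | nil =>
    refine (Frag.Runs.seq (v' := ((none, none, b), idle)) (Frag.runs_block ?_)
      (Frag.runs_loop_done rfl)).mono ?_
    · simp only [TM2.stepAux, tapes_inr, Function.update_self, update_tapes_inr]
      rw [show Function.update ρ r [].reverse = ρ by
        rw [List.reverse_nil, ← hr, Function.update_eq_self]]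
      simp [single]
    · simp
  | cons x w =>
    have := storeOutput_loop (A := A) j r b w ρ x
    rw [hr, ← List.reverse_cons] at this
    refine (Frag.Runs.seq (v' := ((some x, none, b), idle)) (Frag.runs_block ?_)
      this).mono ?_
    · simp [single, update_tapes_inr]
    · simp; omega

/-- Moving data between a register and a tape reverses it, so the register holds the reversed input
before the call and the reversed output after it. -/
theorem does_call (j : J) (r : R) (b : Bool) {w w' : List Sym} {n : ℕ} (ρ : R → List Sym)
    (h : TM2OutputsInTime (A j).tm (w.map (A j).inputAlphabet.invFun)
      (some (w'.map (A j).outputAlphabet.invFun)) n) (hr : ρ r = w.reverse) :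
    Does (A := A) (call j r) (none, none, b) ρ (2 * w.length + n + 2 * w'.length + 8)
      (none, none, b) (Function.update ρ r w'.reverse) := by
  have h1 : StepsTo (A j).tm.m h.steps (initList (A j).tm (w.map (A j).inputAlphabet.invFun))
    (haltList (A j).tm (w'.map (A j).outputAlphabet.invFun)) := h.evals_in_steps
  have h2 := stepsTo_body j (none, none, b) (Function.update ρ r []) idle (fun _ _ => []) h1
  rw [stk_initList, stk_haltList] at h2
  -- A machine that has produced its output is back in its initial state with all other tapes empty,
  -- so the subroutine can be called again.
  have e : Function.update idle j (A j).tm.initialState = (idle : ∀ j, (A j).tm.σ) :=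
    Function.update_eq_self j idle
  have h3 : (body j).Runs ((none, none, b), idle) _ n ((none, none, b), idle) _ :=
    ⟨h.steps, h.steps_le_m, by
      simp only [initList, haltList, e] at h2
      exact h2⟩
  have h4 := ((runs_loadInput j r b w ρ hr).seq (h3.seq
    (runs_storeOutput j r b w' (Function.update ρ r []) (by simp))))
  rw [Function.update_idem] at h4
  exact h4.mono (by omega)

end Registers

end ProximitySearch

namespace ProximitySearch

open Turing

/-! ### Operations on registers -/

/-- A word with its end mark. -/
def encWord (w : List Bool) : List Sym := w.map some ++ [none]

theorem encWords_cons (w : List Bool) (ws : List (List Bool)) :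
    encWords (w :: ws) = encWord w ++ encWords ws := rfl

@[simp] theorem length_encWord (w : List Bool) : (encWord w).length = w.length + 1 := by
  simp [encWord]

section Registers

set_option linter.unusedSectionVars false

variable {J : Type} [DecidableEq J] {A : J → TM2ComputableAux Sym Sym} {R : Type} [DecidableEq R]

/-- The flags between two operations. -/
abbrev flag (b : Bool) : Flags := (none, none, b)

/-- The truth value. -/
abbrev hasFlag (s : Vars A) : Bool := s.1.2.2

/-! ### Running times of composed register programs. -/

section Combinators

variable {F G : Prog A R} {v v' v'' : Flags} {ρ ρ' ρ'' : R → List Sym} {T T' : ℕ} {b b' : Bool}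

theorem Does.mono (h : Does F v ρ T v' ρ') (hT : T ≤ T') : Does F v ρ T' v' ρ' :=
  Frag.Runs.mono h hT

theorem Does.weaken (h : Does F v ρ T v' ρ') (hT : T ≤ T') (hρ : ρ' = ρ'') :
    Does F v ρ T' v' ρ'' :=
  hρ ▸ h.mono hT

theorem Does.seq (h : Does F v ρ T v' ρ') (h' : Does G v' ρ' T' v'' ρ'') :
    Does (F.seq G) v ρ (T + T') v'' ρ'' :=
  Frag.Runs.seq h h'

theorem Does.ite_true (h : Does F (flag true) ρ T v' ρ') :
    Does (Frag.ite hasFlag F G) (flag true) ρ (1 + T) v' ρ' :=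
  Frag.Runs.ite_true rfl h

theorem Does.ite_false (h : Does G (flag false) ρ T v' ρ') :
    Does (Frag.ite hasFlag F G) (flag false) ρ (1 + T) v' ρ' :=
  Frag.Runs.ite_false rfl h

theorem does_loop_false : Does (Frag.loop hasFlag F) (flag false) ρ 1 (flag false) ρ :=
  Frag.runs_loop_done rfl

theorem Does.loop_true (h : Does F (flag true) ρ T v' ρ')
    (h' : Does (Frag.loop hasFlag F) v' ρ' T' v'' ρ'') :
    Does (Frag.loop hasFlag F) (flag true) ρ (1 + T + T') v'' ρ'' :=
  Frag.Runs.loop rfl h h'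

theorem does_loop_not_true :
    Does (Frag.loop (fun s => !hasFlag s) F) (flag true) ρ 1 (flag true) ρ :=
  Frag.runs_loop_done rfl

theorem Does.loop_not_false (h : Does F (flag false) ρ T v' ρ')
    (h' : Does (Frag.loop (fun s => !hasFlag s) F) v' ρ' T' v'' ρ'') :
    Does (Frag.loop (fun s => !hasFlag s) F) (flag false) ρ (1 + T + T') v'' ρ'' :=
  Frag.Runs.loop rfl h h'

end Combinators

/-- Do nothing. -/
def skip : Prog A R := Frag.block .halt

theorem does_skip (v : Flags) (ρ : R → List Sym) : Does (A := A) skip v ρ 1 v ρ :=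
  Frag.runs_block rfl

/-- Push a symbol. -/
def pushSym (r : R) (x : Sym) : Prog A R := Frag.block (.push (.inl r) (fun _ => x) .halt)

theorem does_pushSym (r : R) (x : Sym) (v : Flags) (ρ : R → List Sym) :
    Does (A := A) (pushSym r x) v ρ 1 v (Function.update ρ r (x :: ρ r)) :=
  Frag.runs_block (by simp)

/-- Set the truth value. -/
def setFlag (b : Bool) : Prog A R := Frag.block (.load (fun s => (flag b, s.2)) .halt)

theorem does_setFlag (b : Bool) (v : Flags) (ρ : R → List Sym) :
    Does (A := A) (setFlag b) v ρ 1 (flag b) ρ :=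
  Frag.runs_block rfl

/-- Test whether a register is nonempty. -/
def testNonempty (r : R) : Prog A R :=
  Frag.block (.peek (.inl r) (fun s o => (flag o.isSome, s.2)) .halt)

theorem does_testNonempty (r : R) (v : Flags) (ρ : R → List Sym) :
    Does (A := A) (testNonempty r) v ρ 1 (flag (ρ r).head?.isSome) ρ :=
  Frag.runs_block rfl

/-- Pop all the symbols of a register, performing an action for each of them. -/
def drain (r : R) (q : TM2.Stmt (Alph A R) Unit (Vars A) → TM2.Stmt (Alph A R) Unit (Vars A)) :
    Prog A R :=
  (Frag.block (popTop r .halt)).seq <| Frag.loop hasTop <| Frag.block <| q <| popTop r .halt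

/-- One loop serves emptying, moving, copying, zeroing and comparing registers: the effect of the
loop is the fold of `act` over the drained register. The hypothesis `hr` says that `act` is
independent of the register `r`, so what remains there can be tracked separately. -/
theorem does_drain {r : R}
    {q : TM2.Stmt (Alph A R) Unit (Vars A) → TM2.Stmt (Alph A R) Unit (Vars A)}
    {act : (R → List Sym) × Bool → Sym → (R → List Sym) × Bool}
    (hact : ∀ k x b ρ, TM2.stepAux (q k) ((some x, none, b), idle) (tapes ρ fun _ _ => []) =
      TM2.stepAux k ((some x, none, (act (ρ, b) x).2), idle)
        (tapes (act (ρ, b) x).1 fun _ _ => []))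
    (hr : ∀ x b ρ w, act (Function.update ρ r w, b) x =
      (Function.update (act (ρ, b) x).1 r w, (act (ρ, b) x).2))
    (b : Bool) (ρ : R → List Sym) :
    Does (drain r q) (flag b) ρ (2 * (ρ r).length + 2) (flag ((ρ r).foldl act (ρ, b)).2)
      (Function.update ((ρ r).foldl act (ρ, b)).1 r []) := by
  -- The loop is always entered with one symbol `x` already popped into the flags, which is why the
  -- fold runs over `x :: w`.
  have key : ∀ (w : List Sym) (x : Sym) (s : (R → List Sym) × Bool),
      Does (Frag.loop hasTop <| Frag.block <| q <| popTop r .halt) (some x, none, s.2)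
        (Function.update s.1 r w) (2 * w.length + 3) (flag ((x :: w).foldl act s).2)
        (Function.update ((x :: w).foldl act s).1 r []) := by
    intro w
    induction w with
    | nil =>
      intro x s
      refine (Frag.Runs.loop (v := ((some x, none, s.2), idle))
        (v' := (flag (act s x).2, idle)) rfl (Frag.runs_block ?_)
        (Frag.runs_loop_done rfl)).mono ?_
      · rw [hact, hr]; simp
      · simp
    | cons y w ih =>
      intro x s
      refine (Frag.Runs.loop (v := ((some x, none, s.2), idle))
        (v' := ((some y, none, (act s x).2), idle)) rfl (Frag.runs_block ?_)
        (ih y (act s x))).mono ?_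
      · rw [hact, hr]; simp
      · simp; omega
  cases h : ρ r with
  | nil =>
    refine (Frag.Runs.seq (v' := (flag b, idle)) (Frag.runs_block ?_)
      (Frag.runs_loop_done rfl)).mono ?_
    · simp [h]
    · simp
  | cons x w =>
    refine (Frag.Runs.seq (v' := ((some x, none, b), idle)) (Frag.runs_block ?_)
      (key w x (ρ, b))).mono ?_
    · simp [h]
    · simp; omega

/-- Empty a register. -/
def clear (r : R) : Prog A R := drain r id

theorem does_clear (r : R) (b : Bool) (ρ : R → List Sym) :
    Does (A := A) (clear r) (flag b) ρ (2 * (ρ r).length + 2) (flag b)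
      (Function.update ρ r []) := by
  have := does_drain (A := A) (r := r) (q := id) (act := fun s _ => s) (fun _ _ _ _ => rfl)
    (fun _ _ _ _ => rfl) b ρ
  have h : ∀ w : List Sym, w.foldl (fun s _ => s) (ρ, b) = (ρ, b) := fun w => by
    induction w <;> simp_all
  rwa [h] at this

/-- Move the content of a register to another one, in reverse order. -/
def pour (r s : R) : Prog A R := drain r fun k => .push (.inl s) (fun v => v.1.1.getD none) k

theorem does_pour {r s : R} (hrs : r ≠ s) (b : Bool) (ρ : R → List Sym) :
    Does (A := A) (pour r s) (flag b) ρ (2 * (ρ r).length + 2) (flag b)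
      (Function.update (Function.update ρ s ((ρ r).reverse ++ ρ s)) r []) := by
  have := does_drain (A := A) (r := r)
    (q := fun k => .push (.inl s) (fun v => v.1.1.getD none) k)
    (act := fun p x => (Function.update p.1 s (x :: p.1 s), p.2)) (fun _ _ _ _ => by simp)
    (fun x b ρ w => by simp [hrs.symm, Function.update_comm hrs]) b ρ
  have h : ∀ (w : List Sym) (ρ : R → List Sym),
      w.foldl (fun p x => (Function.update p.1 s (x :: p.1 s), p.2)) (ρ, b) =
        (Function.update ρ s (w.reverse ++ ρ s), b) := fun w => by
    induction w with
    | nil => simp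
    | cons x w ih => intro ρ; simp [ih]
  rwa [h] at this

/-- Copy the content of the register `r` to `s`, in reverse order, using `t`. -/
def copyRev (r s t : R) : Prog A R :=
  (drain r fun k => .push (.inl s) (fun v => v.1.1.getD none) <|
    .push (.inl t) (fun v => v.1.1.getD none) k).seq (pour t r)

theorem does_copyRev {r s t : R} (hrs : r ≠ s) (hrt : r ≠ t) (hst : s ≠ t) (b : Bool)
    {ρ : R → List Sym} (ht : ρ t = []) :
    Does (A := A) (copyRev r s t) (flag b) ρ (4 * (ρ r).length + 4) (flag b)
      (Function.update ρ s ((ρ r).reverse ++ ρ s)) := by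
  have := does_drain (A := A) (r := r)
    (q := fun k => .push (.inl s) (fun v => v.1.1.getD none) <|
      .push (.inl t) (fun v => v.1.1.getD none) k)
    (act := fun p x => (Function.update (Function.update p.1 s (x :: p.1 s)) t (x :: p.1 t), p.2))
    (fun _ _ _ _ => by simp [hst.symm])
    (fun x b ρ w => by
      simp only [Prod.mk.injEq, and_true]
      funext u
      simp only [Function.update_apply]
      split_ifs <;> simp_all) b ρ
  have h : ∀ (w : List Sym) (ρ : R → List Sym),
      w.foldl (fun p x =>
        (Function.update (Function.update p.1 s (x :: p.1 s)) t (x :: p.1 t), p.2)) (ρ, b) =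
        (Function.update (Function.update ρ s (w.reverse ++ ρ s)) t (w.reverse ++ ρ t), b) :=
    fun w => by
    induction w with
    | nil => simp
    | cons x w ih =>
      intro ρ
      simp only [List.foldl_cons, ih, Prod.mk.injEq, and_true]
      funext u
      simp only [Function.update_apply]
      split_ifs <;> simp_all
  rw [h] at this
  refine ((this.seq (does_pour hrt.symm b _)).weaken ?_ ?_)
  · simp [hrt.symm, ht]; omega
  · funext u
    simp only [Function.update_apply]
    split_ifs <;> simp_all

/-- Copy the content of the register `r` to `s`, using `t` and `t'`. -/
def copy (r s t t' : R) : Prog A R := (copyRev r t' t).seq (pour t' s)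

theorem does_copy {r s t t' : R} (hrt : r ≠ t) (hrt' : r ≠ t') (hst' : s ≠ t')
    (htt' : t' ≠ t) (b : Bool) {ρ : R → List Sym} (ht : ρ t = []) (ht' : ρ t' = []) :
    Does (A := A) (copy r s t t') (flag b) ρ (6 * (ρ r).length + 6) (flag b)
      (Function.update ρ s (ρ r ++ ρ s)) := by
  refine (((does_copyRev (A := A) hrt' hrt htt' b ht).seq (does_pour hst'.symm b _)).weaken ?_ ?_)
  · simp [ht']; omega
  · funext u
    simp only [Function.update_apply]
    split_ifs <;> simp_all

/-- Replace all the bits of a word by zeros, using `t`. -/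
def zeros (r t : R) : Prog A R :=
  (drain r fun k => .push (.inl t) (fun v => (v.1.1.getD none).map fun _ => false) k).seq (pour t r)

theorem does_zeros {r t : R} (hrt : r ≠ t) (b : Bool) {ρ : R → List Sym} (ht : ρ t = [])
    {w : List Bool} (hw : ρ r = encWord w) :
    Does (A := A) (zeros r t) (flag b) ρ (4 * w.length + 8) (flag b)
      (Function.update ρ r (encWord (List.replicate w.length false))) := by
  have := does_drain (A := A) (r := r)
    (q := fun k => .push (.inl t) (fun v => (v.1.1.getD none).map fun _ => false) k)
    (act := fun p x => (Function.update p.1 t (x.map (fun _ => false) :: p.1 t), p.2))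
    (fun _ _ _ _ => by simp)
    (fun x b ρ w => by simp [hrt.symm, Function.update_comm hrt]) b ρ
  have h : ∀ (w : List Sym) (ρ : R → List Sym),
      w.foldl (fun p x => (Function.update p.1 t (x.map (fun _ => false) :: p.1 t), p.2)) (ρ, b) =
        (Function.update ρ t ((w.map fun x => x.map fun _ => false).reverse ++ ρ t), b) :=
    fun w => by
    induction w with
    | nil => simp
    | cons x w ih => intro ρ; simp [ih]
  rw [h] at this
  refine ((this.seq (does_pour hrt.symm b _)).weaken ?_ ?_)
  · simp [hrt.symm, ht, hw]; omega
  · have : encWord (List.replicate w.length false) = (encWord w).map fun x => x.map fun _ => false := by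
      simp [encWord, Function.comp_def]
    funext u
    simp only [Function.update_apply]
    split_ifs <;> simp_all

end Registers

end ProximitySearch

namespace ProximitySearch

open Turing

/-! ### Operations on words in registers -/

/-- Bitwise comparison of words. -/
def subWord (u w : List Bool) : Bool := (List.zipWith (fun x y => !x || y) u w).all id

section Words

set_option linter.unusedSectionVars false

variable {J : Type} [DecidableEq J] {A : J → TM2ComputableAux Sym Sym} {R : Type} [DecidableEq R]

/-- Comparison of symbols: a one only lies below a one. -/
def leSym (x y : Sym) : Bool := x != some true || y == some true

/-- Test whether the word in `r` lies bitwise below the first word in `s`, using `t` and `t'`. -/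
def subTest (r s t t' : R) : Prog A R :=
  (setFlag true).seq <| (drain r fun k =>
    .pop (.inl s) (fun v o => ((v.1.1, o, v.1.2.2 && leSym (v.1.1.getD none) (o.getD none)), v.2)) <|
    .push (.inl t) (fun v => v.1.1.getD none) <| .push (.inl t') (fun v => v.1.2.1.getD none) <|
    .load (fun v => ((v.1.1, none, v.1.2.2), v.2)) k).seq <|
  (pour t r).seq (pour t' s)

/-- Both words are read in lockstep while copies are kept in `t` and `t'`, from which the registers
are restored. Equal lengths ensure that exactly the first word of `s` is consumed. -/
theorem does_subTest {r s t t' : R} (hrs : r ≠ s) (hrt : r ≠ t) (hrt' : r ≠ t') (hst : s ≠ t)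
    (hst' : s ≠ t') (htt' : t ≠ t') (b : Bool) {ρ : R → List Sym} (ht : ρ t = []) (ht' : ρ t' = [])
    {u w : List Bool} {l : List Sym} (hr : ρ r = encWord u) (hs : ρ s = encWord w ++ l)
    (huw : u.length = w.length) :
    Does (A := A) (subTest r s t t') (flag b) ρ (6 * u.length + 13) (flag (subWord u w)) ρ := by
  have h1 := does_drain (A := A) (r := r)
    (q := fun k => .pop (.inl s) (fun v o =>
        ((v.1.1, o, v.1.2.2 && leSym (v.1.1.getD none) (o.getD none)), v.2)) <|
      .push (.inl t) (fun v => v.1.1.getD none) <| .push (.inl t') (fun v => v.1.2.1.getD none) <|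
      .load (fun v => ((v.1.1, none, v.1.2.2), v.2)) k)
    (act := fun p x => (Function.update (Function.update (Function.update p.1 s (p.1 s).tail)
      t (x :: p.1 t)) t' ((p.1 s).head?.getD none :: p.1 t'),
        p.2 && leSym x ((p.1 s).head?.getD none)))
    (fun _ _ _ _ => by simp [hst.symm, hst'.symm, htt'.symm])
    (fun x b ρ w => by
      simp only [Prod.mk.injEq]
      constructor
      · funext u
        simp only [Function.update_apply]
        split_ifs <;> simp_all
      · simp [hrs.symm]) true ρ
  have h : ∀ (u w : List Sym) (ρ : R → List Sym) (b : Bool), u.length = w.length →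
      ρ s = w ++ l →
      u.foldl (fun p x => (Function.update (Function.update (Function.update p.1 s (p.1 s).tail)
      t (x :: p.1 t)) t' ((p.1 s).head?.getD none :: p.1 t'),
        p.2 && leSym x ((p.1 s).head?.getD none))) (ρ, b) =
        (Function.update (Function.update (Function.update ρ s l) t (u.reverse ++ ρ t))
          t' (w.reverse ++ ρ t'), b && (List.zipWith leSym u w).all id) := by
    intro u
    induction u with
    | nil =>
      intro w ρ b hl hs
      obtain rfl : w = [] := List.length_eq_zero_iff.1 hl.symm
      simp only [List.foldl_nil, List.reverse_nil, List.nil_append, List.zipWith_nil_left,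
        List.all_nil, Bool.and_true, Prod.mk.injEq, and_true]
      funext u
      simp only [Function.update_apply]
      split_ifs <;> simp_all
    | cons x u ih =>
      intro w ρ b hl hs
      obtain _ | ⟨y, w⟩ := w
      · simp at hl
      rw [List.foldl_cons, ih w]
      · simp only [Prod.mk.injEq]
        constructor
        · funext u
          simp only [Function.update_apply]
          split_ifs <;> simp_all
        · simp [hs, Bool.and_assoc]
      · simpa using hl
      · simp [hs, hst, hst']
  rw [h _ (encWord w) ρ true (by simp [hr, huw]) hs] at h1
  -- The comparison also covers the two end marks, which meet each other and contribute the value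
  -- true.
  have e : (true && (List.zipWith leSym (ρ r) (encWord w)).all id) = subWord u w := by
    have h2 : ∀ (u w : List Bool), u.length = w.length →
        (List.zipWith leSym (encWord u) (encWord w)).all id = subWord u w := by
      intro u
      induction u with
      | nil =>
        intro w hl
        obtain rfl : w = [] := List.length_eq_zero_iff.1 hl.symm
        rfl
      | cons x u ih =>
        intro w hl
        obtain _ | ⟨y, w⟩ := w
        · simp at hl
        have := ih w (by simpa using hl)
        simp only [encWord, subWord, List.map_cons, List.cons_append, List.zipWith_cons_cons,
          List.all_cons] at this ⊢
        rw [this]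
        cases x <;> cases y <;> rfl
    rw [Bool.true_and, hr, h2 u w huw]
  simp only [e] at h1
  refine (((does_setFlag true _ _).seq (h1.seq ((does_pour hrt.symm _ _).seq
    (does_pour hst'.symm _ _)))).weaken ?_ ?_)
  · simp [ht, ht', hr, huw, hrt.symm, hrt'.symm, htt', htt'.symm]; omega
  · funext u
    simp only [Function.update_apply]
    split_ifs <;> simp_all

/-- Move the first word of `r` to `s`, in reverse order. -/
def popWord (r s : R) : Prog A R :=
  let F : Prog A R := Frag.block (popTop r (.push (.inl s) (fun v => v.1.1.getD none) .halt))
  F.seq ((Frag.loop (fun v => (v.1.1.getD none).isSome) F).seq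
    (Frag.block (.load (fun v => ((none, v.1.2), v.2)) .halt)))

theorem does_popWord {r s : R} (hrs : r ≠ s) (b : Bool) {ρ : R → List Sym}
    {w : List Bool} {l : List Sym} (hr : ρ r = encWord w ++ l) :
    Does (A := A) (popWord r s) (flag b) ρ (2 * w.length + 3) (flag b)
      (Function.update (Function.update ρ r l) s ((encWord w).reverse ++ ρ s)) := by
  -- The loop condition inspects the symbol moved last, here the bit `x`. The loop stops once the
  -- end mark itself has been moved.
  have key : ∀ (w : List Bool) (x : Bool) (ρ : R → List Sym), ρ r = encWord w ++ l →
      Does (A := A) (Frag.loop (fun v => (v.1.1.getD none).isSome) <|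
        Frag.block (popTop r (.push (.inl s) (fun v => v.1.1.getD none) .halt)))
        (some (some x), none, b) ρ (2 * w.length + 3) (some none, none, b)
      (Function.update (Function.update ρ r l) s ((encWord w).reverse ++ ρ s)) := by
    intro w
    induction w with
    | nil =>
      intro x ρ hr
      refine (Frag.Runs.loop (v := ((some (some x), none, b), idle))
        (v' := ((some none, none, b), idle)) rfl (Frag.runs_block ?_)
        (Frag.runs_loop_done rfl)).mono ?_
      · simp [hr, encWord, hrs.symm]
      · simp
    | cons y w ih =>
      intro x ρ hr
      have := ih y (Function.update (Function.update ρ r (encWord w ++ l)) s (some y :: ρ s))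
          (by simp [hrs])
      refine Does.weaken (Frag.Runs.loop (v := ((some (some x), none, b), idle))
        (v' := ((some (some y), none, b), idle)) rfl (Frag.runs_block ?_) this) ?_ ?_
      · simp [hr, encWord, hrs.symm]
      · simp; omega
      · funext u
        simp only [Function.update_apply]
        split_ifs <;> simp_all [encWord]
  cases w with
  | nil =>
    refine (Frag.Runs.seq (v' := ((some none, none, b), idle))
      (S' := tapes (Function.update (Function.update ρ r l) s ((encWord []).reverse ++ ρ s))
        fun _ _ => []) (Frag.runs_block ?_)
      (Frag.Runs.seq (Frag.runs_loop_done rfl) (Frag.runs_block ?_))).mono ?_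
    · simp [hr, encWord, hrs.symm]
    · simp
    · simp
  | cons x w =>
    refine (Frag.Runs.seq (v' := ((some (some x), none, b), idle)) (Frag.runs_block ?_)
      (Frag.Runs.seq (key w x (Function.update (Function.update ρ r (encWord w ++ l)) s
        (some x :: ρ s)) (by simp [hrs])) (Frag.runs_block ?_))).mono ?_
    · simp [hr, encWord, hrs.symm]
    · simp only [TM2.stepAux, TM2.Cfg.mk.injEq, true_and]
      congr 1
      funext u
      simp only [Function.update_apply]
      split_ifs <;> simp_all [encWord]
    · simp; omega

/-- Remove the first word of `r`, using `t`. -/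
def dropWord (r t : R) : Prog A R := (popWord r t).seq (clear t)

theorem does_dropWord {r t : R} (hrt : r ≠ t) (b : Bool) {ρ : R → List Sym} (ht : ρ t = [])
    {w : List Bool} {l : List Sym} (hr : ρ r = encWord w ++ l) :
    Does (A := A) (dropWord r t) (flag b) ρ (4 * w.length + 7) (flag b)
      (Function.update ρ r l) := by
  refine ((does_popWord hrt b hr).seq (does_clear t b _)).weaken ?_ ?_
  · simp [ht]; omega
  · funext u
    simp only [Function.update_apply]
    split_ifs <;> simp_all

/-- Move the first word of `r` to `s`, using `t`. -/
def moveWord (r s t : R) : Prog A R := (popWord r t).seq (pour t s)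

theorem does_moveWord {r s t : R} (hrt : r ≠ t) (hrs : r ≠ s) (hst : s ≠ t) (b : Bool)
    {ρ : R → List Sym} (ht : ρ t = [])
    {w : List Bool} {l : List Sym} (hr : ρ r = encWord w ++ l) :
    Does (A := A) (moveWord r s t) (flag b) ρ (4 * w.length + 7) (flag b)
      (Function.update (Function.update ρ r l) s (encWord w ++ ρ s)) := by
  refine ((does_popWord hrt b hr).seq (does_pour hst.symm b _)).weaken ?_ ?_
  · simp [ht]; omega
  · funext u
    simp only [Function.update_apply]
    split_ifs <;> simp_all

/-- Set the bit of the word in `s` whose number is given in unary by the first word in `r`,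
using `t`. -/
def setBit (r s t : R) : Prog A R :=
  Frag.seq (Frag.block (popTop r .halt)) <|
  Frag.seq (Frag.loop (fun v => (v.1.1.getD none).isSome) <| Frag.block <|
    .pop (.inl s) (fun v o => ((v.1.1, o, v.1.2.2), v.2)) <|
    .push (.inl t) (fun v => v.1.2.1.getD none) <|
    .load (fun v => ((v.1.1, none, v.1.2.2), v.2)) <| popTop r .halt) <|
  Frag.seq (Frag.block <| .pop (.inl s) (fun v _ => ((none, none, v.1.2.2), v.2)) <|
    .push (.inl t) (fun _ => some true) .halt) <| pour t s

theorem does_setBit {r s t : R} (hrs : r ≠ s) (hrt : r ≠ t) (hst : s ≠ t) (b : Bool)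
    {ρ : R → List Sym} (ht : ρ t = []) {c : List Bool} {k : ℕ} {l : List Sym}
    (hr : ρ r = encWord (List.replicate k true) ++ l) (hs : ρ s = encWord c) (hk : k < c.length) :
    Does (A := A) (setBit r s t) (flag b) ρ (4 * k + 7) (flag b)
      (Function.update (Function.update ρ r l) s (encWord (c.set k true))) := by
  -- The first symbol of the unary number is already in the flags. Each further round moves one bit
  -- of `c` to `t`, so that the end mark is met exactly when bit number `k` is on top of `s`.
  have key : ∀ (k : ℕ) (c : List Sym) (ρ : R → List Sym), k < c.length →
      ρ s = c → ρ r = (encWord (List.replicate k true)).tail ++ l →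
      Does (A := A) (Frag.loop (fun v => (v.1.1.getD none).isSome) <| Frag.block <|
        .pop (.inl s) (fun v o => ((v.1.1, o, v.1.2.2), v.2)) <|
        .push (.inl t) (fun v => v.1.2.1.getD none) <|
        .load (fun v => ((v.1.1, none, v.1.2.2), v.2)) <| popTop r .halt)
      ((encWord (List.replicate k true)).head?, none, b) ρ (2 * k + 1) (some none, none, b)
      (Function.update (Function.update (Function.update ρ r l) s (c.drop k)) t
        ((c.take k).reverse ++ ρ t)) := by
    intro k
    induction k with
    | zero =>
      intro c ρ hk hs hr
      refine Does.weaken (Frag.runs_loop_done rfl) le_rfl ?_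
      funext u
      simp only [Function.update_apply]
      split_ifs <;> simp_all [encWord]
    | succ k ih =>
      intro c ρ hk hs hr
      obtain _ | ⟨x, c⟩ := c
      · simp at hk
      have := ih c (Function.update (Function.update (Function.update ρ r
        ((encWord (List.replicate k true)).tail ++ l)) s c) t (x :: ρ t)) (by simpa using hk)
          (by simp [hst]) (by simp [hrs, hrt])
      refine Does.weaken (Frag.Runs.loop (v := ((some (some true), none, b), idle)) rfl
        (Frag.runs_block ?_) this) ?_ ?_
      · have e : ρ r = encWord (List.replicate k true) ++ l := by
          rw [hr]; simp [encWord, List.replicate_succ]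
        have e' : encWord (List.replicate k true) ++ l ≠ [] := by simp [encWord]
        have e'' : (encWord (List.replicate k true) ++ l).head? =
          (encWord (List.replicate k true)).head? := by cases k <;> rfl
        have e3 : (encWord (List.replicate k true) ++ l).tail =
          (encWord (List.replicate k true)).tail ++ l := by cases k <;> rfl
        simp only [TM2.stepAux, tapes_inl, update_tapes_inl, hs, Function.update_of_ne hst.symm,
          Function.update_of_ne hrs, Function.update_of_ne hrt, e, e'', e3, TM2.Cfg.mk.injEq,
          true_and, List.head?_cons, List.tail_cons, Option.getD_some]
        congr 1
        funext u
        simp only [Function.update_apply]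
        split_ifs <;> simp_all
      · omega
      · funext u
        simp only [Function.update_apply]
        split_ifs <;> simp_all
  have h1 := key k (encWord c) (Function.update ρ r ((encWord (List.replicate k true)).tail ++ l))
    (by simp; omega) (by simp [hs, hrs.symm]) (by simp)
  have h2 : Does (A := A) (Frag.block (popTop r .halt)) (flag b) ρ 1
      ((encWord (List.replicate k true)).head?, none, b)
      (Function.update ρ r ((encWord (List.replicate k true)).tail ++ l)) := by
    refine Frag.runs_block ?_
    have e'' : (encWord (List.replicate k true) ++ l).head? =
      (encWord (List.replicate k true)).head? := by cases k <;> rfl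
    have e3 : (encWord (List.replicate k true) ++ l).tail =
      (encWord (List.replicate k true)).tail ++ l := by cases k <;> rfl
    simp [hr, e'', e3]
  set ρ₁ := (Function.update (Function.update (Function.update (Function.update ρ r
    ((encWord (List.replicate k true)).tail ++ l)) r l) s ((encWord c).drop k)) t
        (((encWord c).take k).reverse ++ Function.update ρ r
    ((encWord (List.replicate k true)).tail ++ l) t)) with hρ₁
  have h3 : Does (A := A) (Frag.block <| .pop (.inl s) (fun v _ => ((none, none, v.1.2.2), v.2)) <|
    .push (.inl t) (fun _ => some true) .halt) (some none, none, b) ρ₁ 1 (flag b)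
      (Function.update (Function.update ρ₁ s (ρ₁ s).tail) t (some true :: ρ₁ t)) :=
    Frag.runs_block (by simp [hst.symm])
  refine (h2.seq (h1.seq (h3.seq (does_pour hst.symm b _)))).weaken ?_ ?_
  · simp [hρ₁, ht, hrt.symm]; omega
  · have e : encWord (c.set k true) =
      (encWord c).take k ++ some true :: (encWord c).drop (k + 1) := by
      rw [List.set_eq_take_append_cons_drop, if_pos hk]
      simp only [encWord, List.map_append, List.map_cons, List.map_take, List.map_drop,
        List.append_assoc, List.cons_append]
      rw [List.take_append_of_le_length (by simp; omega),
        List.drop_append_of_le_length (by simp; omega)]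
    rw [e, hρ₁]
    funext u
    simp only [Function.update_apply]
    split_ifs <;> simp_all

end Words

end ProximitySearch

namespace ProximitySearch

/-! ### The parent of a maximal set -/

section Parent

variable {U : Type} [DecidableEq U] {𝓕 : Set (Finset U)}

/-- The state of the search for a target: the part of the target that has been read, the current
maximal set, and the maximal set that was current before the last change. -/
abbrev SearchState (𝓕 : Set (Finset U)) := Finset U × maxSets 𝓕 × maxSets 𝓕

variable (N : maxSets 𝓕 → List (maxSets 𝓕)) (F₀ : maxSets 𝓕) (π : 𝓕 → List U)

/-- Read one more element of the target; if it is not in the current maximal set, move to the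
first neighbour that contains everything read so far. -/
def searchStep (s : SearchState 𝓕) (x : U) : SearchState 𝓕 :=
  if insert x s.1 ⊆ s.2.1.1 then (insert x s.1, s.2.1, s.2.2)
  else (insert x s.1, ((N s.2.1).find? fun Z => insert x s.1 ⊆ Z.1).getD s.2.1, s.2.1)

/-- The state of the search after reading a sequence. -/
def search (l : List U) : SearchState 𝓕 := l.foldl (searchStep N) (∅, F₀, F₀)

/-- The parent of a maximal set. -/
def parent (Y : maxSets 𝓕) : maxSets 𝓕 := (search N F₀ (π (maxToMem Y))).2.2

variable {N F₀ π}

theorem search_concat (l : List U) (x : U) :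
    search N F₀ (l ++ [x]) = searchStep N (search N F₀ l) x := by
  simp [search]

theorem toFinset_concat {U : Type} [DecidableEq U] (l : List U) (x : U) :
    (l ++ [x]).toFinset = insert x l.toFinset := by
  ext; simp

theorem search_fst (l : List U) : (search N F₀ l).1 = l.toFinset := by
  induction l using List.reverseRecOn with
  | nil => rfl
  | append_singleton l x ih =>
    rw [search_concat, searchStep]
    split_ifs <;> rw [ih, toFinset_concat]

-- By maximality, inclusion between maximal sets is equality. The machine can therefore test
-- equality by bitwise comparison.
omit [DecidableEq U] in
theorem maxSets_eq_of_subset {F G : maxSets 𝓕} (h : F.1 ⊆ G.1) : F = G :=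
  Subtype.ext (le_antisymm h (F.2.2 G.2.1 h))

variable (hπ : IsOrderingScheme 𝓕 π)
include hπ

theorem length_ordering (F : 𝓕) : (π F).length = F.1.card := by
  rw [← (hπ F).2.1, List.toFinset_card_of_nodup (hπ F).1]

theorem mem_of_prefix (F : 𝓕) {p : List U} (hp : p <+: π F) : p.toFinset ∈ 𝓕 := by
  rw [List.prefix_iff_eq_take] at hp
  -- An ordering scheme speaks only about proper prefixes; for the whole sequence, `F` itself is the
  -- required member.
  rcases lt_or_ge p.length F.1.card with h | h
  · rw [hp]; exact (hπ F).2.2 _ h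
  · rw [hp, List.take_of_length_le (by rwa [length_ordering hπ]), (hπ F).2.1]
    exact F.2

-- Prefixes grow with `i`, so the property maximised in `prox` is inherited by smaller indices.
omit hπ in
theorem le_prox_iff (G : Finset U) (F : 𝓕) (i : ℕ) (hi : i ≤ F.1.card) :
    i ≤ prox π G F ↔ ((π F).take i).toFinset ⊆ G := by
  constructor
  · intro h
    have := Nat.findGreatest_spec (P := fun i => ((π F).take i).toFinset ⊆ G) (n := F.1.card)
      (Nat.zero_le _) (by simp)
    refine Finset.Subset.trans (fun x hx => ?_) this
    rw [List.mem_toFinset] at hx ⊢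
    exact (List.take_prefix_take_left h).subset hx
  · intro h
    exact Nat.le_findGreatest hi h

variable (hN : ∀ F₁ F₂ : maxSets 𝓕, F₁ ≠ F₂ →
  ∃ F' ∈ N F₁, prox π F₁.1 (maxToMem F₂) < prox π F'.1 (maxToMem F₂))
include hN

/-- Since `p` lies in `G`, the proximity of `G` to `Y` is at least the length of `p`. A neighbour
with larger proximity contains the next element as well. -/
theorem exists_neighbour {Y G : maxSets 𝓕} {p : List U} {x : U} (hp : p ++ [x] <+: π (maxToMem Y))
    (hG : p.toFinset ⊆ G.1) (hx : ¬ insert x p.toFinset ⊆ G.1) :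
    ∃ Z ∈ N G, insert x p.toFinset ⊆ Z.1 := by
  have hY : (π (maxToMem Y)).toFinset = Y.1 := (hπ _).2.1
  have hc : p.length + 1 ≤ (maxToMem Y).1.card := by
    have := hp.length_le
    rw [length_ordering hπ] at this
    simpa using this
  -- The set `Y` contains every prefix of its own ordering, whereas `G` misses this one.
  have hne : G ≠ Y := by
    rintro rfl
    refine hx (Finset.Subset.trans ?_ hY.le)
    intro y hy
    rw [List.mem_toFinset]
    apply hp.subset
    simp at hy ⊢
    tauto
  obtain ⟨Z, hZ, h⟩ := hN G Y hne
  refine ⟨Z, hZ, ?_⟩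
  have h1 : p.length ≤ prox π G.1 (maxToMem Y) := by
    rw [le_prox_iff _ _ _ (by omega)]
    rwa [← List.prefix_iff_eq_take.1 ((List.prefix_append p [x]).trans hp)]
  have h2 : p.length + 1 ≤ prox π Z.1 (maxToMem Y) := by omega
  rw [le_prox_iff _ _ _ hc] at h2
  have h3 := List.prefix_iff_eq_take.1 hp
  rw [List.length_append, List.length_singleton] at h3
  rw [← h3] at h2
  rwa [toFinset_concat] at h2

/-- This invariant makes the search succeed: as long as the sequence is a prefix of the ordering of
some maximal set, the current set contains everything read. -/
theorem subset_search {Y : maxSets 𝓕} {p : List U} (hp : p <+: π (maxToMem Y)) :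
    p.toFinset ⊆ (search N F₀ p).2.1.1 := by
  induction p using List.reverseRecOn with
  | nil => simp
  | append_singleton p x ih =>
    have ih := ih ((List.prefix_append p [x]).trans hp)
    have e := toFinset_concat p x
    rw [search_concat, searchStep, search_fst, e]
    split_ifs with h
    · exact h
    -- A suitable neighbour exists, so the default value in `searchStep` is never used.
    · obtain ⟨Z, hZ, hZ'⟩ := exists_neighbour hπ hN hp ih h
      obtain ⟨W, hW⟩ := Option.isSome_iff_exists.1
        (List.find?_isSome (p := fun Z : maxSets 𝓕 => decide (insert x p.toFinset ⊆ Z.1)).2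
          ⟨Z, hZ, by simpa using hZ'⟩)
      simp only [hW, Option.getD_some]
      simpa using List.find?_some hW

theorem search_eq_self (Y : maxSets 𝓕) : (search N F₀ (π (maxToMem Y))).2.1 = Y := by
  have := subset_search (F₀ := F₀) hπ hN (Y := Y) List.prefix_rfl
  rw [(hπ _).2.1] at this
  exact (maxSets_eq_of_subset this).symm

/-- The last change of the current maximal set in a search. -/
theorem exists_last_change {Y : maxSets 𝓕} {p : List U} (hp : p <+: π (maxToMem Y)) :
    (search N F₀ p).2.1 = F₀ ∨ ∃ q x, q ++ [x] <+: p ∧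
      ¬ insert x q.toFinset ⊆ (search N F₀ q).2.1.1 ∧
      (search N F₀ p).2.2 = (search N F₀ q).2.1 ∧
      (search N F₀ p).2.1 = (search N F₀ (q ++ [x])).2.1 ∧
      (search N F₀ p).2.1 ∈ N (search N F₀ q).2.1 := by
  induction p using List.reverseRecOn with
  | nil => exact .inl rfl
  | append_singleton p x ih =>
    have hp' := (List.prefix_append p [x]).trans hp
    -- Without a change at `x` the earlier last change remains the last one; otherwise `x` itself is
    -- the witness.
    by_cases h : insert x p.toFinset ⊆ (search N F₀ p).2.1.1
    · have e : (search N F₀ (p ++ [x])).2 = (search N F₀ p).2 := by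
        rw [search_concat, searchStep, search_fst, if_pos h]
      rw [e]
      refine (ih hp').imp_right ?_
      rintro ⟨q, y, hq, h'⟩
      exact ⟨q, y, hq.trans (List.prefix_append p [x]), h'⟩
    · refine .inr ⟨p, x, List.prefix_rfl, h, ?_, rfl, ?_⟩
      · rw [search_concat, searchStep, search_fst, if_neg h]
      · obtain ⟨Z, hZ, hZ'⟩ := exists_neighbour hπ hN hp (subset_search hπ hN hp') h
        obtain ⟨W, hW⟩ := Option.isSome_iff_exists.1
          (List.find?_isSome (p := fun Z : maxSets 𝓕 => decide (insert x p.toFinset ⊆ Z.1)).2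
            ⟨Z, hZ, by simpa using hZ'⟩)
        rw [search_concat, searchStep, search_fst, if_neg h]
        simp only [hW, Option.getD_some]
        exact List.mem_of_find?_eq_some hW

theorem exists_parent {Y : maxSets 𝓕} (hY : Y ≠ F₀) :
    ∃ q x, q ++ [x] <+: π (maxToMem Y) ∧
      ¬ insert x q.toFinset ⊆ (search N F₀ q).2.1.1 ∧
      parent N F₀ π Y = (search N F₀ q).2.1 ∧ (search N F₀ (q ++ [x])).2.1 = Y ∧
      Y ∈ N (parent N F₀ π Y) := by
  rcases exists_last_change (F₀ := F₀) hπ hN (Y := Y) List.prefix_rfl with h | ⟨q, x, h1, h2, h3, h4, h5⟩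
  · rw [search_eq_self hπ hN] at h
    exact absurd h hY
  · rw [search_eq_self hπ hN] at h4 h5
    refine ⟨q, x, h1, h2, h3, h4.symm, ?_⟩
    rw [parent, h3]
    exact h5

end Parent

/-! ### The parents form a forest -/

section Lex

variable {U : Type}

/-- The lexicographic order of sequences for orders that depend on the common prefix. -/
def LexFrom (r : List U → U → U → Prop) : List U → List U → List U → Prop
  | _, [], [] => False
  | _, [], _ :: _ => True
  | _, _ :: _, [] => False
  | p, a :: l, b :: l' => r p a b ∨ a = b ∧ LexFrom r (p ++ [a]) l l'

theorem LexFrom.trans {r : List U → U → U → Prop} (hr : ∀ p a b c, r p a b → r p b c → r p a c)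
    {p l₁ l₂ l₃ : List U} (h : LexFrom r p l₁ l₂) (h' : LexFrom r p l₂ l₃) :
    LexFrom r p l₁ l₃ := by
  induction l₁ generalizing p l₂ l₃ with
  | nil =>
    cases l₂ with
    | nil => exact h.elim
    | cons b l₂ => cases l₃ with
      | nil => exact h'.elim
      | cons c l₃ => trivial
  | cons a l₁ ih =>
    cases l₂ with
    | nil => exact h.elim
    | cons b l₂ => cases l₃ with
      | nil => exact h'.elim
      | cons c l₃ =>
        rcases h with h | ⟨rfl, h⟩ <;> rcases h' with h' | ⟨rfl, h'⟩
        · exact .inl (hr _ _ _ _ h h')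
        · exact .inl h
        · exact .inl h'
        · exact .inr ⟨rfl, ih h h'⟩

theorem LexFrom.irrefl {r : List U → U → U → Prop} (hr : ∀ p a, ¬ r p a a) (p l : List U) :
    ¬ LexFrom r p l l := by
  induction l generalizing p with
  | nil => exact id
  | cons a l ih => rintro (h | ⟨-, h⟩); exacts [hr _ _ h, ih _ h]

/-- If `l` first differs from `c'` in a smaller element, or `c` is shorter than `c'`, then the
prefix `c` of `l` is smaller than `c' ++ [x]`. -/
theorem lexFrom_of_prefix {r : List U → U → U → Prop} {p l c c' : List U} (x : U)
    (hc : c <+: l) (hlen : c' <+: l → c.length ≤ c'.length)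
    (h : ∀ q a b, p ++ (q ++ [a]) <+: p ++ l → q ++ [b] <+: c' → a ≠ b → r (p ++ q) a b) :
    LexFrom r p c (c' ++ [x]) := by
  induction c' generalizing p l c with
  | nil =>
    -- The empty sequence is a prefix of `l`, so the length condition leaves only the empty `c`.
    obtain rfl : c = [] := List.length_eq_zero_iff.1 (by simpa using hlen List.nil_prefix)
    trivial
  | cons b c' ih =>
    cases c with
    | nil => trivial
    | cons a c =>
      obtain ⟨t, rfl⟩ := hc
      by_cases hab : a = b
      · subst hab
        refine .inr ⟨rfl, ih (l := c ++ t) (List.prefix_append _ _) (fun h' => ?_) ?_⟩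
        · have := hlen (by simpa using h')
          simpa using this
        · intro q a' b' h1 h2 h3
          have := h (a :: q) a' b' (by simpa using h1) (by simpa using h2) h3
          simpa using this
      · exact .inl (by simpa using h [] a b (by simp) (by simp) hab)

end Lex

section Forest

variable {U : Type} [DecidableEq U] {𝓕 : Set (Finset U)} {N : maxSets 𝓕 → List (maxSets 𝓕)}
  {F₀ : maxSets 𝓕} {π : 𝓕 → List U}

/-- The shortest prefix of the ordering of a maximal set for which the search finds this set. -/
noncomputable def core (N : maxSets 𝓕 → List (maxSets 𝓕)) (F₀ : maxSets 𝓕) (π : 𝓕 → List U)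
    (Y : maxSets 𝓕) : List U :=
  (π (maxToMem Y)).take (sInf {i | (search N F₀ ((π (maxToMem Y)).take i)).2.1 = Y})

theorem search_core (hπ : IsOrderingScheme 𝓕 π) (hN : ∀ F₁ F₂ : maxSets 𝓕, F₁ ≠ F₂ →
      ∃ F' ∈ N F₁, prox π F₁.1 (maxToMem F₂) < prox π F'.1 (maxToMem F₂)) (Y : maxSets 𝓕) :
    (search N F₀ (core N F₀ π Y)).2.1 = Y :=
  Nat.sInf_mem (s := {i | (search N F₀ ((π (maxToMem Y)).take i)).2.1 = Y})
    ⟨(π (maxToMem Y)).length, by simpa using search_eq_self hπ hN Y⟩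

theorem core_prefix (Y : maxSets 𝓕) : core N F₀ π Y <+: π (maxToMem Y) := List.take_prefix _ _

theorem core_length_le {Y : maxSets 𝓕} {p : List U} (hp : p <+: π (maxToMem Y))
    (h : (search N F₀ p).2.1 = Y) : (core N F₀ π Y).length ≤ p.length := by
  rw [List.prefix_iff_eq_take] at hp
  rw [core, List.length_take]
  exact (min_le_left _ _).trans (Nat.sInf_le (by rw [Set.mem_ofPred_eq, ← hp, h]))

/-- Once the search is at `Y`, elements of `Y` cannot drive it away. -/
theorem search_stable {Y : maxSets 𝓕} {p q : List U} (hpq : p <+: q)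
    (hq : q.toFinset ⊆ Y.1) (h : (search N F₀ p).2.1 = Y) : (search N F₀ q).2.1 = Y := by
  induction q using List.reverseRecOn with
  | nil => rwa [List.prefix_nil.1 hpq] at h
  | append_singleton q x ih =>
    rcases List.prefix_concat_iff.1 hpq with rfl | hpq
    · exact h
    · have e := toFinset_concat q x
      rw [e] at hq
      have := ih hpq ((Finset.subset_insert _ _).trans hq)
      rw [search_concat, searchStep, search_fst, this, if_pos hq]

/-- The orders that make an ordering scheme prefix-closed, as relations on the ground set that
depend on a sequence. -/
def ctxOrder (𝓕 : Set (Finset U)) (r : Finset U → U → U → Prop) (p : List U) (a b : U) : Prop :=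
  p.toFinset ∈ 𝓕 ∧ a ∈ candidates 𝓕 p.toFinset ∧ b ∈ candidates 𝓕 p.toFinset ∧ r p.toFinset a b

/-- By prefix-closedness, `a` is the least candidate for `q` inside `F`. The element `b` competes
with it: it lies in `F`, and it is a candidate because `q ++ [b]` is a prefix of another ordering
and hence lists a member. -/
theorem ctxOrder_of_prefix {r : Finset U → U → U → Prop} (hπ : IsOrderingScheme 𝓕 π)
    (hr : ∀ (F : 𝓕) (l : List U), l.Nodup → l.toFinset = F.1 →
      (π F = l ↔ ∀ (i : ℕ) (hi : i < l.length),
        IsMin (r (l.take i).toFinset) (candidates 𝓕 (l.take i).toFinset ∩ (F.1 : Set U)) l[i]))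
    {F F' : 𝓕} {q : List U} {a b : U} (ha : q ++ [a] <+: π F) (hb : q ++ [b] <+: π F')
    (hbF : b ∈ F.1) (hab : a ≠ b) : ctxOrder 𝓕 r q a b := by
  have cand : ∀ (F : 𝓕) (a : U), q ++ [a] <+: π F → a ∈ candidates 𝓕 q.toFinset := by
    intro F a ha
    have h1 : (q ++ [a]).Nodup := (hπ F).1.sublist ha.sublist
    have h2 := mem_of_prefix hπ F ha
    have e := toFinset_concat q a
    refine ⟨?_, e ▸ h2⟩
    rw [List.mem_toFinset]
    intro h
    exact (List.nodup_append.1 h1).2.2 a h a (by simp) rfl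
  refine ⟨mem_of_prefix hπ F ((List.prefix_append _ _).trans ha), cand F a ha, cand F' b hb, ?_⟩
  have hlt : q.length < (π F).length := by
    have := ha.length_le
    simp at this
    omega
  have h := ((hr F (π F) (hπ F).1 (hπ F).2.1).1 rfl) q.length hlt
  rw [← List.prefix_iff_eq_take.1 ((List.prefix_append _ _).trans ha)] at h
  have e : (π F)[q.length] = a := by
    obtain ⟨t, ht⟩ := ha
    simp [← ht]
  rw [e] at h
  exact h.2 b ⟨cand F' b hb, hbF⟩ hab.symm

/-- This excludes cycles of parents. The core of `Y` ends exactly at the last change, so it is `q ++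
[x]` with `q` leading to the parent, and `q` is contained in the parent. The parent's own ordering
is greedy, hence it never falls behind `q` lexicographically, and the core of the parent stops in
time if the two agree on all of `q`. -/
theorem core_parent_lt {r : Finset U → U → U → Prop} (hπ : IsOrderingScheme 𝓕 π)
    (hr : ∀ (F : 𝓕) (l : List U), l.Nodup → l.toFinset = F.1 →
      (π F = l ↔ ∀ (i : ℕ) (hi : i < l.length),
        IsMin (r (l.take i).toFinset) (candidates 𝓕 (l.take i).toFinset ∩ (F.1 : Set U)) l[i]))
    (hN : ∀ F₁ F₂ : maxSets 𝓕, F₁ ≠ F₂ →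
      ∃ F' ∈ N F₁, prox π F₁.1 (maxToMem F₂) < prox π F'.1 (maxToMem F₂))
    {Y : maxSets 𝓕} (hY : Y ≠ F₀) :
    LexFrom (ctxOrder 𝓕 r) [] (core N F₀ π (parent N F₀ π Y)) (core N F₀ π Y) := by
  obtain ⟨q, x, h1, h2, h3, h4, -⟩ := exists_parent hπ hN hY
  have hq := (List.prefix_append q [x]).trans h1
  have e : core N F₀ π Y = q ++ [x] := by
    have hle := core_length_le h1 h4
    have hpre := List.prefix_of_prefix_length_le (core_prefix (N := N) (F₀ := F₀) Y) h1 hle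
    rcases List.prefix_concat_iff.1 hpre with h | h
    · exact h
    -- If a prefix of `q` led to `Y`, the search would still be at `Y` after `q`, and reading `x`,
    -- an element of `Y`, would not change the set.
    · exfalso
      have hsub : (q ++ [x]).toFinset ⊆ Y.1 := by
        rw [← show (π (maxToMem Y)).toFinset = Y.1 from (hπ _).2.1]
        intro y hy
        rw [List.mem_toFinset] at hy ⊢
        exact h1.subset hy
      have : (search N F₀ q).2.1 = Y := search_stable h
        (Finset.Subset.trans (by intro y; simp; tauto) hsub) (search_core hπ hN Y)
      rw [this] at h2
      refine h2 (Finset.Subset.trans ?_ hsub)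
      intro y; simp
  rw [e]
  have hsub : q.toFinset ⊆ (parent N F₀ π Y).1 := h3 ▸ subset_search hπ hN hq
  -- If `q` is a prefix of the parent's ordering, then `q` already leads to the parent, so
  -- minimality bounds the length of the parent's core.
  refine lexFrom_of_prefix x (core_prefix _) (fun h => core_length_le h h3.symm) ?_
  intro p a b ha hb hab
  refine ctxOrder_of_prefix hπ hr (by simpa using ha) (hb.trans hq) (hsub ?_) hab
  rw [List.mem_toFinset]
  exact hb.subset (by simp)

/-- The relation between a maximal set and its parent. -/
def IsChild (N : maxSets 𝓕 → List (maxSets 𝓕)) (F₀ : maxSets 𝓕) (π : 𝓕 → List U)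
    (Z F : maxSets 𝓕) : Prop :=
  Z ≠ F₀ ∧ parent N F₀ π Z = F

/-- The parents form a rooted forest. -/
theorem exists_order (hπ : IsOrderingScheme 𝓕 π) (hpre : IsPrefixClosed 𝓕 π)
    (hN : ∀ F₁ F₂ : maxSets 𝓕, F₁ ≠ F₂ →
      ∃ F' ∈ N F₁, prox π F₁.1 (maxToMem F₂) < prox π F'.1 (maxToMem F₂)) :
    ∃ lt : maxSets 𝓕 → maxSets 𝓕 → Prop, IsStrictOrder _ lt ∧
      ∀ Z F, IsChild N F₀ π Z F → lt F Z := by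
  obtain ⟨r, hr₁, hr₂⟩ := hpre
  refine ⟨fun F Z => LexFrom (ctxOrder 𝓕 r) [] (core N F₀ π F) (core N F₀ π Z), ?_, ?_⟩
  · refine { irrefl := fun F => LexFrom.irrefl ?_ _ _, trans := fun F G H => LexFrom.trans ?_ }
    -- The given orders are strict only among the candidates for a member; the membership clauses of
    -- `ctxOrder` supply precisely this, so the lexicographic order is strict on all sequences.
    · rintro p a ⟨hp, ha, -, h⟩
      exact (hr₁ _ hp).toIrrefl.irrefl ⟨a, ha⟩ h
    · rintro p a b c ⟨hp, ha, hb, h⟩ ⟨-, -, hc, h'⟩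
      exact ⟨hp, ha, hc, (hr₁ _ hp).toIsTrans.trans ⟨a, ha⟩ ⟨b, hb⟩ ⟨c, hc⟩ h h'⟩
  · rintro Z F ⟨hZ, rfl⟩
    exact core_parent_lt hπ hr₂ hN hZ

end Forest

end ProximitySearch

namespace ProximitySearch

/-! ### Traversal of a rooted forest -/

section Tour

variable {V : Type} [DecidableEq V] (root : V) (par : V → V) (ch : V → List V)

/-- The sublist that follows the first occurrence of `v`. -/
def after (v : V) (l : List V) : List V := (l.dropWhile (· ≠ v)).tail

/-- One move of the depth-first traversal, whose state consists of a vertex and of those of its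
children that have not been visited yet. -/
def move : V × List V → V × List V
  | (_, Z :: _) => (Z, ch Z)
  | (F, []) => (par F, after F (ch (par F)))

/-- The vertex that is entered or left in a move. -/
def visited : V × List V → V
  | (_, Z :: _) => Z
  | (F, []) => F

/-- Sequences of moves, with a list of those vertices that are entered or left in every second
move; the truth value tells whether the next move counts. -/
inductive Tour : Bool → V × List V → List V → Bool → V × List V → Prop
  | nil (b : Bool) (s : V × List V) : Tour b s [] b s
  | skip {s s' : V × List V} {outs : List V} {b : Bool} (hs : s ≠ (root, []))
      (h : Tour true (move par ch s) outs b s') : Tour false s outs b s'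
  | visit {s s' : V × List V} {outs : List V} {b : Bool} (hs : s ≠ (root, []))
      (h : Tour false (move par ch s) outs b s') : Tour true s (visited s :: outs) b s'

variable {root par ch}

theorem Tour.trans {b b' b'' : Bool} {s s' s'' : V × List V} {o o' : List V}
    (h : Tour root par ch b s o b' s') (h' : Tour root par ch b' s' o' b'' s'') :
    Tour root par ch b s (o ++ o') b'' s'' := by
  induction h with
  | nil => exact h'
  | skip hs _ ih => exact .skip hs (ih h')
  | visit hs _ ih => exact .visit hs (ih h')

theorem Tour.single (b : Bool) {s : V × List V} (hs : s ≠ (root, [])) :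
    Tour root par ch b s (if b then [visited s] else []) (!b) (move par ch s) := by
  cases b
  · exact .skip hs (.nil _ _)
  · exact .visit hs (.nil _ _)

/-- The relation between a vertex and its parent. -/
def Par (root : V) (par : V → V) (Z F : V) : Prop := Z ≠ root ∧ par Z = F

theorem after_append {pre : List V} {Z : V} {l : List V} (h : (pre ++ Z :: l).Nodup) :
    after Z (pre ++ Z :: l) = l := by
  have h1 : ∀ x ∈ pre, decide (x ≠ Z) = true := fun x hx => by
    simpa using (List.nodup_append.1 h).2.2 x hx Z (by simp)
  rw [after, List.dropWhile_append_of_pos h1]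
  simp

-- The traversal of the subtrees of `l` returns with the parity with which it began. A child `Z` is
-- entered with parity `b`, its subtrees are traversed with the opposite parity, and it is left with
-- that opposite parity. So `Z` is listed once: on entering if `b` is true, on leaving otherwise.
open Relation in
theorem exists_tour_aux [Finite V] (hnd : ∀ F, (ch F).Nodup)
    (hch : ∀ F Z, Z ∈ ch F ↔ Par root par Z F) {lt : V → V → Prop} (hlt : IsStrictOrder V lt)
    (hpar : ∀ Z F, Par root par Z F → lt F Z) (F : V) :
    ∀ (l pre : List V) (b : Bool), ch F = pre ++ l → ∃ outs : List V,
      Tour root par ch b (F, l) outs b (F, []) ∧ outs.Nodup ∧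
      ∀ v, v ∈ outs ↔ ∃ Z ∈ l, ReflTransGen (Par root par) v Z := by
  -- The induction runs from the leaves towards the root, with an inner induction over the remaining
  -- children.
  have wf : WellFounded fun Z F => lt F Z :=
    haveI : IsStrictOrder V (fun Z F => lt F Z) :=
      { irrefl := fun a => hlt.irrefl a, trans := fun a b c h h' => hlt.trans c b a h' h }
    Finite.wellFounded_of_trans_of_irrefl _
  have hgen : ∀ v Z, TransGen (Par root par) v Z → lt Z v := fun v Z h => by
    induction h with
    | single h => exact hpar _ _ h
    | tail _ h ih => exact hlt.trans _ _ _ (hpar _ _ h) ih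
  have huniq : Relator.RightUnique (Par root par) := fun a b c h h' => h.2.symm.trans h'.2
  induction F using wf.induction with
  | _ F ihF =>
    intro l
    induction l with
    | nil => exact fun pre b _ => ⟨[], .nil _ _, List.nodup_nil, by simp⟩
    | cons Z l ih =>
      intro pre b hl
      have hZ : Par root par Z F := (hch F Z).1 (by rw [hl]; simp)
      obtain ⟨o₁, h₁, n₁, m₁⟩ := ihF Z (hpar _ _ hZ) (ch Z) [] (!b) rfl
      obtain ⟨o₂, h₂, n₂, m₂⟩ := ih (pre ++ [Z]) b (by simpa using hl)
      -- On the way back the children of `F` are recomputed and cut after `Z`. As they are listed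
      -- without repetition, exactly `l` is left.
      have hmv : move par ch (Z, []) = (F, l) := by
        rw [move, hZ.2, hl, after_append (hl ▸ hnd F)]
      have t₁ := Tour.single (root := root) (par := par) (ch := ch) b (s := (F, Z :: l)) (by simp)
      have t₂ := Tour.single (root := root) (par := par) (ch := ch) (!b) (s := (Z, []))
        (by simpa using hZ.1)
      rw [hmv, Bool.not_not] at t₂
      have t := (t₁.trans h₁).trans (t₂.trans h₂)
      have hm₁ : ∀ v, v ∈ o₁ ↔ TransGen (Par root par) v Z := fun v => by
        rw [m₁, TransGen.tail'_iff]
        exact exists_congr fun W => by rw [hch, and_comm]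
      have hZ₁ : Z ∉ o₁ := fun h => hlt.irrefl _ (hgen _ _ ((hm₁ Z).1 h))
      -- Subtrees of distinct siblings are disjoint: parents are unique, so of two ancestors of `v`
      -- one descends from the other.
      have hdis : ∀ v, ReflTransGen (Par root par) v Z → v ∉ o₂ := by
        intro v hv hv₂
        obtain ⟨W, hW, hvW⟩ := (m₂ v).1 hv₂
        have hne : Z ≠ W := by
          rintro rfl
          have := hl ▸ hnd F
          simp [List.nodup_append] at this
          tauto
        have hWF : Par root par W F := (hch F W).1 (by rw [hl]; simp [hW])
        -- A path from `A` to its sibling `B` would have to pass through the common parent `F`, and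
        -- then lead from `F` back to `F`.
        have key : ∀ A B, A ≠ B → Par root par A F → Par root par B F →
            ¬ ReflTransGen (Par root par) A B := by
          intro A B hAB hA hB h
          rcases h.cases_head with rfl | ⟨C, hC, h⟩
          · exact hAB rfl
          · rw [huniq hC hA] at h
            exact hlt.irrefl _ (hgen _ _ (TransGen.tail' h hB))
        rcases ReflTransGen.total_of_right_unique huniq hv hvW with h | h
        · exact key _ _ hne hZ hWF h
        · exact key _ _ hne.symm hWF hZ h
      have hsplit : ∀ v, ReflTransGen (Par root par) v Z ↔ v = Z ∨ v ∈ o₁ := fun v => by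
        rw [hm₁, reflTransGen_iff_eq_or_transGen, eq_comm]
      have hmem : ∀ v, (v = Z ∨ v ∈ o₁ ∨ v ∈ o₂) ↔
          ∃ W ∈ Z :: l, ReflTransGen (Par root par) v W := fun v => by
        simp only [List.mem_cons, exists_eq_or_imp, ← m₂, hsplit, or_assoc]
      have hZ₂ := hdis Z .refl
      have hd : ∀ a ∈ o₁, ∀ c ∈ o₂, a ≠ c := fun a ha c hc hac =>
        hdis a ((hsplit a).2 (.inr ha)) (hac ▸ hc)
      refine ⟨_, t, ?_, fun v => ?_⟩
      · cases b <;> simp [visited, List.nodup_append, n₁, n₂, hZ₁, hZ₂]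
        all_goals grind
      · rw [← hmem]
        cases b <;> simp only [visited, Bool.not_true, Bool.not_false, if_true, if_false,
          Bool.false_eq_true, List.mem_append, List.mem_cons, List.not_mem_nil, or_false, false_or]
        all_goals tauto

/-- The moves in pairs. -/
inductive PairTour (root : V) (par : V → V) (ch : V → List V) : V × List V → List V → Prop
  | nil : PairTour root par ch (root, []) []
  | cons {s : V × List V} {outs : List V} (hs : s ≠ (root, []))
      (hs' : move par ch s ≠ (root, []))
      (h : PairTour root par ch (move par ch (move par ch s)) outs) :
      PairTour root par ch s (visited (move par ch s) :: outs)

/-- The case of parity true describes half a pair and is needed only to carry the induction. In each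
full pair the second move is the one that counts. -/
theorem Tour.pairs {b b' : Bool} {s s' : V × List V} {o : List V}
    (h : Tour root par ch b s o b' s') (hs' : s' = (root, [])) (hb' : b' = false) :
    (b = false → PairTour root par ch s o) ∧
    (b = true → s ≠ (root, []) ∧ ∃ o', o = visited s :: o' ∧
      PairTour root par ch (move par ch s) o') := by
  induction h with
  | nil b s => subst hs' hb'; exact ⟨fun _ => .nil, fun h => by simp at h⟩
  | skip hs _ ih =>
    obtain ⟨h, o', rfl, h'⟩ := (ih hs' hb').2 rfl
    exact ⟨fun _ => .cons hs h h', fun h => by simp at h⟩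
  | visit hs _ ih => exact ⟨fun h => by simp at h, fun _ => ⟨hs, _, rfl, (ih hs' hb').1 rfl⟩⟩

-- The tour lists the proper descendants of the root, each once; the root has no parent in the
-- relation `Par` and is added in front.
open Relation in
theorem exists_pairTour [Finite V] (hnd : ∀ F, (ch F).Nodup)
    (hch : ∀ F Z, Z ∈ ch F ↔ Par root par Z F) {lt : V → V → Prop} (hlt : IsStrictOrder V lt)
    (hpar : ∀ Z F, Par root par Z F → lt F Z) :
    ∃ outs : List V, PairTour root par ch (root, ch root) outs ∧ (root :: outs).Nodup ∧
      ∀ v, v ∈ root :: outs := by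
  obtain ⟨outs, h, hn, hm⟩ := exists_tour_aux hnd hch hlt hpar root (ch root) [] false rfl
  have hm' : ∀ v, v ∈ outs ↔ TransGen (Par root par) v root := fun v => by
    rw [hm, TransGen.tail'_iff]
    exact exists_congr fun W => by rw [hch, and_comm]
  refine ⟨outs, (h.pairs rfl rfl).1 rfl, ?_, fun v => ?_⟩
  · refine List.nodup_cons.2 ⟨fun h => ?_, hn⟩
    obtain ⟨C, hC, -⟩ := TransGen.head'_iff.1 ((hm' _).1 h)
    exact hC.1 rfl
  · rw [List.mem_cons, hm', eq_comm (a := v), ← reflTransGen_iff_eq_or_transGen]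
    -- Following parents decreases `lt` on a finite set, so it must end in the root.
    induction v using (Finite.wellFounded_of_trans_of_irrefl lt).induction with
    | _ v ih =>
      by_cases hv : v = root
      · rw [hv]
      · exact (ih (par v) (hpar _ _ ⟨hv, rfl⟩)).head ⟨hv, rfl⟩

end Tour

end ProximitySearch

namespace ProximitySearch

open Turing

/-! ### Characteristic vectors -/

section CharVec

variable {S : SetSystemFamily} {i : S.Inst}

@[simp] theorem length_charVec (F : Finset (S.U i)) : (S.charVec F).length = S.size i := by
  simp [SetSystemFamily.charVec]

theorem subWord_charVec (F G : Finset (S.U i)) :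
    subWord (S.charVec F) (S.charVec G) = decide (F ⊆ G) := by
  rw [Bool.eq_iff_iff, decide_eq_true_iff, subWord, List.all_eq_true]
  constructor
  · intro h x hx
    have := h ((fun x y => !x || y) ((S.charVec F)[(S.num i x : ℕ)]'(by simp))
      ((S.charVec G)[(S.num i x : ℕ)]'(by simp)))
      (List.mem_iff_getElem.2 ⟨(S.num i x : ℕ), by simp, by simp⟩)
    simpa [SetSystemFamily.charVec, hx] using this
  · intro h y hy
    obtain ⟨k, hk, rfl⟩ := List.mem_iff_getElem.1 hy
    have hk' : k < S.size i := by simpa using hk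
    by_cases hF : (S.num i).symm ⟨k, hk'⟩ ∈ F
    · simp [SetSystemFamily.charVec, hF, h hF]
    · simp [SetSystemFamily.charVec, hF]

theorem charVec_set (C : Finset (S.U i)) (x : S.U i) :
    (S.charVec C).set (S.num i x) true = S.charVec (insert x C) := by
  refine List.ext_getElem (by simp) fun k h₁ h₂ => ?_
  have hk : k < S.size i := by simpa using h₂
  rw [List.getElem_set]
  by_cases h : (S.num i x : ℕ) = k
  · subst h; simp [SetSystemFamily.charVec]
  · have : (S.num i).symm ⟨k, hk⟩ ≠ x := by
      rintro rfl; simp at h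
    simp [SetSystemFamily.charVec, h, this]

theorem charVec_empty : S.charVec (∅ : Finset (S.U i)) = List.replicate (S.size i) false := by
  refine List.ext_getElem (by simp) fun k h₁ h₂ => ?_
  simp [SetSystemFamily.charVec]

end CharVec

/-! ### The enumeration program -/

/-- The registers of the enumeration program. -/
inductive Reg
  | inst | root | cur | todo | out | inp | tmp | tmp' | order | mask | best | par | nbrs | cand
  | kids | queue | scan | found
  deriving DecidableEq

instance : Fintype Reg :=
  ⟨{.inst, .root, .cur, .todo, .out, .inp, .tmp, .tmp', .order, .mask, .best, .par, .nbrs, .cand,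
    .kids, .queue, .scan, .found}, fun r => by cases r <;> simp⟩

/-- The subroutines of the enumeration program. -/
inductive Sub
  | first | order | nbrs
  deriving DecidableEq

instance : Fintype Sub := ⟨{.first, .order, .nbrs}, fun j => by cases j <;> simp⟩

section Program

variable {A : Sub → TM2ComputableAux Sym Sym}

/-- Find the neighbours of the set in `best`. -/
def nbrsOf : Prog A Reg :=
  (copyRev .inst .inp .tmp).seq <| (copyRev .best .inp .tmp).seq <|
  (call .nbrs .inp).seq (pour .inp .nbrs)

/-- Find the ordering of the set in `cand`. -/
def orderOf : Prog A Reg :=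
  (copyRev .inst .inp .tmp).seq <| (copyRev .cand .inp .tmp).seq <|
  (call .order .inp).seq (pour .inp .order)

/-- Remove words from `n` until the first one lies above the word in `c`. -/
def seek (c n : Reg) : Prog A Reg :=
  (subTest c n .tmp .tmp').seq <| Frag.loop (fun v => !hasFlag v) <|
    (dropWord n .tmp).seq (subTest c n .tmp .tmp')

/-- Replace the current set of a search. -/
def change : Prog A Reg :=
  (clear .par).seq <| (copy .best .par .tmp .tmp').seq <| nbrsOf.seq <|
  (seek .mask .nbrs).seq <| (clear .best).seq <| (moveWord .nbrs .best .tmp).seq (clear .nbrs)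

/-- Read one element in a search. -/
def readElem : Prog A Reg :=
  (setBit .order .mask .tmp).seq <| (subTest .mask .best .tmp .tmp').seq <|
  Frag.ite hasFlag skip change

/-- Find the parent of the set in `cand`. -/
def parentOf : Prog A Reg :=
  orderOf.seq <| (copy .root .best .tmp .tmp').seq <| (copy .root .par .tmp .tmp').seq <|
  (copy .root .mask .tmp .tmp').seq <| (zeros .mask .tmp).seq <|
  (testNonempty .order).seq <| (Frag.loop hasFlag (readElem.seq (testNonempty .order))).seq <|
  (clear .mask).seq (clear .best)

/-- Test whether the set in `cand` occurs in the list in `kids`. -/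
def memTest : Prog A Reg :=
  (copy .kids .scan .tmp .tmp').seq <| (testNonempty .scan).seq <|
  (Frag.loop hasFlag <| (subTest .cand .scan .tmp .tmp').seq <|
    (Frag.ite hasFlag (pushSym .found none) skip).seq <|
    (dropWord .scan .tmp).seq (testNonempty .scan)).seq <|
  (testNonempty .found).seq (clear .found)

/-- Add the first set in `queue` to `kids` if it is a new child of the set in `cur`. -/
def addKid : Prog A Reg :=
  (moveWord .queue .cand .tmp).seq <| (subTest .cand .root .tmp .tmp').seq <|
  (Frag.ite hasFlag skip <| parentOf.seq <| (subTest .par .cur .tmp .tmp').seq <|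
    (Frag.ite hasFlag
      (memTest.seq (Frag.ite hasFlag skip (copy .cand .kids .tmp .tmp'))) skip).seq
    (clear .par)).seq (clear .cand)

/-- Find the children of the set in `cur`. -/
def kidsOf : Prog A Reg :=
  (copy .cur .best .tmp .tmp').seq <| nbrsOf.seq <| (clear .best).seq <|
  (pour .nbrs .tmp).seq <| (pour .tmp .queue).seq <| (testNonempty .queue).seq <|
  (Frag.loop hasFlag (addKid.seq (testNonempty .queue))).seq <|
  (pour .kids .tmp).seq (pour .tmp .todo)

/-- Enter a child. -/
def enter : Prog A Reg :=
  (clear .cur).seq <| (clear .out).seq <| (moveWord .todo .cur .tmp).seq <| (clear .todo).seq <|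
  (copy .cur .out .tmp .tmp').seq kidsOf

/-- Leave a vertex. -/
def leave : Prog A Reg :=
  (clear .out).seq <| (copy .cur .out .tmp .tmp').seq <|
  (pour .cur .tmp).seq <| (pour .tmp .cand).seq <| parentOf.seq <| (clear .cand).seq <|
  (pour .par .tmp).seq <| (pour .tmp .cur).seq <| kidsOf.seq <|
  (seek .out .todo).seq (dropWord .todo .tmp)

/-- One move of the traversal. -/
def moveProg : Prog A Reg := (testNonempty .todo).seq (Frag.ite hasFlag enter leave)

/-- Two moves of the traversal; the truth value tells whether the traversal was complete before. -/
def mainProg : Prog A Reg :=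
  (testNonempty .todo).seq <|
  (Frag.ite hasFlag (setFlag false) (subTest .cur .root .tmp .tmp')).seq <|
  Frag.ite hasFlag skip (moveProg.seq (moveProg.seq (setFlag false)))

/-- Prepare the traversal. -/
def initProg : Prog A Reg :=
  (copyRev .inst .inp .tmp).seq <| (call .first .inp).seq <| (pour .inp .root).seq <|
  (copy .root .cur .tmp .tmp').seq <| (copy .root .out .tmp .tmp').seq kidsOf

end Program

/-! ### Correctness of the enumeration program -/

/-- The code of a set in a register. -/
abbrev code {S : SetSystemFamily} {i : S.Inst} (F : Finset (S.U i)) : List Sym :=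
  encWord (S.charVec F)

/-- The code of a list of maximal sets in a register. -/
def codes {S : SetSystemFamily} {i : S.Inst} (l : List (maxSets (S.sets i))) : List Sym :=
  encWords (l.map fun F => S.charVec F.1)

/-- The code of a sequence of elements in a register. -/
def elems {S : SetSystemFamily} {i : S.Inst} (l : List (S.U i)) : List Sym :=
  encWords (l.map S.elemCode)

theorem codes_cons {S : SetSystemFamily} {i : S.Inst} (F : maxSets (S.sets i))
    (l : List (maxSets (S.sets i))) : codes (F :: l) = code F.1 ++ codes l := rfl

theorem elems_cons {S : SetSystemFamily} {i : S.Inst} (x : S.U i) (l : List (S.U i)) :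
    elems (x :: l) = encWord (S.elemCode x) ++ elems l := rfl

@[simp] theorem codes_nil {S : SetSystemFamily} {i : S.Inst} :
    codes ([] : List (maxSets (S.sets i))) = [] := rfl

@[simp] theorem elems_nil {S : SetSystemFamily} {i : S.Inst} :
    elems ([] : List (S.U i)) = [] := rfl

/-- The properties of an instance that the program depends on, with a number `B` that bounds the
running times of the subroutines and the lengths of their inputs and outputs. -/
structure Setting (A : Sub → TM2ComputableAux Sym Sym) (S : SetSystemFamily) (i : S.Inst)
    (π : S.sets i → List (S.U i)) (N : maxSets (S.sets i) → List (maxSets (S.sets i)))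
    (F₀ : maxSets (S.sets i)) (B : ℕ) : Prop where
  scheme : IsOrderingScheme (S.sets i) π
  prefixClosed : IsPrefixClosed (S.sets i) π
  closer : ∀ F₁ F₂ : maxSets (S.sets i), F₁ ≠ F₂ →
    ∃ F' ∈ N F₁, prox π F₁.1 (maxToMem F₂) < prox π F'.1 (maxToMem F₂)
  inst_le : (S.encode i).length + 1 ≤ B
  size_le : S.size i + 1 ≤ B
  nbrs_le : ∀ F, (codes (N F)).length ≤ B
  order_le : ∀ F : maxSets (S.sets i), (elems (π (maxToMem F))).length ≤ B
  first : ∀ (ρ : Reg → List Sym) (b : Bool), ρ .inp = (encWord (S.encode i)).reverse →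
    Does (A := A) (call .first .inp) (flag b) ρ B (flag b)
      (Function.update ρ .inp (code F₀.1).reverse)
  order : ∀ (F : maxSets (S.sets i)) (ρ : Reg → List Sym) (b : Bool),
    ρ .inp = (encWord (S.encode i) ++ code F.1).reverse →
    Does (A := A) (call .order .inp) (flag b) ρ B (flag b)
      (Function.update ρ .inp (elems (π (maxToMem F))).reverse)
  nbrs : ∀ (F : maxSets (S.sets i)) (ρ : Reg → List Sym) (b : Bool),
    ρ .inp = (encWord (S.encode i) ++ code F.1).reverse →
    Does (A := A) (call .nbrs .inp) (flag b) ρ B (flag b)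
      (Function.update ρ .inp (codes (N F)).reverse)

/-- The contents of some registers between the operations of the program. -/
structure Clean {S : SetSystemFamily} {i : S.Inst} (F₀ : maxSets (S.sets i))
    (ρ : Reg → List Sym) : Prop where
  inst : ρ .inst = encWord (S.encode i)
  root : ρ .root = code F₀.1
  tmp : ρ .tmp = []
  tmp' : ρ .tmp' = []
  inp : ρ .inp = []
  nbrs : ρ .nbrs = []

section Correctness

variable {A : Sub → TM2ComputableAux Sym Sym} {S : SetSystemFamily} {i : S.Inst}
  {π : S.sets i → List (S.U i)} {N : maxSets (S.sets i) → List (maxSets (S.sets i))}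
  {F₀ : maxSets (S.sets i)} {B : ℕ} {ρ : Reg → List Sym}

theorem does_nbrsOf (h : Setting A S i π N F₀ B) (hρ : Clean F₀ ρ) (b : Bool)
    {G : maxSets (S.sets i)} (hG : ρ .best = code G.1) :
    Does (A := A) nbrsOf (flag b) ρ (11 * B + 10) (flag b)
      (Function.update ρ .nbrs (codes (N G))) := by
  have h1 := h.inst_le
  have h2 := h.size_le
  have h3 := h.nbrs_le G
  refine ((does_copyRev (by decide) (by decide) (by decide) b hρ.tmp).seq <|
    (does_copyRev (by decide) (by decide) (by decide) b (by simp [hρ.tmp])).seq <|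
    (h.nbrs G _ b (by simp [hρ.inst, hρ.inp, hG])).seq
    (does_pour (by decide) b _)).weaken ?_ ?_
  · simp [hρ.inst, hG] at *
    omega
  · funext u
    cases u <;> simp [hρ.inp, hρ.nbrs]

theorem does_orderOf (h : Setting A S i π N F₀ B) (hρ : Clean F₀ ρ) (b : Bool)
    {G : maxSets (S.sets i)} (hG : ρ .cand = code G.1) (ho : ρ .order = []) :
    Does (A := A) orderOf (flag b) ρ (11 * B + 10) (flag b)
      (Function.update ρ .order (elems (π (maxToMem G)))) := by
  have h1 := h.inst_le
  have h2 := h.size_le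
  have h3 := h.order_le G
  refine ((does_copyRev (by decide) (by decide) (by decide) b hρ.tmp).seq <|
    (does_copyRev (by decide) (by decide) (by decide) b (by simp [hρ.tmp])).seq <|
    (h.order G _ b (by simp [hρ.inst, hρ.inp, hG])).seq
    (does_pour (by decide) b _)).weaken ?_ ?_
  · simp [hρ.inst, hG] at *
    omega
  · funext u
    cases u <;> simp [hρ.inp, ho]

/-- The flag always holds the result of the test for the first remaining word. The word `w`
guarantees a success before the list is exhausted, so every test has a word to read. -/
theorem does_seek {c n : Reg} (hcn : c ≠ n) (hc : c ≠ .tmp ∧ c ≠ .tmp') (hn : n ≠ .tmp ∧ n ≠ .tmp')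
    (b : Bool) {u w : List Bool} {pre post : List (List Bool)} (hpre : ∀ v ∈ pre, subWord u v = false)
    (hw : subWord u w = true) (hlen : ∀ v ∈ pre ++ w :: post, u.length = v.length)
    {ρ : Reg → List Sym} (ht : ρ .tmp = []) (ht' : ρ .tmp' = [])
    (hρc : ρ c = encWord u) (hρn : ρ n = encWords (pre ++ w :: post)) :
    Does (A := A) (seek c n) (flag b) ρ ((pre.length + 1) * (10 * u.length + 22)) (flag true)
      (Function.update ρ n (encWords (w :: post))) := by
  have key : ∀ (pre : List (List Bool)) (ρ : Reg → List Sym), (∀ v ∈ pre, subWord u v = false) →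
      (∀ v ∈ pre ++ w :: post, u.length = v.length) → ρ .tmp = [] → ρ .tmp' = [] →
      ρ c = encWord u → ρ n = encWords (pre ++ w :: post) →
      Does (A := A) (Frag.loop (fun v => !hasFlag v) <|
        (dropWord n .tmp).seq (subTest c n .tmp .tmp'))
        (flag (subWord u ((pre ++ w :: post).headD []))) ρ (pre.length * (10 * u.length + 22) + 1)
        (flag true) (Function.update ρ n (encWords (w :: post))) := by
    intro pre
    induction pre with
    | nil =>
      intro ρ _ _ _ _ _ hρn
      rw [List.nil_append, List.headD_cons, hw]
      exact does_loop_not_true.weaken (by simp) (by rw [List.nil_append] at hρn; rw [← hρn]; simp)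
    | cons v pre ih =>
      intro ρ hpre hlen ht ht' hρc hρn
      rw [List.cons_append, encWords_cons] at hρn
      rw [List.cons_append, List.headD_cons, hpre v (by simp)]
      have hl := hlen v (by simp)
      have h1 := does_dropWord (A := A) hn.1 false ht hρn
      obtain ⟨v', l', hv'⟩ : ∃ v' l', pre ++ w :: post = v' :: l' := by
        cases pre <;> simp
      have h2 := does_subTest (A := A) hcn hc.1 hc.2 hn.1 hn.2 (by decide) false
        (ρ := Function.update ρ n (encWords (pre ++ w :: post))) (u := u) (w := v')
        (l := encWords l')
        (by simp [ht, hn.1.symm]) (by simp [ht', hn.2.symm]) (by simp [hρc, hcn])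
        (by simp [hv', encWords_cons]) (hlen v' (by rw [List.cons_append, hv']; simp))
      have h3 := ih (Function.update ρ n (encWords (pre ++ w :: post)))
        (fun v hv => hpre v (by simp [hv])) (fun v hv => hlen v (by
          rw [List.cons_append]; exact List.mem_cons_of_mem _ hv))
        (by simp [ht, hn.1.symm]) (by simp [ht', hn.2.symm]) (by simp [hρc, hcn]) (by simp)
      have e : (pre ++ w :: post).headD [] = v' := by rw [hv', List.headD_cons]
      rw [e] at h3
      refine ((h1.seq h2).loop_not_false h3).weaken ?_ (by simp)
      simp only [List.length_cons, Nat.add_mul, Nat.one_mul]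
      omega
  obtain ⟨v', l', hv'⟩ : ∃ v' l', pre ++ w :: post = v' :: l' := by
    cases pre <;> simp
  have h2 := does_subTest (A := A) hcn hc.1 hc.2 hn.1 hn.2 (by decide) b
    (u := u) (w := v') (l := encWords l') ht ht' hρc (by rw [hρn, hv', encWords_cons])
    (hlen v' (by rw [hv']; simp))
  have h3 := key pre ρ hpre hlen ht ht' hρc hρn
  rw [hv', List.headD_cons] at h3
  refine (h2.seq h3).mono ?_
  simp only [Nat.add_mul, Nat.one_mul]
  omega

end Correctness

end ProximitySearch

namespace ProximitySearch

open Turing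

/-! ### Correctness and running time of the computation of parents. -/

section Correctness

variable {A : Sub → TM2ComputableAux Sym Sym} {S : SetSystemFamily} {i : S.Inst}
  {π : S.sets i → List (S.U i)} {N : maxSets (S.sets i) → List (maxSets (S.sets i))}
  {F₀ : maxSets (S.sets i)} {B : ℕ} {ρ : Reg → List Sym}

theorem Clean.update (h : Clean F₀ ρ) {r : Reg} (hr : r ≠ .inst ∧ r ≠ .root ∧ r ≠ .tmp ∧
    r ≠ .tmp' ∧ r ≠ .inp ∧ r ≠ .nbrs) (w : List Sym) : Clean F₀ (Function.update ρ r w) where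
  inst := by rw [Function.update_of_ne hr.1.symm, h.inst]
  root := by rw [Function.update_of_ne hr.2.1.symm, h.root]
  tmp := by rw [Function.update_of_ne hr.2.2.1.symm, h.tmp]
  tmp' := by rw [Function.update_of_ne hr.2.2.2.1.symm, h.tmp']
  inp := by rw [Function.update_of_ne hr.2.2.2.2.1.symm, h.inp]
  nbrs := by rw [Function.update_of_ne hr.2.2.2.2.2.symm, h.nbrs]

theorem length_le_length_encWords (ws : List (List Bool)) : ws.length ≤ (encWords ws).length := by
  induction ws with
  | nil => simp
  | cons w ws ih => rw [encWords_cons]; simp; omega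

theorem length_codes (l : List (maxSets (S.sets i))) :
    (codes l).length = l.length * (S.size i + 1) := by
  induction l with
  | nil => simp
  | cons F l ih =>
    rw [codes_cons, List.length_append, ih]
    simp [Nat.add_mul]
    omega

theorem subWord_maxSets (F G : maxSets (S.sets i)) :
    subWord (S.charVec F.1) (S.charVec G.1) = decide (F = G) := by
  rw [subWord_charVec, decide_eq_decide]
  exact ⟨maxSets_eq_of_subset, fun h => h ▸ Finset.Subset.refl _⟩

/-- Both the number of words and the length of a word are bounded by the length `B` allowed for the
code of the list, which gives the quadratic time bound. -/
theorem does_seek_sets (hB : S.size i + 1 ≤ B) {c n : Reg} (hcn : c ≠ n)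
    (hc : c ≠ .tmp ∧ c ≠ .tmp') (hn : n ≠ .tmp ∧ n ≠ .tmp') (b : Bool) {C : Finset (S.U i)}
    {pre post : List (maxSets (S.sets i))} {Z : maxSets (S.sets i)}
    (hpre : ∀ W ∈ pre, ¬ C ⊆ W.1) (hZ : C ⊆ Z.1)
    (ht : ρ .tmp = []) (ht' : ρ .tmp' = []) (hρc : ρ c = code C)
    (hρn : ρ n = codes (pre ++ Z :: post)) (hle : (codes (pre ++ Z :: post)).length ≤ B) :
    Does (A := A) (seek c n) (flag b) ρ (B * (10 * B + 22)) (flag true)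
      (Function.update ρ n (codes (Z :: post))) := by
  refine (does_seek hcn hc hn b (u := S.charVec C) (w := S.charVec Z.1)
    (pre := pre.map fun F => S.charVec F.1) (post := post.map fun F => S.charVec F.1)
    ?_ ?_ ?_ ht ht' hρc ?_).weaken ?_ ?_
  · intro v hv
    obtain ⟨W, hW, rfl⟩ := List.mem_map.1 hv
    rw [subWord_charVec]
    simpa using hpre W hW
  · rw [subWord_charVec]; simpa using hZ
  · intro v hv
    rw [← List.map_cons (f := fun F : maxSets (S.sets i) => S.charVec F.1), ← List.map_append] at hv
    obtain ⟨W, -, rfl⟩ := List.mem_map.1 hv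
    simp
  · rw [hρn, codes, List.map_append, List.map_cons]
  · have := length_le_length_encWords ((pre ++ Z :: post).map fun F => S.charVec F.1)
    rw [List.map_append, List.map_cons] at this
    simp only [List.length_map, List.length_append, List.length_cons, length_charVec] at this ⊢
    refine Nat.mul_le_mul ?_ (by omega)
    have h2 : (codes (pre ++ Z :: post)).length ≤ B := hle
    unfold codes at h2
    rw [List.map_append, List.map_cons] at h2
    omega
  · rw [codes, List.map_cons]

/-- A time bound for `change`. -/
def tChange (B : ℕ) : ℕ := B * (10 * B + 22) + 27 * B + 30

theorem does_change (h : Setting A S i π N F₀ B) (hρ : Clean F₀ ρ) (b : Bool)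
    {C : Finset (S.U i)} {G Z P : maxSets (S.sets i)} (hm : ρ .mask = code C)
    (hb : ρ .best = code G.1) (hp : ρ .par = code P.1)
    (hZ : (N G).find? (fun Z => C ⊆ Z.1) = some Z) :
    Does (A := A) change (flag b) ρ (tChange B) (flag true)
      (Function.update (Function.update ρ .par (code G.1)) .best (code Z.1)) := by
  have h2 := h.size_le
  have h3 := h.nbrs_le G
  -- The list of neighbours is split at the first that contains `C`, which is where `seek` stops.
  obtain ⟨hZ1, pre, post, hN, hpre⟩ := List.find?_eq_some_iff_append.1 hZ
  have h4 : (codes (Z :: post)).length ≤ B := by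
    rw [hN, length_codes, List.length_append, Nat.add_mul] at h3
    rw [length_codes]
    omega
  have h5 : (codes post).length ≤ B := by
    rw [length_codes, List.length_cons, Nat.add_mul] at h4
    rw [length_codes]
    omega
  have d₁ := does_clear (A := A) Reg.par b ρ
  generalize e₁ : Function.update ρ Reg.par [] = ρ₁ at d₁
  have d₂ := does_copy (A := A) (r := Reg.best) (s := .par) (t := .tmp) (t' := .tmp')
    (by decide) (by decide) (by decide) (by decide) b (ρ := ρ₁)
    (by simp [← e₁, hρ.tmp]) (by simp [← e₁, hρ.tmp'])
  generalize e₂ : Function.update ρ₁ Reg.par _ = ρ₂ at d₂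
  have c₂ : Clean F₀ ρ₂ := e₂ ▸ (e₁ ▸ hρ.update (by decide) _ : Clean F₀ ρ₁).update (by decide) _
  have b₂ : ρ₂ .best = code G.1 := by simp [← e₂, ← e₁, hb]
  have d₃ := does_nbrsOf h c₂ b b₂
  generalize e₃ : Function.update ρ₂ Reg.nbrs _ = ρ₃ at d₃
  have d₄ := does_seek_sets (A := A) (ρ := ρ₃) (c := .mask) (n := .nbrs) h2 (by decide)
    (by decide) (by decide) b (C := C) (Z := Z) (pre := pre) (post := post)
    (fun W hW => by simpa using hpre W hW) (by simpa using hZ1) (by simp [← e₃, c₂.tmp])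
    (by simp [← e₃, c₂.tmp']) (by simp [← e₃, ← e₂, ← e₁, hm]) (by simp [← e₃, hN]) (hN ▸ h3)
  generalize e₄ : Function.update ρ₃ Reg.nbrs _ = ρ₄ at d₄
  have d₅ := does_clear (A := A) Reg.best true ρ₄
  generalize e₅ : Function.update ρ₄ Reg.best _ = ρ₅ at d₅
  have d₆ := does_moveWord (A := A) (r := Reg.nbrs) (s := .best) (t := .tmp) (ρ := ρ₅)
    (by decide) (by decide) (by decide) true (w := S.charVec Z.1) (l := codes post)
    (by simp [← e₅, ← e₄, ← e₃, c₂.tmp]) (by simp [← e₅, ← e₄, codes_cons])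
  generalize e₆ : Function.update (Function.update ρ₅ _ _) _ _ = ρ₆ at d₆
  have d₇ := does_clear (A := A) Reg.nbrs true ρ₆
  refine (d₁.seq (d₂.seq (d₃.seq (d₄.seq (d₅.seq (d₆.seq d₇)))))).weaken ?_ ?_
  · have l₁ : ρ₁ .best = code G.1 := by simp [← e₁, hb]
    have l₄ : ρ₄ .best = code G.1 := by simp [← e₄, ← e₃, b₂]
    have l₆ : ρ₆ .nbrs = codes post := by simp [← e₆]
    simp [l₁, l₄, l₆, hp, tChange]
    omega
  · subst e₆ e₅ e₄ e₃ e₂ e₁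
    funext u
    cases u <;> simp [hρ.nbrs, hb]

/-- The registers during a search. -/
def searchRegs (ρ : Reg → List Sym) (s : SearchState (S.sets i)) (l : List (S.U i)) :
    Reg → List Sym :=
  Function.update (Function.update (Function.update (Function.update ρ .mask (code s.1))
    .best (code s.2.1.1)) .par (code s.2.2.1)) .order (elems l)

/-- A time bound for `readElem`. -/
def tRead (B : ℕ) : ℕ := tChange B + 10 * B + 30

/-- The hypothesis `hs` is what proximity searchability provides: whenever a change is needed, the
list of neighbours contains a suitable set. -/
theorem does_readElem (h : Setting A S i π N F₀ B) (hρ : Clean F₀ ρ) (b : Bool)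
    {s : SearchState (S.sets i)} {x : S.U i} {l : List (S.U i)}
    (hs : ¬ insert x s.1 ⊆ s.2.1.1 → ∃ Z ∈ N s.2.1, insert x s.1 ⊆ Z.1) :
    ∃ b', Does (A := A) readElem (flag b) (searchRegs ρ s (x :: l)) (tRead B) (flag b')
      (searchRegs ρ (searchStep N s x) l) := by
  have h2 := h.size_le
  have h3 : (S.num i x : ℕ) < S.size i := (S.num i x).2
  have k1 := does_setBit (A := A) (r := .order) (s := .mask) (t := .tmp) (by decide) (by decide)
    (by decide) b (ρ := searchRegs ρ s (x :: l)) (c := S.charVec s.1) (k := S.num i x)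
    (l := elems l) (by simp [searchRegs, hρ.tmp])
    (by simp [searchRegs, elems_cons, SetSystemFamily.elemCode]) (by simp [searchRegs])
    (by simp)
  rw [charVec_set] at k1
  have k2 := does_subTest (A := A) (r := .mask) (s := .best) (t := .tmp) (t' := .tmp') (by decide)
    (by decide) (by decide) (by decide) (by decide) (by decide) b
    (ρ := Function.update (Function.update (searchRegs ρ s (x :: l)) .order (elems l)) .mask
      (code (insert x s.1))) (u := S.charVec (insert x s.1)) (w := S.charVec s.2.1.1) (l := [])
    (by simp [searchRegs, hρ.tmp]) (by simp [searchRegs, hρ.tmp']) (by simp)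
    (by simp [searchRegs]) (by simp)
  rw [subWord_charVec] at k2
  by_cases hx : insert x s.1 ⊆ s.2.1.1
  · rw [decide_eq_true hx] at k2
    refine ⟨true, (k1.seq (k2.seq (does_skip _ _).ite_true)).weaken ?_ ?_⟩
    · simp [tRead]; omega
    · rw [searchStep, if_pos hx]
      funext u
      cases u <;> simp [searchRegs]
  · obtain ⟨Z, hZ, hZ'⟩ := hs hx
    obtain ⟨W, hW⟩ := Option.isSome_iff_exists.1
      (List.find?_isSome (p := fun Z : maxSets (S.sets i) => decide (insert x s.1 ⊆ Z.1)).2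
        ⟨Z, hZ, by simpa using hZ'⟩)
    rw [decide_eq_false hx] at k2
    have k3 := does_change h (ρ := Function.update (Function.update (searchRegs ρ s (x :: l))
      .order (elems l)) .mask (code (insert x s.1))) (Clean.update (Clean.update (Clean.update
        (Clean.update (Clean.update (hρ.update (by decide) _) (by decide) _) (by decide) _)
        (by decide) _) (by decide) _) (by decide) _) false (C := insert x s.1) (G := s.2.1)
        (P := s.2.2) (by simp) (by simp [searchRegs]) (by simp [searchRegs]) hW
    refine ⟨true, (k1.seq (k2.seq k3.ite_false)).weaken ?_ ?_⟩
    · simp [tRead]; omega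
    · rw [searchStep, if_neg hx]
      simp only [hW, Option.getD_some]
      funext u
      cases u <;> simp [searchRegs]

/-- A time bound for `parentOf`. -/
def tParent (B : ℕ) : ℕ := B * (tRead B + 2) + 40 * B + 50

theorem does_parentOf (h : Setting A S i π N F₀ B) (hρ : Clean F₀ ρ) (b : Bool)
    {Y : maxSets (S.sets i)} (hY : ρ .cand = code Y.1) (ho : ρ .order = []) (hm : ρ .mask = [])
    (hb : ρ .best = []) (hp : ρ .par = []) :
    Does (A := A) parentOf (flag b) ρ (tParent B) (flag false)
      (Function.update ρ .par (code (parent N F₀ π Y).1)) := by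
  have h2 := h.size_le
  have h3 := h.order_le Y
  -- The part `p` of the ordering has been read and `l` remains, so the registers hold the state of
  -- the search after `p`.
  have key : ∀ (l p : List (S.U i)), p ++ l = π (maxToMem Y) →
      Does (A := A) (Frag.loop hasFlag (readElem.seq (testNonempty .order)))
        (flag (elems l).head?.isSome) (searchRegs ρ (search N F₀ p) l)
        (l.length * (tRead B + 2) + 1) (flag false)
        (searchRegs ρ (search N F₀ (π (maxToMem Y))) []) := by
    intro l
    induction l with
    | nil =>
      intro p hp
      rw [List.append_nil] at hp
      rw [hp]
      exact does_loop_false.mono (by simp)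
    | cons x l ih =>
      intro p hp
      have hpre : p ++ [x] <+: π (maxToMem Y) := ⟨l, by simpa using hp⟩
      have hsub := subset_search (F₀ := F₀) h.scheme h.closer
        ((List.prefix_append p [x]).trans hpre)
      obtain ⟨b', k⟩ := does_readElem h hρ true (s := search N F₀ p) (x := x) (l := l) (by
        rw [search_fst]
        exact exists_neighbour h.scheme h.closer hpre hsub)
      have k2 := does_testNonempty (A := A) .order (flag b')
        (searchRegs ρ (searchStep N (search N F₀ p) x) l)
      have e : (elems (x :: l)).head?.isSome = true := by
        simp [elems_cons, encWord]
      rw [e]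
      have k3 := ih (p ++ [x]) (by simpa using hp)
      rw [search_concat] at k3
      have e2 : searchRegs ρ (searchStep N (search N F₀ p) x) l .order = elems l := by
        simp [searchRegs]
      rw [e2] at k2
      refine ((k.seq k2).loop_true k3).mono ?_
      rw [List.length_cons, Nat.add_mul]
      omega
  have k := key (π (maxToMem Y)) [] rfl
  have hlen := length_le_length_encWords ((π (maxToMem Y)).map S.elemCode)
  have d₁ := does_orderOf h hρ b hY ho
  generalize e₁ : Function.update ρ Reg.order _ = ρ₁ at d₁
  have d₂ := does_copy (A := A) (r := Reg.root) (s := .best) (t := .tmp) (t' := .tmp')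
    (by decide) (by decide) (by decide) (by decide) b (ρ := ρ₁)
    (by simp [← e₁, hρ.tmp]) (by simp [← e₁, hρ.tmp'])
  generalize e₂ : Function.update ρ₁ Reg.best _ = ρ₂ at d₂
  have d₃ := does_copy (A := A) (r := Reg.root) (s := .par) (t := .tmp) (t' := .tmp')
    (by decide) (by decide) (by decide) (by decide) b (ρ := ρ₂)
    (by simp [← e₂, ← e₁, hρ.tmp]) (by simp [← e₂, ← e₁, hρ.tmp'])
  generalize e₃ : Function.update ρ₂ Reg.par _ = ρ₃ at d₃
  have d₄ := does_copy (A := A) (r := Reg.root) (s := .mask) (t := .tmp) (t' := .tmp')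
    (by decide) (by decide) (by decide) (by decide) b (ρ := ρ₃)
    (by simp [← e₃, ← e₂, ← e₁, hρ.tmp]) (by simp [← e₃, ← e₂, ← e₁, hρ.tmp'])
  generalize e₄ : Function.update ρ₃ Reg.mask _ = ρ₄ at d₄
  have d₅ := does_zeros (A := A) (r := Reg.mask) (t := .tmp) (by decide) b (ρ := ρ₄)
    (w := S.charVec F₀.1) (by simp [← e₄, ← e₃, ← e₂, ← e₁, hρ.tmp])
    (by simp [← e₄, ← e₃, ← e₂, ← e₁, hρ.root, hm])
  -- Zeroing a copy of the root's vector yields a vector of the right length for the empty set, so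
  -- these are the registers of a search that has read nothing.
  have e₅ : Function.update ρ₄ Reg.mask (encWord (List.replicate (S.charVec F₀.1).length false)) =
      searchRegs ρ (search N F₀ []) (π (maxToMem Y)) := by
    subst e₄ e₃ e₂ e₁
    funext u
    cases u <;> simp [searchRegs, search, hρ.root, hb, hp]
    exact congrArg encWord charVec_empty.symm
  rw [e₅] at d₅
  have d₆ := does_testNonempty (A := A) Reg.order (flag b)
    (searchRegs ρ (search N F₀ []) (π (maxToMem Y)))
  rw [show searchRegs ρ (search N F₀ []) (π (maxToMem Y)) .order = elems (π (maxToMem Y)) by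
    simp [searchRegs]] at d₆
  generalize e₇ : searchRegs ρ (search N F₀ (π (maxToMem Y))) [] = ρ₇ at k
  have d₈ := does_clear (A := A) Reg.mask false ρ₇
  have d₉ := does_clear (A := A) Reg.best false (Function.update ρ₇ .mask [])
  refine (d₁.seq (d₂.seq (d₃.seq (d₄.seq (d₅.seq (d₆.seq (k.seq (d₈.seq d₉)))))))).weaken ?_ ?_
  · have : (π (maxToMem Y)).length * (tRead B + 2) ≤ B * (tRead B + 2) :=
      Nat.mul_le_mul_right _ (by rw [List.length_map] at hlen; unfold elems at h3; omega)
    have l₁ : ρ₁ .root = code F₀.1 := by simp [← e₁, hρ.root]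
    have l₂ : ρ₂ .root = code F₀.1 := by simp [← e₂, l₁]
    have l₃ : ρ₃ .root = code F₀.1 := by simp [← e₃, l₂]
    simp [← e₇, searchRegs, l₁, l₂, l₃, tParent]
    omega
  · subst e₇
    funext u
    cases u <;> simp [searchRegs, parent, ho, hm, hb]

end Correctness

end ProximitySearch

namespace ProximitySearch

open Turing

/-! ### Correctness and running time of the filter for children. -/

section Correctness

variable {A : Sub → TM2ComputableAux Sym Sym} {S : SetSystemFamily} {i : S.Inst}
  {π : S.sets i → List (S.U i)} {N : maxSets (S.sets i) → List (maxSets (S.sets i))}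
  {F₀ : maxSets (S.sets i)} {B : ℕ} {ρ : Reg → List Sym}

theorem head_codes_isSome (l : List (maxSets (S.sets i))) :
    (codes l).head?.isSome = !l.isEmpty := by
  cases l with
  | nil => rfl
  | cons F l => simp [codes_cons, encWord]

/-- A time bound for `memTest`. -/
def tMem (B : ℕ) : ℕ := B * (20 * B + 40) + 30 * B + 60

theorem does_memTest (hB : S.size i + 1 ≤ B) (hρ : Clean F₀ ρ) (b : Bool)
    {Z : maxSets (S.sets i)} {acc : List (maxSets (S.sets i))} (hZ : ρ .cand = code Z.1)
    (hk : ρ .kids = codes acc) (hs : ρ .scan = []) (hf : ρ .found = [])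
    (hle : (codes acc).length ≤ B) :
    Does (A := A) memTest (flag b) ρ (tMem B) (flag (decide (Z ∈ acc))) ρ := by
  -- The flag is overwritten by every comparison, so successes are recorded as marks in `found`,
  -- which is nonempty precisely if `Z` occurs in the part `pre` already scanned.
  have key : ∀ (l : List (maxSets (S.sets i))) (fd : List Sym) (pre : List (maxSets (S.sets i))),
      pre ++ l = acc → fd.length ≤ pre.length → (fd ≠ [] ↔ Z ∈ pre) →
      ∃ fd' : List Sym, fd'.length ≤ acc.length ∧ (fd' ≠ [] ↔ Z ∈ acc) ∧
      Does (A := A) (Frag.loop hasFlag <| (subTest .cand .scan .tmp .tmp').seq <|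
        (Frag.ite hasFlag (pushSym .found none) skip).seq <|
        (dropWord .scan .tmp).seq (testNonempty .scan)) (flag (!l.isEmpty))
        (Function.update (Function.update ρ .scan (codes l)) .found fd)
        (l.length * (10 * B + 30) + 1) (flag false) (Function.update ρ .found fd') := by
    intro l
    induction l with
    | nil =>
      intro fd pre hp hl hfd
      rw [List.append_nil] at hp
      subst hp
      refine ⟨fd, hl, hfd, (does_loop_false).weaken (by simp) ?_⟩
      funext u
      cases u <;> simp [hs]
    | cons W l ih =>
      intro fd pre hp hl hfd
      have d₁ := does_subTest (A := A) (r := .cand) (s := .scan) (t := .tmp) (t' := .tmp')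
        (by decide) (by decide) (by decide) (by decide) (by decide) (by decide) true
        (ρ := Function.update (Function.update ρ .scan (codes (W :: l))) .found fd)
        (u := S.charVec Z.1) (w := S.charVec W.1) (l := codes l) (by simp [hρ.tmp])
        (by simp [hρ.tmp']) (by simp [hZ]) (by simp [codes_cons]) (by simp)
      rw [subWord_maxSets] at d₁
      obtain ⟨fd', hl', hfd', d₂⟩ : ∃ fd' : List Sym, fd'.length ≤ (pre ++ [W]).length ∧
          (fd' ≠ [] ↔ Z ∈ pre ++ [W]) ∧
          Does (A := A) (Frag.ite hasFlag (pushSym .found none) skip) (flag (decide (Z = W)))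
            (Function.update (Function.update ρ .scan (codes (W :: l))) .found fd) 2
            (flag (decide (Z = W)))
            (Function.update (Function.update ρ .scan (codes (W :: l))) .found fd') := by
        by_cases h : Z = W
        · refine ⟨none :: fd, by simpa using hl, by simp [h], ?_⟩
          rw [decide_eq_true h]
          exact (does_pushSym _ _ _ _).ite_true.weaken le_rfl (by simp)
        · refine ⟨fd, by simp; omega, by simp [h, hfd], ?_⟩
          rw [decide_eq_false h]
          exact (does_skip _ _).ite_false
      have d₃ := does_dropWord (A := A) (r := .scan) (t := .tmp) (by decide) (decide (Z = W))
        (ρ := Function.update (Function.update ρ .scan (codes (W :: l))) .found fd')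
        (w := S.charVec W.1) (l := codes l) (by simp [hρ.tmp]) (by simp [codes_cons])
      have e : Function.update (Function.update (Function.update ρ .scan (codes (W :: l))) .found fd')
          .scan (codes l) = Function.update (Function.update ρ .scan (codes l)) .found fd' := by
        funext u
        cases u <;> simp
      rw [e] at d₃
      have d₄ := does_testNonempty (A := A) Reg.scan (flag (decide (Z = W)))
        (Function.update (Function.update ρ .scan (codes l)) .found fd')
      rw [show Function.update (Function.update ρ .scan (codes l)) .found fd' .scan = codes l by
        simp, head_codes_isSome] at d₄
      obtain ⟨fd'', hl'', hfd'', d₅⟩ := ih fd' (pre ++ [W]) (by simpa using hp) hl' hfd'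
      refine ⟨fd'', hl'', hfd'', ((d₁.seq (d₂.seq (d₃.seq d₄))).loop_true d₅).mono ?_⟩
      rw [List.length_cons, Nat.add_mul]
      simp
      omega
  obtain ⟨fd, hl, hfd, d₃⟩ := key acc [] [] rfl le_rfl (by simp)
  have d₁ := does_copy (A := A) (r := Reg.kids) (s := .scan) (t := .tmp) (t' := .tmp')
    (by decide) (by decide) (by decide) (by decide) b hρ.tmp hρ.tmp'
  have e₁ : Function.update ρ .scan (ρ .kids ++ ρ .scan) =
      Function.update (Function.update ρ .scan (codes acc)) .found [] := by
    funext u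
    cases u <;> simp [hk, hs, hf]
  rw [e₁] at d₁
  have d₂ := does_testNonempty (A := A) Reg.scan (flag b)
    (Function.update (Function.update ρ .scan (codes acc)) .found [])
  rw [show Function.update (Function.update ρ .scan (codes acc)) .found [] .scan = codes acc by
    simp, head_codes_isSome] at d₂
  have d₄ := does_testNonempty (A := A) Reg.found (flag false) (Function.update ρ .found fd)
  have e₄ : (Function.update ρ .found fd .found).head?.isSome = decide (Z ∈ acc) := by
    rw [Function.update_self, Bool.eq_iff_iff, decide_eq_true_iff, ← hfd]
    cases fd <;> simp
  rw [e₄] at d₄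
  have d₅ := does_clear (A := A) Reg.found (decide (Z ∈ acc)) (Function.update ρ .found fd)
  refine (d₁.seq (d₂.seq (d₃.seq (d₄.seq d₅)))).weaken ?_ ?_
  · have h1 : acc.length ≤ B := by
      have := length_codes acc
      have : acc.length * 1 ≤ acc.length * (S.size i + 1) := Nat.mul_le_mul_left _ (by omega)
      omega
    have h2 : acc.length * (10 * B + 30) ≤ B * (20 * B + 40) := Nat.mul_le_mul h1 (by omega)
    simp [hk, tMem]
    omega
  · funext u
    cases u <;> simp [hf]

/-- One step in the construction of the list of children. -/
def kidStep (N : maxSets (S.sets i) → List (maxSets (S.sets i))) (F₀ : maxSets (S.sets i))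
    (π : S.sets i → List (S.U i)) (F : maxSets (S.sets i)) (acc : List (maxSets (S.sets i)))
    (Z : maxSets (S.sets i)) : List (maxSets (S.sets i)) :=
  if Z ≠ F₀ ∧ parent N F₀ π Z = F ∧ Z ∉ acc then Z :: acc else acc

/-- The list of children. -/
def kids (N : maxSets (S.sets i) → List (maxSets (S.sets i))) (F₀ : maxSets (S.sets i))
    (π : S.sets i → List (S.U i)) (F : maxSets (S.sets i)) : List (maxSets (S.sets i)) :=
  (N F).foldl (kidStep N F₀ π F) []

/-- The registers during the construction of the list of children. -/
def kidRegs (ρ : Reg → List Sym) (queue acc : List (maxSets (S.sets i))) : Reg → List Sym :=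
  Function.update (Function.update ρ .queue (codes queue)) .kids (codes acc)

/-- The registers that are empty between the operations of the program. -/
structure Idle (ρ : Reg → List Sym) : Prop where
  order : ρ .order = []
  mask : ρ .mask = []
  best : ρ .best = []
  par : ρ .par = []
  cand : ρ .cand = []
  kids : ρ .kids = []
  queue : ρ .queue = []
  scan : ρ .scan = []
  found : ρ .found = []

/-- A time bound for `addKid`. -/
def tAdd (B : ℕ) : ℕ := tParent B + tMem B + 60 * B + 100

theorem does_addKid (h : Setting A S i π N F₀ B) (hρ : Clean F₀ ρ) (hi : Idle ρ) (b : Bool)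
    {F Z : maxSets (S.sets i)} {l acc : List (maxSets (S.sets i))} (hF : ρ .cur = code F.1)
    (hle : (codes acc).length ≤ B) :
    ∃ b', Does (A := A) addKid (flag b) (kidRegs ρ (Z :: l) acc) (tAdd B) (flag b')
      (kidRegs ρ l (kidStep N F₀ π F acc Z)) := by
  have h2 := h.size_le
  have hk : ∀ l acc : List (maxSets (S.sets i)), Clean F₀ (kidRegs ρ l acc) := fun l acc =>
    (hρ.update (by decide) _).update (by decide) _
  have d₁ := does_moveWord (A := A) (r := Reg.queue) (s := .cand) (t := .tmp)
    (ρ := kidRegs ρ (Z :: l) acc) (by decide) (by decide) (by decide) b (w := S.charVec Z.1)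
    (l := codes l) (hk _ _).tmp (by simp [kidRegs, codes_cons])
  have e₁ : Function.update (Function.update (kidRegs ρ (Z :: l) acc) .queue (codes l)) .cand
      (encWord (S.charVec Z.1) ++ kidRegs ρ (Z :: l) acc .cand) =
      Function.update (kidRegs ρ l acc) .cand (code Z.1) := by
    funext u
    cases u <;> simp [kidRegs, hi.cand]
  rw [e₁] at d₁
  have c₁ : Clean F₀ (Function.update (kidRegs ρ l acc) .cand (code Z.1)) :=
    (hk _ _).update (by decide) _
  have d₂ := does_subTest (A := A) (r := .cand) (s := .root) (t := .tmp) (t' := .tmp')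
    (by decide) (by decide) (by decide) (by decide) (by decide) (by decide) b
    (ρ := Function.update (kidRegs ρ l acc) .cand (code Z.1))
    (u := S.charVec Z.1) (w := S.charVec F₀.1) (l := []) c₁.tmp c₁.tmp' (by simp)
    (by rw [c₁.root, List.append_nil]) (by simp)
  rw [subWord_maxSets] at d₂
  -- The final clean-up is stated for an arbitrary list of accepted children because all branches
  -- share it.
  have d₉ : ∀ (b : Bool) (acc' : List (maxSets (S.sets i))), Does (A := A) (clear .cand) (flag b)
      (Function.update (kidRegs ρ l acc') .cand (code Z.1)) (2 * B + 2) (flag b)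
      (kidRegs ρ l acc') := fun b acc' => by
    refine (does_clear (A := A) Reg.cand b _).weaken ?_ ?_
    · simp; omega
    · funext u
      cases u <;> simp [kidRegs, hi.cand]
  by_cases h₀ : Z = F₀
  · rw [decide_eq_true h₀] at d₂
    refine ⟨true, (d₁.seq (d₂.seq ((does_skip _ _).ite_true.seq (d₉ _ _)))).weaken ?_ ?_⟩
    · simp [tAdd]; omega
    · simp [kidStep, h₀]
  rw [decide_eq_false h₀] at d₂
  have d₃ := does_parentOf h c₁ false (Y := Z) (by simp) (by simp [kidRegs, hi.order])
    (by simp [kidRegs, hi.mask]) (by simp [kidRegs, hi.best]) (by simp [kidRegs, hi.par])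
  generalize e₃ : Function.update (Function.update (kidRegs ρ l acc) .cand (code Z.1)) .par _ = ρ₃
    at d₃
  have c₃ : Clean F₀ ρ₃ := e₃ ▸ c₁.update (by decide) _
  have d₄ := does_subTest (A := A) (r := .par) (s := .cur) (t := .tmp) (t' := .tmp')
    (by decide) (by decide) (by decide) (by decide) (by decide) (by decide) false
    (ρ := ρ₃) (u := S.charVec (parent N F₀ π Z).1) (w := S.charVec F.1) (l := []) c₃.tmp c₃.tmp'
    (by simp [← e₃]) (by simp [← e₃, kidRegs, hF]) (by simp)
  rw [subWord_maxSets] at d₄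
  have d₈ : ∀ (b : Bool) (acc' : List (maxSets (S.sets i))), Does (A := A) (clear .par) (flag b)
      (Function.update (Function.update (kidRegs ρ l acc') .cand (code Z.1)) .par
        (code (parent N F₀ π Z).1)) (2 * B + 2) (flag b)
      (Function.update (kidRegs ρ l acc') .cand (code Z.1)) := fun b acc' => by
    refine (does_clear (A := A) Reg.par b _).weaken ?_ ?_
    · simp; omega
    · funext u
      cases u <;> simp [kidRegs, hi.par]
  by_cases hp : parent N F₀ π Z = F
  · rw [decide_eq_true hp] at d₄
    have d₅ := does_memTest (A := A) h2 c₃ true (Z := Z) (acc := acc) (by simp [← e₃])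
      (by simp [← e₃, kidRegs]) (by simp [← e₃, kidRegs, hi.scan])
      (by simp [← e₃, kidRegs, hi.found]) hle
    by_cases hm : Z ∈ acc
    · rw [decide_eq_true hm] at d₅
      have d₆ := Does.ite_true (G := skip) (d₅.seq (Does.ite_true
        (G := copy .cand .kids .tmp .tmp') (does_skip (flag true) ρ₃)))
      rw [← e₃] at d₆ d₃ d₄
      refine ⟨true, (d₁.seq (d₂.seq (((d₃.seq (d₄.seq
        (d₆.seq (d₈ true acc)))).ite_false).seq (d₉ true acc)))).weaken ?_ ?_⟩
      · simp [tAdd]; omega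
      · simp [kidStep, hm]
    · rw [decide_eq_false hm] at d₅
      have d₇ := does_copy (A := A) (r := Reg.cand) (s := .kids) (t := .tmp) (t' := .tmp')
        (by decide) (by decide) (by decide) (by decide) false c₃.tmp c₃.tmp'
      have e₇ : Function.update ρ₃ .kids (ρ₃ .cand ++ ρ₃ .kids) =
          Function.update (Function.update (kidRegs ρ l (Z :: acc)) .cand (code Z.1)) .par
            (code (parent N F₀ π Z).1) := by
        funext u
        cases u <;> simp [← e₃, kidRegs, codes_cons]
      have l₇ : ρ₃ .cand = code Z.1 := by simp [← e₃]
      rw [e₇, l₇] at d₇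
      have d₆ := Does.ite_true (G := skip) (d₅.seq (Does.ite_false (F := skip) d₇))
      rw [← e₃] at d₆ d₃ d₄
      refine ⟨false, (d₁.seq (d₂.seq (((d₃.seq (d₄.seq
        (d₆.seq (d₈ false (Z :: acc))))).ite_false).seq (d₉ false (Z :: acc))))).weaken ?_ ?_⟩
      · simp [tAdd]; omega
      · simp [kidStep, hm, h₀, hp]
  · rw [decide_eq_false hp] at d₄
    rw [← e₃] at d₃ d₄
    refine ⟨false, (d₁.seq (d₂.seq (((d₃.seq (d₄.seq
      ((does_skip _ _).ite_false.seq (d₈ false acc)))).ite_false).seq (d₉ false acc)))).weaken ?_ ?_⟩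
    · simp [tAdd]; omega
    · simp [kidStep, hp]

end Correctness

end ProximitySearch

namespace ProximitySearch

open Turing

/-! ### Lists of children and moves of the traversal. -/

section Correctness

variable {A : Sub → TM2ComputableAux Sym Sym} {S : SetSystemFamily} {i : S.Inst}
  {π : S.sets i → List (S.U i)} {N : maxSets (S.sets i) → List (maxSets (S.sets i))}
  {F₀ : maxSets (S.sets i)} {B : ℕ} {ρ : Reg → List Sym}

theorem kidStep_length_le (F : maxSets (S.sets i)) (acc : List (maxSets (S.sets i)))
    (Z : maxSets (S.sets i)) : (kidStep N F₀ π F acc Z).length ≤ acc.length + 1 := by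
  rw [kidStep]
  split_ifs <;> simp

/-- Neighbour lists may contain repetitions; the membership test in each step keeps the list of
children free of them, as the traversal requires. -/
theorem foldl_kidStep (F : maxSets (S.sets i)) (l acc : List (maxSets (S.sets i)))
    (hacc : acc.Nodup) : (l.foldl (kidStep N F₀ π F) acc).Nodup ∧
      ∀ Z, Z ∈ l.foldl (kidStep N F₀ π F) acc ↔ Z ∈ acc ∨ Z ∈ l ∧ IsChild N F₀ π Z F := by
  induction l generalizing acc with
  | nil => simpa using hacc
  | cons Y l ih =>
    rw [List.foldl_cons]
    by_cases h : Y ≠ F₀ ∧ parent N F₀ π Y = F ∧ Y ∉ acc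
    · rw [kidStep, if_pos h]
      refine ⟨(ih _ (List.nodup_cons.2 ⟨h.2.2, hacc⟩)).1, fun Z => ?_⟩
      rw [(ih _ (List.nodup_cons.2 ⟨h.2.2, hacc⟩)).2, List.mem_cons, List.mem_cons]
      have : IsChild N F₀ π Y F := ⟨h.1, h.2.1⟩
      constructor
      · rintro ((rfl | h') | h')
        · exact .inr ⟨.inl rfl, this⟩
        · exact .inl h'
        · exact .inr ⟨.inr h'.1, h'.2⟩
      · rintro (h' | ⟨rfl | h', h''⟩)
        · exact .inl (.inr h')
        · exact .inl (.inl rfl)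
        · exact .inr ⟨h', h''⟩
    · rw [kidStep, if_neg h]
      refine ⟨(ih _ hacc).1, fun Z => ?_⟩
      rw [(ih _ hacc).2, List.mem_cons]
      constructor
      · rintro (h' | h')
        · exact .inl h'
        · exact .inr ⟨.inr h'.1, h'.2⟩
      · rintro (h' | ⟨rfl | h', h''⟩)
        · exact .inl h'
        · exact .inl (by by_contra hZ; exact h ⟨h''.1, h''.2, hZ⟩)
        · exact .inr ⟨h', h''⟩

theorem nodup_kids (F : maxSets (S.sets i)) : (kids N F₀ π F).Nodup :=
  (foldl_kidStep F (N F) [] List.nodup_nil).1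

/-- Filtering the neighbours loses no child, because every maximal set other than the root is a
neighbour of its parent. -/
theorem mem_kids (h : Setting A S i π N F₀ B) (F Z : maxSets (S.sets i)) :
    Z ∈ kids N F₀ π F ↔ Par F₀ (parent N F₀ π) Z F := by
  rw [kids, (foldl_kidStep F (N F) [] List.nodup_nil).2]
  constructor
  · rintro (h | ⟨-, h⟩)
    · simp at h
    · exact h
  · rintro ⟨h₁, rfl⟩
    obtain ⟨-, -, -, -, -, -, h₂⟩ := exists_parent h.scheme h.closer h₁
    exact .inr ⟨h₂, h₁, rfl⟩

/-- A time bound for `kidsOf`. -/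
def tKids (B : ℕ) : ℕ := B * (tAdd B + 2) + 40 * B + 60

theorem length_kids_le (F : maxSets (S.sets i)) : (kids N F₀ π F).length ≤ (N F).length := by
  have : ∀ l acc : List (maxSets (S.sets i)),
      (l.foldl (kidStep N F₀ π F) acc).length ≤ acc.length + l.length := by
    intro l
    induction l with
    | nil => simp
    | cons Z l ih =>
      intro acc
      have h1 := ih (kidStep N F₀ π F acc Z)
      have h2 := kidStep_length_le (N := N) (F₀ := F₀) (π := π) F acc Z
      rw [List.foldl_cons, List.length_cons]
      omega
  simpa [kids] using this (N F) []

theorem length_codes_le {l l' : List (maxSets (S.sets i))} (h : l.length ≤ l'.length) :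
    (codes l).length ≤ (codes l').length := by
  rw [length_codes, length_codes]
  exact Nat.mul_le_mul_right _ h

theorem codes_kids_le (h : Setting A S i π N F₀ B) (F : maxSets (S.sets i)) :
    (codes (kids N F₀ π F)).length ≤ B :=
  (length_codes_le (length_kids_le F)).trans (h.nbrs_le F)

theorem does_kidsOf (h : Setting A S i π N F₀ B) (hρ : Clean F₀ ρ) (hi : Idle ρ) (b : Bool)
    {F : maxSets (S.sets i)} (hF : ρ .cur = code F.1) (ht : ρ .todo = []) :
    Does (A := A) kidsOf (flag b) ρ (tKids B) (flag false)
      (Function.update ρ .todo (codes (kids N F₀ π F))) := by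
  have h2 := h.size_le
  have h3 := h.nbrs_le F
  -- The length condition bounds the code of the accepted children by that of the neighbour list,
  -- hence by `B`, throughout the loop.
  have key : ∀ (l acc : List (maxSets (S.sets i))), acc.length + l.length ≤ (N F).length →
      Does (A := A) (Frag.loop hasFlag (addKid.seq (testNonempty .queue))) (flag (!l.isEmpty))
        (kidRegs ρ l acc) (l.length * (tAdd B + 2) + 1) (flag false)
        (kidRegs ρ [] (l.foldl (kidStep N F₀ π F) acc)) := by
    intro l
    induction l with
    | nil => exact fun acc _ => does_loop_false.mono (by simp)
    | cons Z l ih =>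
      intro acc hlen
      rw [List.length_cons] at hlen
      obtain ⟨b', d₁⟩ := does_addKid h hρ hi true (F := F) (Z := Z) (l := l) (acc := acc) hF
        ((length_codes_le (by omega)).trans h3)
      have d₂ := does_testNonempty (A := A) Reg.queue (flag b')
        (kidRegs ρ l (kidStep N F₀ π F acc Z))
      rw [show kidRegs ρ l (kidStep N F₀ π F acc Z) .queue = codes l by simp [kidRegs],
        head_codes_isSome] at d₂
      have h4 := kidStep_length_le (N := N) (F₀ := F₀) (π := π) F acc Z
      refine ((d₁.seq d₂).loop_true (ih _ (by omega))).mono ?_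
      rw [List.length_cons, Nat.add_mul]
      omega
  have d₁ := does_copy (A := A) (r := Reg.cur) (s := .best) (t := .tmp) (t' := .tmp')
    (by decide) (by decide) (by decide) (by decide) b hρ.tmp hρ.tmp'
  generalize e₁ : Function.update ρ Reg.best _ = ρ₁ at d₁
  have c₁ : Clean F₀ ρ₁ := e₁ ▸ hρ.update (by decide) _
  have d₂ := does_nbrsOf h c₁ b (G := F) (by simp [← e₁, hF, hi.best])
  have d₃ := does_clear (A := A) Reg.best b (Function.update ρ₁ .nbrs (codes (N F)))
  have e₃ : Function.update (Function.update ρ₁ .nbrs (codes (N F))) .best [] =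
      Function.update ρ .nbrs (codes (N F)) := by
    funext u
    cases u <;> simp [← e₁, hi.best]
  rw [e₃] at d₃
  -- The list must leave `nbrs`, since each computation of a parent needs that register empty. Two
  -- moves preserve its order.
  have d₄ := does_pour (A := A) (r := Reg.nbrs) (s := .tmp) (by decide) b
    (Function.update ρ .nbrs (codes (N F)))
  have e₄ : Function.update (Function.update (Function.update ρ .nbrs (codes (N F))) .tmp
      ((Function.update ρ .nbrs (codes (N F)) .nbrs).reverse ++
        Function.update ρ .nbrs (codes (N F)) .tmp)) .nbrs [] =
      Function.update ρ .tmp (codes (N F)).reverse := by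
    funext u
    cases u <;> simp [hρ.tmp, hρ.nbrs]
  rw [e₄] at d₄
  have d₅ := does_pour (A := A) (r := Reg.tmp) (s := .queue) (by decide) b
    (Function.update ρ .tmp (codes (N F)).reverse)
  have e₅ : Function.update (Function.update (Function.update ρ .tmp (codes (N F)).reverse) .queue
      ((Function.update ρ .tmp (codes (N F)).reverse .tmp).reverse ++
        Function.update ρ .tmp (codes (N F)).reverse .queue)) .tmp [] = kidRegs ρ (N F) [] := by
    funext u
    cases u <;> simp [hρ.tmp, hi.queue, hi.kids, kidRegs]
  rw [e₅] at d₅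
  have d₆ := does_testNonempty (A := A) Reg.queue (flag b) (kidRegs ρ (N F) [])
  rw [show kidRegs ρ (N F) [] .queue = codes (N F) by simp [kidRegs], head_codes_isSome] at d₆
  have d₇ := key (N F) [] (by simp)
  have e₇ : kidRegs ρ [] ((N F).foldl (kidStep N F₀ π F) []) =
      Function.update ρ .kids (codes (kids N F₀ π F)) := by
    funext u
    cases u <;> simp [kidRegs, hi.queue, kids]
  rw [e₇] at d₇
  have d₈ := does_pour (A := A) (r := Reg.kids) (s := .tmp) (by decide) false
    (Function.update ρ .kids (codes (kids N F₀ π F)))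
  have e₈ : Function.update (Function.update (Function.update ρ .kids (codes (kids N F₀ π F))) .tmp
      ((Function.update ρ .kids (codes (kids N F₀ π F)) .kids).reverse ++
        Function.update ρ .kids (codes (kids N F₀ π F)) .tmp)) .kids [] =
      Function.update ρ .tmp (codes (kids N F₀ π F)).reverse := by
    funext u
    cases u <;> simp [hρ.tmp, hi.kids]
  rw [e₈] at d₈
  have d₉ := does_pour (A := A) (r := Reg.tmp) (s := .todo) (by decide) false
    (Function.update ρ .tmp (codes (kids N F₀ π F)).reverse)
  have h5 := codes_kids_le h F
  have l₁ : ρ₁ .best = code F.1 := by simp [← e₁, hF, hi.best]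
  refine (d₁.seq (d₂.seq (d₃.seq (d₄.seq (d₅.seq (d₆.seq (d₇.seq (d₈.seq d₉)))))))).weaken ?_ ?_
  · have h6 : (N F).length ≤ B := by
      have := length_codes (N F)
      have : (N F).length * 1 ≤ (N F).length * (S.size i + 1) := Nat.mul_le_mul_left _ (by omega)
      omega
    have h7 : (N F).length * (tAdd B + 2) ≤ B * (tAdd B + 2) := Nat.mul_le_mul_right _ h6
    simp [hF, l₁, tKids]
    omega
  · funext u
    cases u <;> simp [hρ.tmp, ht]

/-- The registers before and after the moves of the traversal. -/
def stateRegs (F₀ F : maxSets (S.sets i)) (l : List (maxSets (S.sets i)))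
    (o : maxSets (S.sets i)) : Reg → List Sym
  | .inst => encWord (S.encode i)
  | .root => code F₀.1
  | .cur => code F.1
  | .todo => codes l
  | .out => code o.1
  | _ => []

theorem clean_stateRegs (F : maxSets (S.sets i)) (l : List (maxSets (S.sets i)))
    (o : maxSets (S.sets i)) : Clean F₀ (stateRegs F₀ F l o) := ⟨rfl, rfl, rfl, rfl, rfl, rfl⟩

theorem idle_stateRegs (F : maxSets (S.sets i)) (l : List (maxSets (S.sets i)))
    (o : maxSets (S.sets i)) : Idle (stateRegs F₀ F l o) :=
  ⟨rfl, rfl, rfl, rfl, rfl, rfl, rfl, rfl, rfl⟩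

theorem update_todo_stateRegs (F : maxSets (S.sets i)) (l l' : List (maxSets (S.sets i)))
    (o : maxSets (S.sets i)) :
    Function.update (stateRegs F₀ F l o) .todo (codes l') = stateRegs F₀ F l' o := by
  funext u
  cases u <;> simp [stateRegs]

/-- A time bound for `enter`. -/
def tEnter (B : ℕ) : ℕ := tKids B + 30 * B + 60

theorem does_enter (h : Setting A S i π N F₀ B) (b : Bool) {F Z o : maxSets (S.sets i)}
    {l : List (maxSets (S.sets i))} (hl : (codes (Z :: l)).length ≤ B) :
    Does (A := A) enter (flag b) (stateRegs F₀ F (Z :: l) o) (tEnter B) (flag false)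
      (stateRegs F₀ Z (kids N F₀ π Z) Z) := by
  have h2 := h.size_le
  have d₁ := does_clear (A := A) Reg.cur b (stateRegs F₀ F (Z :: l) o)
  generalize e₁ : Function.update _ Reg.cur _ = ρ₁ at d₁
  have d₂ := does_clear (A := A) Reg.out b ρ₁
  generalize e₂ : Function.update _ Reg.out _ = ρ₂ at d₂
  have d₃ := does_moveWord (A := A) (r := Reg.todo) (s := .cur) (t := .tmp) (ρ := ρ₂) (by decide)
    (by decide) (by decide) b (w := S.charVec Z.1) (l := codes l)
    (by simp [← e₂, ← e₁, stateRegs]) (by simp [← e₂, ← e₁, stateRegs, codes_cons])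
  generalize e₃ : Function.update (Function.update ρ₂ _ _) _ _ = ρ₃ at d₃
  -- The unvisited siblings are forgotten here and recomputed on leaving; this keeps the space
  -- independent of the depth.
  have d₄ := does_clear (A := A) Reg.todo b ρ₃
  generalize e₄ : Function.update _ Reg.todo _ = ρ₄ at d₄
  have d₅ := does_copy (A := A) (r := Reg.cur) (s := .out) (t := .tmp) (t' := .tmp')
    (by decide) (by decide) (by decide) (by decide) b (ρ := ρ₄)
    (by simp [← e₄, ← e₃, ← e₂, ← e₁, stateRegs]) (by simp [← e₄, ← e₃, ← e₂, ← e₁, stateRegs])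
  have l₁ : ρ₁ .out = code o.1 := by simp [← e₁, stateRegs]
  have l₃ : ρ₃ .todo = codes l := by simp [← e₃]
  have l₄ : ρ₄ .cur = code Z.1 := by simp [← e₄, ← e₃, ← e₂, ← e₁]
  have e₅ : Function.update ρ₄ .out (ρ₄ .cur ++ ρ₄ .out) = stateRegs F₀ Z [] Z := by
    subst e₄ e₃ e₂ e₁
    funext u
    cases u <;> simp [stateRegs]
  rw [e₅, l₄] at d₅
  have d₆ := does_kidsOf h (clean_stateRegs (F₀ := F₀) Z [] Z) (idle_stateRegs Z [] Z) b (F := Z)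
    rfl rfl
  refine (d₁.seq (d₂.seq (d₃.seq (d₄.seq (d₅.seq d₆))))).weaken ?_ (update_todo_stateRegs _ _ _ _)
  rw [codes_cons, List.length_append] at hl
  simp [l₁, l₃, tEnter, stateRegs]
  omega

/-- A time bound for `leave`. -/
def tLeave (B : ℕ) : ℕ := tKids B + tParent B + B * (10 * B + 22) + 60 * B + 100

/-- The vertex left behind is kept in `out`, which locates it in the recomputed list of siblings. No
earlier sibling contains it, because distinct maximal sets are incomparable. -/
theorem does_leave (h : Setting A S i π N F₀ B) (b : Bool) {F o : maxSets (S.sets i)}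
    (hF : F ≠ F₀) :
    Does (A := A) leave (flag b) (stateRegs F₀ F [] o) (tLeave B) (flag true)
      (stateRegs F₀ (parent N F₀ π F) (after F (kids N F₀ π (parent N F₀ π F))) F) := by
  have h2 := h.size_le
  have h3 := codes_kids_le h (parent N F₀ π F)
  obtain ⟨pre, post, hk⟩ := List.append_of_mem ((mem_kids h (parent N F₀ π F) F).2 ⟨hF, rfl⟩)
  have hnd := nodup_kids (N := N) (F₀ := F₀) (π := π) (parent N F₀ π F)
  have hpre : ∀ W ∈ pre, ¬ F.1 ⊆ W.1 := fun W hW hFW => by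
    rw [hk] at hnd
    exact (List.nodup_append.1 hnd).2.2 W hW F (by simp) (maxSets_eq_of_subset hFW).symm
  have ha : after F (kids N F₀ π (parent N F₀ π F)) = post := by
    rw [hk] at hnd ⊢
    exact after_append hnd
  rw [ha]
  have d₁ := does_clear (A := A) Reg.out b (stateRegs F₀ F [] o)
  generalize e₁ : Function.update _ Reg.out _ = ρ₁ at d₁
  have d₂ := does_copy (A := A) (r := Reg.cur) (s := .out) (t := .tmp) (t' := .tmp')
    (by decide) (by decide) (by decide) (by decide) b (ρ := ρ₁)
    (by simp [← e₁, stateRegs]) (by simp [← e₁, stateRegs])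
  have l₁ : ρ₁ .cur = code F.1 := by simp [← e₁, stateRegs]
  have e₂ : Function.update ρ₁ .out (ρ₁ .cur ++ ρ₁ .out) = stateRegs F₀ F [] F := by
    subst e₁
    funext u
    cases u <;> simp [stateRegs]
  rw [e₂, l₁] at d₂
  have d₃ := does_pour (A := A) (r := Reg.cur) (s := .tmp) (by decide) b (stateRegs F₀ F [] F)
  generalize e₃ : Function.update (Function.update _ _ _) Reg.cur _ = ρ₃ at d₃
  have d₄ := does_pour (A := A) (r := Reg.tmp) (s := .cand) (by decide) b ρ₃
  generalize e₄ : Function.update (Function.update ρ₃ _ _) Reg.tmp _ = ρ₄ at d₄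
  have l₃ : ρ₃ .tmp = (code F.1).reverse := by simp [← e₃, stateRegs]
  have e₄' : ρ₄ = Function.update (Function.update (stateRegs F₀ F [] F) .cur []) .cand
      (code F.1) := by
    subst e₄ e₃
    funext u
    cases u <;> simp [stateRegs]
  have c₄ : Clean F₀ ρ₄ :=
    e₄' ▸ ((clean_stateRegs _ _ _).update (by decide) _).update (by decide) _
  have d₅ := does_parentOf h c₄ b (Y := F) (by simp [e₄']) (by simp [e₄', stateRegs])
    (by simp [e₄', stateRegs]) (by simp [e₄', stateRegs]) (by simp [e₄', stateRegs])
  generalize e₅ : Function.update ρ₄ Reg.par _ = ρ₅ at d₅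
  have d₆ := does_clear (A := A) Reg.cand false ρ₅
  generalize e₆ : Function.update ρ₅ Reg.cand _ = ρ₆ at d₆
  have l₅ : ρ₅ .cand = code F.1 := by simp [← e₅, e₄']
  have d₇ := does_pour (A := A) (r := Reg.par) (s := .tmp) (by decide) false ρ₆
  generalize e₇ : Function.update (Function.update ρ₆ _ _) Reg.par _ = ρ₇ at d₇
  have l₆ : ρ₆ .par = code (parent N F₀ π F).1 := by simp [← e₆, ← e₅]
  have d₈ := does_pour (A := A) (r := Reg.tmp) (s := .cur) (by decide) false ρ₇
  have l₇ : ρ₇ .tmp = (code (parent N F₀ π F).1).reverse := by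
    simp [← e₇, ← e₆, ← e₅, c₄.tmp]
  have e₈ : Function.update (Function.update ρ₇ .cur ((ρ₇ .tmp).reverse ++ ρ₇ .cur)) .tmp [] =
      stateRegs F₀ (parent N F₀ π F) [] F := by
    subst e₇ e₆ e₅ e₄'
    funext u
    cases u <;> simp [stateRegs]
  rw [e₈] at d₈
  have d₉ := does_kidsOf h (clean_stateRegs (F₀ := F₀) (parent N F₀ π F) [] F)
    (idle_stateRegs _ [] F) false rfl rfl
  rw [update_todo_stateRegs] at d₉
  have d₁₀ := does_seek_sets (A := A) (ρ := stateRegs F₀ (parent N F₀ π F)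
    (kids N F₀ π (parent N F₀ π F)) F) (c := .out) (n := .todo) h2 (by decide) (by decide)
    (by decide) false hpre (Finset.Subset.refl F.1) rfl rfl rfl (by rw [← hk]; rfl) (hk ▸ h3)
  rw [update_todo_stateRegs] at d₁₀
  have d₁₁ := does_dropWord (A := A) (r := .todo) (t := .tmp) (by decide) true
    (ρ := stateRegs F₀ (parent N F₀ π F) (F :: post) F) (w := S.charVec F.1) (l := codes post)
    rfl rfl
  rw [update_todo_stateRegs] at d₁₁
  refine (d₁.seq (d₂.seq (d₃.seq (d₄.seq (d₅.seq (d₆.seq (d₇.seq (d₈.seq (d₉.seq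
    (d₁₀.seq d₁₁)))))))))).mono ?_
  simp [l₃, l₅, l₆, l₇, tLeave, stateRegs]
  omega

/-- A time bound for `moveProg`. -/
def tMove (B : ℕ) : ℕ := tEnter B + tLeave B + 2

/-- The unvisited children form a suffix of the full list of children, which bounds the length of
their code. -/
theorem does_moveProg (h : Setting A S i π N F₀ B) (b : Bool)
    {s : maxSets (S.sets i) × List (maxSets (S.sets i))} {o : maxSets (S.sets i)}
    (hs : s ≠ (F₀, [])) (hl : s.2 <:+ kids N F₀ π s.1) :
    ∃ b', Does (A := A) moveProg (flag b) (stateRegs F₀ s.1 s.2 o) (tMove B) (flag b')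
      (stateRegs F₀ (move (parent N F₀ π) (kids N F₀ π) s).1
        (move (parent N F₀ π) (kids N F₀ π) s).2 (visited s)) := by
  obtain ⟨F, l⟩ := s
  have d₁ := does_testNonempty (A := A) Reg.todo (flag b) (stateRegs F₀ F l o)
  rw [show stateRegs F₀ F l o .todo = codes l from rfl, head_codes_isSome] at d₁
  cases l with
  | nil =>
    refine ⟨true, (d₁.seq (does_leave h false ?_).ite_false).mono ?_⟩
    · rintro rfl
      exact hs rfl
    · simp [tMove]; omega
  | cons Z l =>
    refine ⟨false, (d₁.seq (does_enter h true
      ((length_codes_le hl.length_le).trans (codes_kids_le h F))).ite_true).mono ?_⟩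
    simp [tMove]; omega

theorem after_suffix {V : Type} [DecidableEq V] (v : V) (l : List V) : after v l <:+ l :=
  (List.tail_suffix _).trans (List.dropWhile_suffix _)

theorem move_suffix (s : maxSets (S.sets i) × List (maxSets (S.sets i))) :
    (move (parent N F₀ π) (kids N F₀ π) s).2 <:+
      kids N F₀ π (move (parent N F₀ π) (kids N F₀ π) s).1 := by
  obtain ⟨F, _ | ⟨Z, l⟩⟩ := s
  · exact after_suffix _ _
  · exact List.suffix_rfl

/-- A time bound for `mainProg`. -/
def tMain (B : ℕ) : ℕ := 2 * tMove B + 10 * B + 40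

theorem does_mainProg_done (h : Setting A S i π N F₀ B) (b : Bool) {o : maxSets (S.sets i)} :
    Does (A := A) mainProg (flag b) (stateRegs F₀ F₀ [] o) (tMain B) (flag true)
      (stateRegs F₀ F₀ [] o) := by
  have h2 := h.size_le
  have d₁ := does_testNonempty (A := A) Reg.todo (flag b) (stateRegs F₀ F₀ [] o)
  rw [show stateRegs F₀ F₀ [] o .todo = codes [] from rfl, head_codes_isSome] at d₁
  have d₂ := does_subTest (A := A) (r := .cur) (s := .root) (t := .tmp) (t' := .tmp')
    (by decide) (by decide) (by decide) (by decide) (by decide) (by decide) false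
    (ρ := stateRegs F₀ F₀ [] o) (u := S.charVec F₀.1) (w := S.charVec F₀.1) (l := [])
    rfl rfl rfl (by rw [List.append_nil]; rfl) rfl
  rw [subWord_maxSets, decide_eq_true rfl] at d₂
  refine (d₁.seq ((d₂.ite_false (F := setFlag false)).seq
    ((does_skip _ _).ite_true))).mono ?_
  simp [tMain]
  omega

/-- The second move of the pair determines the register `out`, in accordance with `PairTour`.
Neither move may start in the final state, where there is no parent to return to. -/
theorem does_mainProg (h : Setting A S i π N F₀ B) (b : Bool)
    {s s' : maxSets (S.sets i) × List (maxSets (S.sets i))} {o : maxSets (S.sets i)}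
    (hs : s ≠ (F₀, [])) (hl : s.2 <:+ kids N F₀ π s.1)
    (hs' : move (parent N F₀ π) (kids N F₀ π) s = s') (hs'' : s' ≠ (F₀, [])) :
    Does (A := A) mainProg (flag b) (stateRegs F₀ s.1 s.2 o) (tMain B) (flag false)
      (stateRegs F₀ (move (parent N F₀ π) (kids N F₀ π) s').1
        (move (parent N F₀ π) (kids N F₀ π) s').2 (visited s')) := by
  have h2 := h.size_le
  obtain ⟨b₁, d₃⟩ := does_moveProg h false (o := o) hs hl
  rw [hs'] at d₃
  obtain ⟨b₂, d₄⟩ := does_moveProg h b₁ (o := visited s) hs'' (hs' ▸ move_suffix s)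
  have d₅ := does_setFlag (A := A) false (flag b₂) (stateRegs F₀
    (move (parent N F₀ π) (kids N F₀ π) s').1 (move (parent N F₀ π) (kids N F₀ π) s').2
    (visited s'))
  have d₆ := Does.ite_false (F := skip) (d₃.seq (d₄.seq d₅))
  have d₁ := does_testNonempty (A := A) Reg.todo (flag b) (stateRegs F₀ s.1 s.2 o)
  rw [show stateRegs F₀ s.1 s.2 o .todo = codes s.2 from rfl, head_codes_isSome] at d₁
  obtain ⟨F, _ | ⟨Z, l⟩⟩ := s
  · have hF : F ≠ F₀ := by
      rintro rfl
      exact hs rfl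
    have d₂ := does_subTest (A := A) (r := .cur) (s := .root) (t := .tmp) (t' := .tmp')
      (by decide) (by decide) (by decide) (by decide) (by decide) (by decide) false
      (ρ := stateRegs F₀ F [] o) (u := S.charVec F.1) (w := S.charVec F₀.1) (l := [])
      rfl rfl rfl (by rw [List.append_nil]; rfl) (by simp)
    rw [subWord_maxSets, decide_eq_false hF] at d₂
    refine (d₁.seq ((d₂.ite_false (F := setFlag false)).seq d₆)).mono ?_
    simp [tMain]
    omega
  · have d₂ := does_setFlag (A := A) false (flag true) (stateRegs F₀ F (Z :: l) o)
    have d₇ := Does.ite_true (G := subTest Reg.cur Reg.root Reg.tmp Reg.tmp') d₂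
    refine (d₁.seq (d₇.seq d₆)).mono ?_
    simp [tMain]
    omega

/-- A time bound for `initProg`. -/
def tInit (B : ℕ) : ℕ := tKids B + 30 * B + 60

theorem does_initProg (h : Setting A S i π N F₀ B) (b : Bool)
    (hρ : ρ = Function.update (fun _ => []) .inst (encWord (S.encode i))) :
    Does (A := A) initProg (flag b) ρ (tInit B) (flag false)
      (stateRegs F₀ F₀ (kids N F₀ π F₀) F₀) := by
  have h1 := h.inst_le
  have h2 := h.size_le
  have d₁ := does_copyRev (A := A) (r := Reg.inst) (s := .inp) (t := .tmp) (by decide) (by decide)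
    (by decide) b (ρ := ρ) (by simp [hρ])
  generalize e₁ : Function.update _ Reg.inp _ = ρ₁ at d₁
  have d₂ := h.first ρ₁ b (by simp [← e₁, hρ])
  generalize e₂ : Function.update _ Reg.inp _ = ρ₂ at d₂
  have d₃ := does_pour (A := A) (r := Reg.inp) (s := .root) (by decide) b ρ₂
  generalize e₃ : Function.update (Function.update _ _ _) Reg.inp _ = ρ₃ at d₃
  have l₀ : ρ .inst = encWord (S.encode i) := by simp [hρ]
  have l₂ : ρ₂ .inp = (code F₀.1).reverse := by simp [← e₂]
  have e₃' : ρ₃ = Function.update (Function.update (fun _ => []) .inst (encWord (S.encode i)))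
      .root (code F₀.1) := by
    subst e₃ e₂ e₁ hρ
    funext u
    cases u <;> simp
  have d₄ := does_copy (A := A) (r := Reg.root) (s := .cur) (t := .tmp) (t' := .tmp')
    (by decide) (by decide) (by decide) (by decide) b (ρ := ρ₃) (by simp [e₃']) (by simp [e₃'])
  generalize e₄ : Function.update _ Reg.cur _ = ρ₄ at d₄
  have d₅ := does_copy (A := A) (r := Reg.root) (s := .out) (t := .tmp) (t' := .tmp')
    (by decide) (by decide) (by decide) (by decide) b (ρ := ρ₄) (by simp [← e₄, e₃'])
    (by simp [← e₄, e₃'])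
  have l₃ : ρ₃ .root = code F₀.1 := by simp [e₃']
  have l₄ : ρ₄ .root = code F₀.1 := by simp [← e₄, l₃]
  have e₅ : Function.update ρ₄ .out (ρ₄ .root ++ ρ₄ .out) = stateRegs F₀ F₀ [] F₀ := by
    subst e₄ e₃'
    funext u
    cases u <;> simp [stateRegs]
  rw [e₅] at d₅
  have d₆ := does_kidsOf h (clean_stateRegs (F₀ := F₀) F₀ [] F₀) (idle_stateRegs _ [] F₀) b rfl rfl
  rw [update_todo_stateRegs] at d₆
  refine (d₁.seq (d₂.seq (d₃.seq (d₄.seq (d₅.seq d₆))))).mono ?_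
  simp [l₀, l₂, l₃, l₄, tInit]
  omega

end Correctness

end ProximitySearch

namespace ProximitySearch

open Turing

/-! ### Enumeration machines -/

namespace EnumMachine

variable (M : EnumMachine)

/-- The machine emits the word `v` at the configuration `c`. -/
def Emits (c : M.tm.Cfg) (v : List Sym) : Prop :=
  (∃ l ∈ M.emit, c.l = some l) ∧ c.stk M.tm.k₁ = v.map M.outputAlphabet.invFun

/-- From the configuration `c` on, the machine emits the words in `vs`, each once, with delay at
most `d` and in space `b`, and halts. -/
structure Lists (d b : ℕ) (c : M.tm.Cfg) (vs : List (List Sym)) : Prop where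
  halts : ∃ t c', StepsTo M.tm.m t c c' ∧ c'.l = none
  sound : ∀ t c' v, StepsTo M.tm.m t c c' → M.Emits c' v → v ∈ vs
  exactly_once : ∀ v ∈ vs, ∃! t, ∃ c', StepsTo M.tm.m t c c' ∧ M.Emits c' v
  delay_le : ∀ t c', StepsTo M.tm.m t c c' → c'.l ≠ none →
    ∃ t', t < t' ∧ t' ≤ t + d ∧ ∃ c'', StepsTo M.tm.m t' c c'' ∧ (c''.l = none ∨ ∃ v, M.Emits c'' v)
  space_le : ∀ t c', StepsTo M.tm.m t c c' → M.space c' ≤ b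

variable {M}

theorem Lists.of_halted {d b : ℕ} {c : M.tm.Cfg} (hc : c.l = none) (hb : M.space c ≤ b) :
    M.Lists d b c [] where
  halts := ⟨0, c, .refl c, hc⟩
  sound t c' v h := by
    rintro ⟨⟨l, -, hl⟩, -⟩
    cases t with
    | zero => rw [← h.of_zero, hc] at hl; simp at hl
    | succ t => exact absurd h (StepsTo.not_succ_of_halted hc)
  exactly_once v hv := by simp at hv
  delay_le t c' h := by
    cases t with
    | zero => rw [← h.of_zero]; exact fun h => absurd hc h
    | succ t => exact absurd h (StepsTo.not_succ_of_halted hc)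
  space_le t c' h := by
    cases t with
    | zero => rwa [← h.of_zero]
    | succ t => exact absurd h (StepsTo.not_succ_of_halted hc)

/-- A run is assembled backwards from legs, each silent strictly between its end points. Here `pre`
holds what is emitted at the start: nothing for the preparation, one set for every later leg. The
hypothesis `hdis` excludes repeated emission. -/
theorem Lists.leg {d b t₀ : ℕ} {c c₁ : M.tm.Cfg} {pre vs : List (List Sym)}
    (h : StepsTo M.tm.m t₀ c c₁) (h₀ : 0 < t₀) (hd : t₀ ≤ d)
    (hsilent : ∀ s c', 0 < s → s < t₀ → StepsTo M.tm.m s c c' → ∃ l ∉ M.emit, c'.l = some l)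
    (hspace : ∀ s c', s ≤ d → StepsTo M.tm.m s c c' → M.space c' ≤ b)
    (hpre : ∀ v, M.Emits c v ↔ v ∈ pre) (hdis : ∀ v ∈ pre, v ∉ vs)
    (hlist : M.Lists d b c₁ vs)
    (hend : c₁.l = none ∨ ∃ v, M.Emits c₁ v) : M.Lists d b c (pre ++ vs) := by
  -- By determinism, a moment of the run is the start, a silent moment inside the leg, or a moment
  -- of the run from `c₁`.
  have hcases : ∀ t c', StepsTo M.tm.m t c c' → (t = 0 ∧ c' = c) ∨
      (0 < t ∧ t < t₀ ∧ ∀ v, ¬ M.Emits c' v) ∨ ∃ s, t = t₀ + s ∧ StepsTo M.tm.m s c₁ c' := by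
    intro t c' ht
    rcases Nat.eq_zero_or_pos t with rfl | h1
    · exact .inl ⟨rfl, ht.of_zero.symm⟩
    rcases lt_or_ge t t₀ with h2 | h2
    · refine .inr (.inl ⟨h1, h2, ?_⟩)
      rintro v ⟨⟨l, hl, hl'⟩, -⟩
      obtain ⟨l', hl₂, hl₂'⟩ := hsilent t c' h1 h2 ht
      rw [hl'] at hl₂'
      cases hl₂'
      exact hl₂ hl
    · obtain ⟨s, rfl⟩ := Nat.exists_eq_add_of_le h2
      obtain ⟨c₂, h3, h4⟩ := ht.split
      rw [h3.unique h] at h4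
      exact .inr (.inr ⟨s, rfl, h4⟩)
  refine ⟨?_, ?_, ?_, ?_, ?_⟩
  · obtain ⟨t, c', h1, h2⟩ := hlist.halts
    exact ⟨t₀ + t, c', h.trans h1, h2⟩
  · intro t c' v ht hv
    rw [List.mem_append]
    rcases hcases t c' ht with ⟨-, rfl⟩ | ⟨-, -, h'⟩ | ⟨s, -, hs⟩
    · exact .inl ((hpre v).1 hv)
    · exact absurd hv (h' v)
    · exact .inr (hlist.sound s c' v hs hv)
  · intro v hv
    by_cases hv' : v ∈ pre
    · refine ⟨0, ⟨c, .refl c, (hpre v).2 hv'⟩, ?_⟩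
      rintro t ⟨c', ht, hc'⟩
      rcases hcases t c' ht with ⟨rfl, -⟩ | ⟨-, -, h'⟩ | ⟨s, -, hs⟩
      · rfl
      · exact absurd hc' (h' v)
      · exact absurd (hlist.sound s c' v hs hc') (hdis v hv')
    · obtain ⟨s, ⟨c', hs, hc'⟩, huniq⟩ :=
        hlist.exactly_once v ((List.mem_append.1 hv).resolve_left hv')
      refine ⟨t₀ + s, ⟨c', h.trans hs, hc'⟩, ?_⟩
      rintro t ⟨c'', ht, hc''⟩
      rcases hcases t c'' ht with ⟨-, rfl⟩ | ⟨-, -, h'⟩ | ⟨s', rfl, hs'⟩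
      · exact absurd ((hpre v).1 hc'') hv'
      · exact absurd hc'' (h' v)
      · rw [huniq s' ⟨c'', hs', hc''⟩]
  · intro t c' ht hc'
    rcases lt_or_ge t t₀ with h2 | h2
    -- Inside the leg, the next event is at its end, at most `d` steps away since `t₀ ≤ d`.
    · exact ⟨t₀, h2, by omega, c₁, h, hend⟩
    · rcases hcases t c' ht with ⟨rfl, -⟩ | ⟨-, h', -⟩ | ⟨s, rfl, hs⟩
      · omega
      · omega
      · obtain ⟨t', h3, h4, c'', h5, h6⟩ := hlist.delay_le s c' hs hc'
        exact ⟨t₀ + t', by omega, by omega, c'', h.trans h5, h6⟩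
  · intro t c' ht
    rcases lt_or_ge t t₀ with h2 | h2
    · exact hspace t c' (by omega) ht
    · rcases hcases t c' ht with ⟨rfl, -⟩ | ⟨-, h', -⟩ | ⟨s, rfl, hs⟩
      · omega
      · omega
      · exact hlist.space_le s c' hs

theorem Lists.enumerates {d b : ℕ} {w : List Sym} {β : Type} {code : β → List Sym} {sols : Set β}
    {l : List β}
    (h : M.Lists d b (initList M.tm (w.map M.inputAlphabet.invFun)) (l.map code))
    (hl : ∀ F, F ∈ l ↔ F ∈ sols) : M.Enumerates w code sols d b where
  halts := h.halts
  sound := by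
    rintro t v ⟨c, hc, hv⟩
    obtain ⟨F, hF, rfl⟩ := List.mem_map.1 (h.sound t c v hc hv)
    exact ⟨F, (hl F).1 hF, rfl⟩
  exactly_once F hF := h.exactly_once (code F) (List.mem_map_of_mem ((hl F).2 hF))
  delay_le t c hc hl := by
    obtain ⟨t', h1, h2, c', h3, h4 | ⟨v, h4⟩⟩ := h.delay_le t c hc hl
    · exact ⟨t', h1, h2, .inl ⟨c', h3, h4⟩⟩
    · exact ⟨t', h1, h2, .inr ⟨v, c', h3, h4⟩⟩
  space_le := h.space_le

end EnumMachine

/-! ### The enumeration machine: preparation, then pairs of moves. -/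

section Machine

variable (A : Sub → TM2ComputableAux Sym Sym)

/-- The program of the enumeration machine. -/
def enumCode : Bool ⊕ (initProg (A := A)).Λ ⊕ (mainProg (A := A)).Λ →
    TM2.Stmt (Alph A Reg) (Bool ⊕ (initProg (A := A)).Λ ⊕ (mainProg (A := A)).Λ) (Vars A)
  | .inl false => .goto fun _ => .inr (.inr mainProg.entry)
  | .inl true => .branch hasFlag .halt (.goto fun _ => .inl false)
  | .inr (.inl l) => relabel (.inr ∘ .inl) (some (.inl false)) (initProg.code l)
  | .inr (.inr l) => relabel (.inr ∘ .inr) (some (.inl true)) (mainProg.code l)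

/-- The enumeration machine. -/
def enumMachine : EnumMachine :=
  haveI := (initProg (A := A)).fin
  haveI := (mainProg (A := A)).fin
  haveI := fun j => (A j).tm.kFin
  haveI := fun j => (A j).tm.σFin
  haveI : Fintype (Alph A Reg (.inl .inst)) := inferInstanceAs (Fintype Sym)
  { tm :=
    { K := Stack A Reg
      k₀ := .inl .inst
      k₁ := .inl .out
      Γ := Alph A Reg
      Λ := Bool ⊕ (initProg (A := A)).Λ ⊕ (mainProg (A := A)).Λ
      main := .inr (.inl initProg.entry)
      σ := Vars A
      initialState := (flag false, idle)
      m := enumCode A }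
    inputAlphabet := Equiv.refl Sym
    outputAlphabet := Equiv.refl Sym
    emit := {.inl false} }

variable {A}

theorem space_enumMachine (l : Option (enumMachine A).tm.Λ) (v : Vars A) (ρ : Reg → List Sym) :
    (enumMachine A).space ⟨l, v, tapes ρ fun _ _ => []⟩ = ∑ r, (ρ r).length := by
  unfold EnumMachine.space
  let := fun j => (A j).tm.kFin
  refine (Fintype.sum_sum_type (fun k : Stack A Reg =>
    (tapes (A := A) ρ (fun _ _ => []) k).length)).trans ?_
  simp

theorem inr_notMem_emit (l : (initProg (A := A)).Λ ⊕ (mainProg (A := A)).Λ) :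
    Sum.inr l ∉ (enumMachine A).emit :=
  Sum.inr_ne_inl

theorem inl_true_notMem_emit : Sum.inl true ∉ (enumMachine A).emit :=
  fun h => Bool.noConfusion (Sum.inl_injective h)

end Machine

end ProximitySearch

namespace ProximitySearch

open Turing

theorem EnumMachine.exists_space_bound (M : EnumMachine) : ∃ C, ∀ t c c',
    StepsTo M.tm.m t c c' → M.space c' ≤ M.space c + C * t :=
  @exists_stackSize_bound M.tm.K _ M.tm.kFin M.tm.Γ M.tm.σ M.tm.Λ M.tm.ΛFin M.tm.m

/-! ### Delay and space of the enumeration machine. -/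

section Machine

variable {A : Sub → TM2ComputableAux Sym Sym} {S : SetSystemFamily} {i : S.Inst}
  {π : S.sets i → List (S.U i)} {N : maxSets (S.sets i) → List (maxSets (S.sets i))}
  {F₀ : maxSets (S.sets i)} {B : ℕ}

theorem sum_stateRegs_le (h : Setting A S i π N F₀ B)
    {F o : maxSets (S.sets i)} {l : List (maxSets (S.sets i))} (hl : l <:+ kids N F₀ π F) :
    ∑ r, (stateRegs F₀ F l o r).length ≤ Fintype.card Reg * B := by
  have h1 := h.inst_le
  have h2 := h.size_le
  have h3 := (length_codes_le hl.length_le).trans (codes_kids_le h F)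
  rw [← smul_eq_mul]
  refine Finset.sum_le_card_nsmul _ _ _ fun r _ => ?_
  cases r <;> simp [stateRegs] <;> assumption

/-- A bound for the delay of the enumeration machine. -/
def delayBound (B : ℕ) : ℕ := tInit B + tMain B + 2

/-- The enumeration machine at an output label. -/
def emitCfg (A : Sub → TM2ComputableAux Sym Sym) (F₀ : maxSets (S.sets i))
    (s : maxSets (S.sets i) × List (maxSets (S.sets i))) (o : maxSets (S.sets i)) :
    (enumMachine A).tm.Cfg :=
  ⟨some (.inl false), (flag false, idle), tapes (stateRegs F₀ s.1 s.2 o) fun _ _ => []⟩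

theorem emits_emitCfg (s : maxSets (S.sets i) × List (maxSets (S.sets i)))
    (o : maxSets (S.sets i)) (v : List Sym) :
    (enumMachine A).Emits (emitCfg A F₀ s o) v ↔ v ∈ [code o.1] := by
  rw [List.mem_singleton]
  constructor
  · rintro ⟨-, h⟩
    have h' : code o.1 = v.map id := h
    rw [h', List.map_id]
  · rintro rfl
    exact ⟨⟨_, rfl, rfl⟩, show code o.1 = (code o.1).map id by rw [List.map_id]⟩

theorem code_injective {F G : maxSets (S.sets i)} (h : code F.1 = code G.1) : F = G := by
  have h' : S.charVec F.1 = S.charVec G.1 := by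
    simpa [code, encWord, (List.map_injective_iff.2 (Option.some_injective Bool)).eq_iff] using h
  have := subWord_maxSets F G
  rw [h', subWord_maxSets G G] at this
  simpa using this.symm

/-- The two extra steps are the jump from the output label into `mainProg` and the final branch,
which halts or returns to the output label. -/
theorem exists_leg {ρ ρ' : Reg → List Sym} {b : Bool} {T : ℕ}
    (h : Does (A := A) mainProg (flag false) ρ T (flag b) ρ') :
    ∃ t ≤ T + 2, 0 < t ∧ StepsTo (enumMachine A).tm.m t
      ⟨some (.inl false), (flag false, idle), tapes ρ fun _ _ => []⟩
      ⟨if b then none else some (.inl false), (flag b, idle), tapes ρ' fun _ _ => []⟩ ∧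
      ∀ s c', 0 < s → s < t → StepsTo (enumMachine A).tm.m s
        ⟨some (.inl false), (flag false, idle), tapes ρ fun _ _ => []⟩ c' →
        ∃ l ∉ (enumMachine A).emit, c'.l = some l := by
  obtain ⟨t, ht, h⟩ := h
  have h₁ : StepsTo (enumCode A) 1
      ⟨some (.inl false), (flag false, idle), tapes ρ fun _ _ => []⟩
      ⟨some (.inr (.inr mainProg.entry)), (flag false, idle), tapes ρ fun _ _ => []⟩ :=
    StepsTo.one rfl
  have h₂ := h.host_exit (e := .inr ∘ .inr) (x := some (.inl true)) (m' := enumCode A) fun _ => rfl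
  have h₃ : StepsTo (enumCode A) 1
      ⟨some (.inl true), (flag b, idle), tapes ρ' fun _ _ => []⟩
      ⟨if b then none else some (.inl false), (flag b, idle), tapes ρ' fun _ _ => []⟩ := by
    refine StepsTo.one ?_
    cases b <;> rfl
  refine ⟨1 + t + 1, by omega, by omega, (h₁.trans h₂).trans h₃, fun s c' hs hs' hc' => ?_⟩
  obtain ⟨s, rfl⟩ := Nat.exists_eq_add_of_le hs
  have hc'' : StepsTo (enumCode A) (1 + s) _ c' := hc'
  -- Strictly inside the leg the machine is at a label of `mainProg` or, at the very last moment, at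
  -- the branch; neither is an output label.
  rcases Nat.lt_or_ge s t with hst | hst
  · obtain ⟨l', v', S', h₄⟩ := h.host_before (e := .inr ∘ .inr) (x := some (.inl true))
      (m' := enumCode A) (fun _ => rfl) hst
    rw [hc''.unique (h₁.trans h₄)]
    exact ⟨_, inr_notMem_emit _, rfl⟩
  · obtain rfl : s = t := by omega
    rw [hc''.unique (h₁.trans h₂)]
    exact ⟨_, inl_true_notMem_emit, rfl⟩

/-- Each pair of moves is one leg. At every output label the tapes hold at most `Fintype.card Reg *
B` symbols, so only the growth during a single leg has to be added, at most `C` symbols for each of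
at most `d` steps. -/
theorem lists_emitCfg (h : Setting A S i π N F₀ B) {C : ℕ} (hC : ∀ t c c',
      StepsTo (enumMachine A).tm.m t c c' →
        (enumMachine A).space c' ≤ (enumMachine A).space c + C * t)
    {d b : ℕ} (hd : delayBound B ≤ d) (hb : Fintype.card Reg * B + C * d ≤ b)
    {s : maxSets (S.sets i) × List (maxSets (S.sets i))} {outs : List (maxSets (S.sets i))}
    (ht : PairTour F₀ (parent N F₀ π) (kids N F₀ π) s outs) (o : maxSets (S.sets i))
    (hs : s.2 <:+ kids N F₀ π s.1) (ho : (o :: outs).Nodup) :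
    (enumMachine A).Lists d b (emitCfg A F₀ s o) ((o :: outs).map fun F => code F.1) := by
  unfold delayBound at hd
  have hspace : ∀ (l : Option (enumMachine A).tm.Λ) (v : Vars A)
      (s : maxSets (S.sets i) × List (maxSets (S.sets i))) (o : maxSets (S.sets i)),
      s.2 <:+ kids N F₀ π s.1 →
      (enumMachine A).space ⟨l, v, tapes (stateRegs F₀ s.1 s.2 o) fun _ _ => []⟩ ≤
        Fintype.card Reg * B := fun l v s o hs => by
    rw [space_enumMachine]
    exact sum_stateRegs_le h hs
  have hspace' : ∀ (s : maxSets (S.sets i) × List (maxSets (S.sets i))) (o : maxSets (S.sets i)),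
      s.2 <:+ kids N F₀ π s.1 → ∀ t c', t ≤ d →
      StepsTo (enumMachine A).tm.m t (emitCfg A F₀ s o) c' → (enumMachine A).space c' ≤ b := by
    intro s o hs t c' ht' hc'
    have h1 := hC t (emitCfg A F₀ s o) c' hc'
    have h2 : (enumMachine A).space (emitCfg A F₀ s o) ≤ Fintype.card Reg * B :=
      hspace (some (.inl false)) (flag false, idle) s o hs
    have h3 := Nat.mul_le_mul_left C ht'
    exact h1.trans ((Nat.add_le_add h2 h3).trans hb)
  have hdis : ∀ {o : maxSets (S.sets i)} {outs : List (maxSets (S.sets i))}, (o :: outs).Nodup →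
      ∀ v ∈ [code o.1], v ∉ outs.map fun F => code F.1 := by
    intro o outs ho v hv hv'
    obtain rfl := List.mem_singleton.1 hv
    obtain ⟨G, hG, hG'⟩ := List.mem_map.1 hv'
    rw [code_injective hG'] at hG
    exact (List.nodup_cons.1 ho).1 hG
  induction ht generalizing o with
  | nil =>
    obtain ⟨t, ht, ht₀, h₁, h₂⟩ := exists_leg (does_mainProg_done h false (o := o))
    rw [if_pos rfl] at h₁
    have hlist := EnumMachine.Lists.of_halted (M := enumMachine A) (d := d) (b := b)
      (c := ⟨none, (flag true, idle), tapes (stateRegs F₀ F₀ [] o) fun _ _ => []⟩) rfl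
      ((hspace _ _ (F₀, []) o hs).trans ((Nat.le_add_right _ _).trans hb))
    exact EnumMachine.Lists.leg (M := enumMachine A) (c := emitCfg A F₀ (F₀, []) o)
      (pre := [code o.1]) (vs := []) h₁ ht₀ (by omega) h₂ (hspace' (F₀, []) o hs)
      (emits_emitCfg _ _) (hdis ho) hlist (.inl rfl)
  | @cons s outs hs₁ hs₂ ht ih =>
    obtain ⟨t, ht, ht₀, h₁, h₂⟩ := exists_leg (does_mainProg h false (o := o) hs₁ hs rfl hs₂)
    rw [if_neg (by simp)] at h₁
    have hlist := ih (visited (move (parent N F₀ π) (kids N F₀ π) s)) (move_suffix _)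
      (List.nodup_cons.1 ho).2
    exact EnumMachine.Lists.leg (M := enumMachine A) (c := emitCfg A F₀ s o)
      (pre := [code o.1]) h₁ ht₀ (by omega) h₂ (hspace' s o hs) (emits_emitCfg _ _) (hdis ho) hlist
      (.inr ⟨_, (emits_emitCfg _ _ _).2 (List.mem_singleton.2 rfl)⟩)

theorem finite_maxSets : Finite (maxSets (S.sets i)) :=
  haveI := Finite.of_equiv _ (S.num i).symm
  inferInstance

theorem enumMachine_enumerates (h : Setting A S i π N F₀ B) {C : ℕ} (hC : ∀ t c c',
      StepsTo (enumMachine A).tm.m t c c' →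
        (enumMachine A).space c' ≤ (enumMachine A).space c + C * t)
    {d b : ℕ} (hd : delayBound B ≤ d) (hb : Fintype.card Reg * B + C * d ≤ b) :
    (enumMachine A).Enumerates (encWords [S.encode i]) (fun F => encWords [S.charVec F])
      (maxSets (S.sets i)) d b := by
  have := finite_maxSets (i := i)
  obtain ⟨lt, hlt, hpar⟩ := exists_order (F₀ := F₀) h.scheme h.prefixClosed h.closer
  obtain ⟨outs, h₁, h₂, h₃⟩ := exists_pairTour (root := F₀) (par := parent N F₀ π)
    (ch := kids N F₀ π) nodup_kids (mem_kids h) hlt hpar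
  have hl := lists_emitCfg h hC hd hb h₁ F₀ List.suffix_rfl h₂
  set ρ : Reg → List Sym := Function.update (fun _ => []) .inst (encWord (S.encode i)) with hρ
  unfold delayBound at hd
  obtain ⟨t, ht, hi⟩ := does_initProg (A := A) h false hρ
  have e : initList (enumMachine A).tm
      ((encWords [S.encode i]).map (enumMachine A).inputAlphabet.invFun) =
      ⟨some (.inr (.inl initProg.entry)), (flag false, idle), tapes ρ fun _ _ => []⟩ := by
    have e₁ : (encWords [S.encode i]).map (enumMachine A).inputAlphabet.invFun =
        encWord (S.encode i) := by
      rw [encWords_cons]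
      exact (List.map_id _).trans (List.append_nil _)
    have e₂ : (initList (enumMachine A).tm (encWord (S.encode i))).stk = tapes ρ fun _ _ => [] := by
      refine (stk_initList (enumMachine A).tm (encWord (S.encode i))).trans ?_
      exact (update_tapes_inl (A := A) (fun _ => []) (fun _ _ => []) Reg.inst _).symm ▸ by
        funext k
        cases k <;> rfl
    rw [e₁, ← e₂]
    rfl
  have hd₁ := hi.host_exit (e := .inr ∘ .inl) (x := some (.inl false)) (m' := enumCode A)
    fun _ => rfl
  -- The preparation starts at a label and ends outside the fragment, so it takes at least one step.
  have ht₀ : 0 < t := by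
    rcases Nat.eq_zero_or_pos t with rfl | h
    · cases hi.of_zero
    · exact h
  have hρB : ∑ r, (ρ r).length ≤ Fintype.card Reg * B := by
    rw [← smul_eq_mul]
    refine Finset.sum_le_card_nsmul _ _ _ fun r _ => ?_
    have h1 := h.inst_le
    cases r <;> simp [hρ, h1]
  refine EnumMachine.Lists.enumerates (l := (F₀ :: outs).map Subtype.val) ?_ fun F => ?_
  · rw [e, List.map_map]
    have hl' : (enumMachine A).Lists d b (emitCfg A F₀ (F₀, kids N F₀ π F₀) F₀)
        ((F₀ :: outs).map ((fun F => encWords [S.charVec F]) ∘ Subtype.val)) := by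
      convert hl using 1
      refine List.map_congr_left fun F _ => ?_
      simp [encWords_cons, code]
      rfl
    refine EnumMachine.Lists.leg (M := enumMachine A) (pre := [])
      (c₁ := emitCfg A F₀ (F₀, kids N F₀ π F₀) F₀) hd₁ ht₀ (by omega) ?_ ?_ ?_
      (by simp) hl' (.inr ⟨_, (emits_emitCfg _ _ _).2 (List.mem_singleton.2 rfl)⟩)
    · intro s c' hs hst hc'
      obtain ⟨l', v', S', h₄⟩ := hi.host_before (e := .inr ∘ .inl) (x := some (.inl false))
        (m' := enumCode A) (fun _ => rfl) hst
      have hc'' : StepsTo (enumCode A) s _ c' := hc'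
      rw [hc''.unique h₄]
      exact ⟨_, inr_notMem_emit _, rfl⟩
    · intro s c' hs hc'
      have h1 := hC _ _ _ hc'
      rw [space_enumMachine] at h1
      exact h1.trans ((Nat.add_le_add hρB (Nat.mul_le_mul_left C hs)).trans hb)
    · rintro v
      refine ⟨?_, by simp⟩
      rintro ⟨⟨l, hl, hl'⟩, -⟩
      cases hl'
      exact absurd hl (inr_notMem_emit _)
  · rw [List.mem_map]
    constructor
    · rintro ⟨G, -, rfl⟩
      exact G.2
    · exact fun hF => ⟨⟨F, hF⟩, h₃ _, rfl⟩

end Machine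

end ProximitySearch

namespace ProximitySearch

open Turing

/-! ### Polynomial bounds -/

/-- The function is given by a polynomial with natural coefficients. -/
def PolyFun (f : ℕ → ℕ) : Prop := ∃ p : Polynomial ℕ, ∀ n, p.eval n = f n

theorem PolyFun.const (c : ℕ) : PolyFun fun _ => c := ⟨.C c, by simp⟩

theorem PolyFun.id : PolyFun fun n => n := ⟨.X, by simp⟩

theorem PolyFun.add {f g : ℕ → ℕ} (hf : PolyFun f) (hg : PolyFun g) : PolyFun fun n => f n + g n :=
  let ⟨p, hp⟩ := hf
  let ⟨q, hq⟩ := hg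
  ⟨p + q, by simp [hp, hq]⟩

theorem PolyFun.mul {f g : ℕ → ℕ} (hf : PolyFun f) (hg : PolyFun g) : PolyFun fun n => f n * g n :=
  let ⟨p, hp⟩ := hf
  let ⟨q, hq⟩ := hg
  ⟨p * q, by simp [hp, hq]⟩

theorem PolyFun.comp {f g : ℕ → ℕ} (hf : PolyFun f) (hg : PolyFun g) : PolyFun fun n => f (g n) :=
  let ⟨p, hp⟩ := hf
  let ⟨q, hq⟩ := hg
  ⟨p.comp q, by simp [hp, hq]⟩

theorem polyFun_eval (p : Polynomial ℕ) : PolyFun fun n => p.eval n := ⟨p, fun _ => rfl⟩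

theorem eval_mono (p : Polynomial ℕ) {m n : ℕ} (h : m ≤ n) : p.eval m ≤ p.eval n := by
  rw [Polynomial.eval_eq_sum, Polynomial.eval_eq_sum]
  exact Finset.sum_le_sum fun k _ => Nat.mul_le_mul_left _ (Nat.pow_le_pow_left h k)

theorem polyFun_tParent : PolyFun tParent := by
  have h1 : PolyFun tChange := (((PolyFun.id.mul (((PolyFun.const 10).mul .id).add (.const 22))).add
    ((PolyFun.const 27).mul .id)).add (.const 30))
  have h2 : PolyFun tRead := (h1.add ((PolyFun.const 10).mul .id)).add (.const 30)
  exact ((PolyFun.id.mul (h2.add (.const 2))).add ((PolyFun.const 40).mul .id)).add (.const 50)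

theorem polyFun_tKids : PolyFun tKids := by
  have h1 : PolyFun tMem := ((PolyFun.id.mul (((PolyFun.const 20).mul .id).add (.const 40))).add
    ((PolyFun.const 30).mul .id)).add (.const 60)
  have h2 : PolyFun tAdd := ((polyFun_tParent.add h1).add ((PolyFun.const 60).mul .id)).add
    (.const 100)
  exact ((PolyFun.id.mul (h2.add (.const 2))).add ((PolyFun.const 40).mul .id)).add (.const 60)

theorem polyFun_delayBound : PolyFun delayBound := by
  have h1 : PolyFun tLeave := ((((polyFun_tKids.add polyFun_tParent).add
    (PolyFun.id.mul (((PolyFun.const 10).mul .id).add (.const 22)))).add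
    ((PolyFun.const 60).mul .id)).add (.const 100))
  have h2 : PolyFun tEnter := (polyFun_tKids.add ((PolyFun.const 30).mul .id)).add (.const 60)
  have h3 : PolyFun tMove := (h2.add h1).add (.const 2)
  have h4 : PolyFun tMain := (((PolyFun.const 2).mul h3).add ((PolyFun.const 10).mul .id)).add
    (.const 40)
  have h5 : PolyFun tInit := (polyFun_tKids.add ((PolyFun.const 30).mul .id)).add (.const 60)
  exact (h5.add h4).add (.const 2)

theorem stackSize_single {K : Type} [DecidableEq K] [Fintype K] {Γ : K → Type} (k : K)
    (w : List (Γ k)) : stackSize (single k w) = w.length := by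
  have := stackSize_update (fun k => ([] : List (Γ k))) k w
  simpa [stackSize, single] using this

/-- The output is on a tape at the end, so it is no longer than the input plus all symbols pushed
during the computation. -/
theorem exists_output_bound (M : TM2ComputableAux Sym Sym) : ∃ C, ∀ (w w' : List Sym) (n : ℕ),
    TM2OutputsInTime M.tm (w.map M.inputAlphabet.invFun) (some (w'.map M.outputAlphabet.invFun)) n →
      w'.length ≤ w.length + C * n := by
  let := M.tm.kFin
  let := M.tm.ΛFin
  obtain ⟨C, hC⟩ := exists_stackSize_bound M.tm.m
  refine ⟨C, fun w w' n h => ?_⟩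
  have h1 : StepsTo M.tm.m h.steps (initList M.tm (w.map M.inputAlphabet.invFun))
    (haltList M.tm (w'.map M.outputAlphabet.invFun)) := h.evals_in_steps
  have h2 := hC _ _ _ h1
  rw [stk_initList, stk_haltList, stackSize_single, stackSize_single, List.length_map,
    List.length_map] at h2
  exact h2.trans (Nat.add_le_add_left (Nat.mul_le_mul_left C h.steps_le_m) _)

/-- The time of a call of a machine on inputs that are not longer than `ℓ`, and a bound for the
lengths of its inputs and outputs. -/
theorem exists_call_bound {J : Type} [DecidableEq J] {R : Type} [DecidableEq R]
    (A : J → TM2ComputableAux Sym Sym) (j : J) (time : Polynomial ℕ) :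
    ∃ β : ℕ → ℕ, PolyFun β ∧ (∀ ℓ, ℓ ≤ β ℓ) ∧ ∀ (ℓ : ℕ) (w w' : List Sym), w.length ≤ ℓ →
      TM2OutputsInTime (A j).tm (w.map (A j).inputAlphabet.invFun)
        (some (w'.map (A j).outputAlphabet.invFun)) (time.eval w.length) →
      w'.length ≤ β ℓ ∧ ∀ (r : R) (b : Bool) (ρ : R → List Sym), ρ r = w.reverse →
        Does (A := A) (call j r) (flag b) ρ (β ℓ) (flag b) (Function.update ρ r w'.reverse) := by
  obtain ⟨C, hC⟩ := exists_output_bound (A j)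
  -- A call costs twice the input, the running time, twice the output and 8 steps; the output has at
  -- most ℓ + C · time(ℓ) symbols.
  refine ⟨fun ℓ => 4 * ℓ + (2 * C + 1) * time.eval ℓ + 8,
    (((PolyFun.const 4).mul .id).add ((PolyFun.const (2 * C + 1)).mul (polyFun_eval time))).add
      (.const 8), fun ℓ => by dsimp only; omega, fun ℓ w w' hw h => ?_⟩
  have h1 := hC _ _ _ h
  have h2 := eval_mono time hw
  have h3 := Nat.mul_le_mul_left C h2
  have h4 : (2 * C + 1) * time.eval ℓ = 2 * (C * time.eval ℓ) + time.eval ℓ := by ring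
  refine ⟨by dsimp only; omega, fun r b ρ hr => (does_call j r b ρ h hr).mono ?_⟩
  dsimp only
  omega

/-- The subroutines. -/
def subs (M₁ M₂ M₃ : TM2ComputableAux Sym Sym) : Sub → TM2ComputableAux Sym Sym
  | .first => M₁
  | .order => M₂
  | .nbrs => M₃

theorem enumerablePolyDelayPolySpace (S : SetSystemFamily)
    (π : ∀ i, S.sets i → List (S.U i))
    (hπ : ∀ i, IsOrderingScheme (S.sets i) (π i))
    (hπ_poly : S.PolyTimeOrdering π)
    (hπ_prox : S.ProximitySearchable π)
    (hπ_prefix : ∀ i, IsPrefixClosed (S.sets i) (π i))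
    (hF₀ : S.PolyTimeMaximalSet) :
    S.EnumerablePolyDelayPolySpace := by
  obtain ⟨F₀, ⟨c₁⟩⟩ := hF₀
  obtain ⟨c₂⟩ := hπ_poly
  obtain ⟨N, ⟨c₃⟩, hN⟩ := hπ_prox
  obtain ⟨p, hp⟩ := S.size_le
  set A := subs c₁.toTM2ComputableAux c₂.toTM2ComputableAux c₃.toTM2ComputableAux with hA
  obtain ⟨β₁, i₁, m₁, b₁⟩ := exists_call_bound (R := Reg) A .first c₁.time
  obtain ⟨β₂, i₂, m₂, b₂⟩ := exists_call_bound (R := Reg) A .order c₂.time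
  obtain ⟨β₃, i₃, m₃, b₃⟩ := exists_call_bound (R := Reg) A .nbrs c₃.time
  obtain ⟨C, hC⟩ := (enumMachine A).exists_space_bound
  -- The longest input of a subroutine consists of the instance and one characteristic vector, each
  -- with its end mark.
  have iℓ : PolyFun fun n => n + p.eval n + 2 := (PolyFun.id.add (polyFun_eval p)).add (.const 2)
  have iB : PolyFun fun n => β₁ (n + p.eval n + 2) + β₂ (n + p.eval n + 2) + β₃ (n + p.eval n + 2) :=
    ((i₁.comp iℓ).add (i₂.comp iℓ)).add (i₃.comp iℓ)
  obtain ⟨q₁, hq₁⟩ := polyFun_delayBound.comp iB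
  obtain ⟨q₂, hq₂⟩ := ((PolyFun.const (Fintype.card Reg)).mul iB).add
    ((PolyFun.const C).mul (polyFun_delayBound.comp iB))
  refine ⟨enumMachine A, q₁, q₂, fun i => ?_⟩
  rw [hq₁, hq₂]
  set n := (S.encode i).length with hn
  set ℓ := n + p.eval n + 2 with hℓ
  have hs : S.size i ≤ p.eval n := hp i
  -- As `β₁ ℓ` is at least ℓ, the common bound also covers the instance and the characteristic
  -- vectors.
  have l₁ := m₁ ℓ
  have e₁ : encWords [S.encode i] = encWord (S.encode i) := List.append_nil _
  have e₂ : ∀ F : Finset (S.U i), encWords [S.encode i, S.charVec F] =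
      encWord (S.encode i) ++ code F := fun F =>
    congrArg (encWord (S.encode i) ++ ·) (List.append_nil (code F))
  have e₃ : ∀ F : Finset (S.U i), (encWord (S.encode i) ++ code F).length ≤ ℓ := fun F => by
    rw [List.length_append, length_encWord, length_encWord, length_charVec]
    omega
  have f₁ := b₁ ℓ (encWord (S.encode i)) (code (F₀ i).1) (by rw [length_encWord]; omega) (by
    have := c₁.outputsFun i
    rw [e₁, show encWords [S.charVec (F₀ i).1] = code (F₀ i).1 from List.append_nil _] at this
    exact this)
  have f₂ := fun F : maxSets (S.sets i) => b₂ ℓ (encWord (S.encode i) ++ code F.1)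
    (elems (π i (maxToMem F))) (e₃ F.1) (by
      have := c₂.outputsFun ⟨i, maxToMem F⟩
      rw [show encWords [S.encode i, S.charVec (maxToMem F).1] = _ from e₂ F.1] at this
      exact this)
  have f₃ := fun F : maxSets (S.sets i) => b₃ ℓ (encWord (S.encode i) ++ code F.1)
    (codes (N i F)) (e₃ F.1) (by
      have := c₃.outputsFun ⟨i, F⟩
      rw [e₂] at this
      exact this)
  have hset : Setting A S i (π i) (N i) (F₀ i) (β₁ ℓ + β₂ ℓ + β₃ ℓ) :=
    { scheme := hπ i
      prefixClosed := hπ_prefix i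
      closer := hN i
      inst_le := by omega
      size_le := by omega
      nbrs_le := fun F => (f₃ F).1.trans (by omega)
      order_le := fun F => (f₂ F).1.trans (by omega)
      first := fun ρ b h => (f₁.2 .inp b ρ h).mono (by omega)
      order := fun F ρ b h => ((f₂ F).2 .inp b ρ h).mono (by omega)
      nbrs := fun F ρ b h => ((f₃ F).2 .inp b ρ h).mono (by omega) }
  exact enumMachine_enumerates hset hC le_rfl le_rfl

end ProximitySearch

theorem mainTheorem2 (S : ProximitySearch.SetSystemFamily)
    (π : ∀ i, S.sets i → List (S.U i))
    (hπ : ∀ i, ProximitySearch.IsOrderingScheme (S.sets i) (π i))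
    (hπ_poly : S.PolyTimeOrdering π)
    (hπ_prox : S.ProximitySearchable π)
    (hπ_prefix : ∀ i, ProximitySearch.IsPrefixClosed (S.sets i) (π i))
    (hF₀ : S.PolyTimeMaximalSet) :
    S.EnumerablePolyDelayPolySpace :=
  ProximitySearch.enumerablePolyDelayPolySpace S π hπ hπ_poly hπ_prox hπ_prefix hF₀
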